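/- **Notation.** For $0<\alpha<1$ and $k\ge 0$ let $C^{k,\alpha}_*(\mathbb R)$ be the space of $f\in C^k(\mathbb R)$ with $$\|f\|^*_{k,\alpha}:=\sup_{s\in\mathbb R,\,j\le k}(1+|s|^{1+\alpha})|\partial_s^jf(s)|+\sup_{s\in\mathbb R,\,0<|\xi|\le1}(1+|s|^{1+\alpha})\frac{|\partial_s^kf(s-\xi)-\partial_s^kf(s)|}{|\xi|^\alpha}<\infty ,$$ and $C^\alpha_*:=C^{0,\alpha}_*$. Let $N\ge 1$ be an integer, $T>0$, $\alpha,\alpha'\in(0,1)$, $\beta\in\mathbb R$. Let $z(s,t)=\beta s+\tilde z(s,t)$ with $\tilde z\in C^1([0,T];C^{1,\alpha}_*(\mathbb R))$, and let $c:\mathbb R\to\mathbb R$ be differentiable with $\partial_sc\in C^{\alpha'}_*(\mathbb R)$ and $0<c(s)\le c_{max}$ for all $s$, for some $c_{max}<\frac{2N-1}{N}$. Set $$c_i(s)=\tfrac{2i-1}{2N-1}c(s),\qquad c_{-i}=-c_i\quad(1\le i\le N),\qquad z^{(i)}(s,t)=z(s,t)+c_i(s)t\quad(i=\pm1,\dots,\pm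 N),$$ $\Gamma^{(i)}(t)=\{(s,z^{(i)}(s,t)):s\in\mathbb R\}$, and $$\Omega^+(t)=\{x_2>z(x_1,t)+c(x_1)t\},\quad \Omega^-(t)=\{x_2<z(x_1,t)-c(x_1)t\},\quad \Omega_{mix}(t)=\{|x_2-z(x_1,t)|<c(x_1)t\}.$$ Let $\rho$ be the piecewise constant density $$\rho(x,t)=\begin{cases}\pm1,& x\in\Omega^\pm(t),\\ \frac iN,& c_i(x_1)t<x_2-z(x_1,t)<c_{i+1}(x_1)t\quad(1\le i\le N-1),\\ 0,&|x_2-z(x_1,t)|<c_1(x_1)t,\\ -\frac iN,& c_i(x_1)t<z(x_1,t)-x_2<c_{i+1}(x_1)t\quad(1\le i\le N-1),\end{cases}$$ with initial value $\rho_0=1$ for $x_2>z(x_1,0)$ and $\rho_0=-1$ for $x_2<z(x_1,0)$. Let $u$ be the velocity determined from $\operatorname{div}u=0$, $\operatorname{curl}u=-\partial_{x_1}\rho$ by the Biot–Savart law, i.e. for $t>0$ and $x\notin\bigcup_j\Gamma^{(j)}(t)$ $$u(x,t)=\lim_{R\to\infty}\sum_{j=\pm1,\dots,\pm N}\frac1{2\pi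 N}\int_{-R}^{R}\frac{\bigl(-(x_2-z^{(j)}(x_1-\xi,t)),\ \xi\bigr)}{\xi^2+(x_2-z^{(j)}(x_1-\xi,t))^2}\,\partial_sz^{(j)}(x_1-\xi,t)\,d\xi ,$$ and let $u_\nu^{(i)}(s,t)=u(s,z^{(i)}(s,t),t)\cdot(-\partial_sz^{(i)}(s,t),1)$ be its normal component on $\Gamma^{(i)}$ (the value on $\Gamma^{(i)}$ being the trace, i.e. the limit of $u(x,t)\cdot(-\partial_sz^{(i)}(s,t),1)$ along points $x$ off the interfaces). **Proposition.** Assume that $$\lim_{t\downarrow0}\sup_s\frac1{c(s)}\bigl|\partial_tz(s,t)-u_\nu^{(i)}(s,t)\bigr|=0\qquad\text{for all }i=\pm1,\dots,\pm N,$$ $$\lim_{t\downarrow0}\sup_s\frac1{t\,c(s)^{3/2}}\Bigl|\int_0^s\Bigl(\partial_tz(s',t)-\sum_{i=1}^N\frac{u_\nu^{(+i)}(s',t)+u_\nu^{(-i)}(s',t)}{2N}\Bigr)ds'\Bigr|=0,$$ and that for some $M>0$ $$|\partial_sz(s,t)|\le Mc(s)^{1/2},\quad |\partial_sc(s)|\le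 Mc(s)^{1/2}\qquad\text{for all }s\in\mathbb R,\ t\in[0,T].$$ Then there are $T'\in(0,T]$ and a vector field $m:\mathbb R^2\times(0,T')\to\mathbb R^2$ such that $(\rho,u,m)$ is an admissible subsolution on $[0,T')$ with mixing zone $\Omega_{mix}=\bigcup_{0<t<T'}\Omega_{mix}(t)\times\{t\}$. That is, with $\Omega^\pm=\bigcup_{0<t<T'}\Omega^\pm(t)\times\{t\}$ and $\Gamma=\bigcup_{0\le t<T'}\bigcup_{i}\Gamma^{(i)}(t)\times\{t\}$: - $(\rho,u,m)\in L^\infty(\mathbb R^2\times[0,T'))$; the sets $\Omega^\pm,\Omega_{mix}$ are open and connected and $\overline{\Omega^+}\cup\overline{\Omega^-}\cup\Omega_{mix}=\mathbb R^2\times[0,T')$, with closures taken in $\mathbb R^2\times[0,T')$; - (i) $\partial_t\rho+\operatorname{div}m=0$, $\operatorname{div}u=0$, $\operatorname{curl}u=-\partial_{x_1}\rho$, $\rho|_{t=0}=\rho_0$ in the sense of distributions in $\mathbb R^2\times[0,T')$; - (ii) $\bigl|m-\rho u+\tfrac12(0,1-\rho^2)\bigr|\le\tfrac12(1-\rho^2)$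 almost everywhere; - (iii) $|\rho|=1$ in $\Omega^+\cup\Omega^-$; - (iv) $\Gamma$ is a null set, $\Omega_{mix}\setminus\Gamma$ is open, the triple $(\rho,u,m)$ is continuous in $\Omega_{mix}\setminus\Gamma$, and there the inequality in (ii) is strict. (For $N=1$ one has $\Omega_{mix}\setminus\Gamma=\Omega_{mix}$.) -/

import Mathlib

open Set Filter Topology MeasureTheory
open scoped ENNReal ContDiff

noncomputable section

namespace Muskat

/-- The plane with its Euclidean norm; the coordinates `x₁, x₂` of the mathematics are
`x 0, x 1`. Points of space-time are pairs `(x, t)`. -/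
abbrev Plane : Type := EuclideanSpace ℝ (Fin 2)

/-! ### Weighted Hölder spaces on the line -/

/-- The weighted Hölder norm
`sup_{s, j ≤ k} (1+|s|^{1+α}) |∂ʲf(s)| + sup_{s, |ξ| ≤ 1} (1+|s|^{1+α}) |∂ᵏf(s-ξ) - ∂ᵏf(s)| / |ξ|^α`,
with values in `[0, ∞]`. -/
def starNorm (k : ℕ) (α : ℝ) (f : ℝ → ℝ) : ℝ≥0∞ :=
  (⨆ (s : ℝ) (j : ℕ) (_ : j ≤ k),
      ENNReal.ofReal ((1 + |s| ^ (1 + α)) * |iteratedDeriv j f s|)) +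
  ⨆ (s : ℝ) (ξ : ℝ) (_ : |ξ| ≤ 1),
      ENNReal.ofReal ((1 + |s| ^ (1 + α)) *
        (|iteratedDeriv k f (s - ξ) - iteratedDeriv k f s| / |ξ| ^ α))

/-- Membership in the weighted Hölder space `C_*^{k,α}(ℝ)`. -/
def MemStar (k : ℕ) (α : ℝ) (f : ℝ → ℝ) : Prop :=
  ContDiff ℝ k f ∧ starNorm k α f < ⊤

/-- `f ∈ C¹([0,T]; C_*^{k,α}(ℝ))`, for `f = f(s,t)`: the curve `t ↦ f(·,t)` takes values in
`C_*^{k,α}` and is continuously differentiable on `[0,T]` (one-sidedly at the end points)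
with respect to the norm of that space. -/
def C1InTime (k : ℕ) (α T : ℝ) (f : ℝ → ℝ → ℝ) : Prop :=
  ∃ f' : ℝ → ℝ → ℝ,
    (∀ t ∈ Icc 0 T, MemStar k α (fun s => f s t) ∧ MemStar k α (fun s => f' s t)) ∧
    (∀ t ∈ Icc 0 T,
      Tendsto (fun τ => starNorm k α (fun s => (f s τ - f s t) / (τ - t) - f' s t))
        (𝓝[Icc 0 T \ {t}] t) (𝓝 0)) ∧
    (∀ t ∈ Icc 0 T,
      Tendsto (fun τ => starNorm k α (fun s => f' s τ - f' s t)) (𝓝[Icc 0 T] t) (𝓝 0))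

/-! ### Interfaces and density -/

/-- The index set `{±1, …, ±N}` of the interfaces. -/
def indices (N : ℕ) : Finset ℤ := (Finset.Icc (-(N : ℤ)) (N : ℤ)).erase 0

/-- `c_i = (2i-1)/(2N-1) c` for `i > 0`, and `c_{-i} = -c_i`. -/
def speed (N : ℕ) (c : ℝ → ℝ) (i : ℤ) (s : ℝ) : ℝ :=
  (i.sign : ℝ) * ((2 * |(i : ℝ)| - 1) / (2 * N - 1)) * c s

/-- `z^{(i)}(s,t) = z(s,t) + c_i(s) t`, for `i = ±1, …, ±N`. -/
def iface (N : ℕ) (c : ℝ → ℝ) (z : ℝ → ℝ → ℝ) (i : ℤ) (s t : ℝ) : ℝ :=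
  z s t + speed N c i s * t

open Classical in
/-- The piecewise constant density, `i/N` between the `i`-th and the `(i+1)`-th interface above
`z`, `-i/N` in the mirror layer, `0` in the middle layer, `±1` outside of the mixing zone.
(On the interfaces, a null set, a value is chosen arbitrarily.) -/
def density (N : ℕ) (c : ℝ → ℝ) (z : ℝ → ℝ → ℝ) (p : Plane × ℝ) : ℝ :=
  let x := p.1
  let t := p.2
  if z (x 0) t + c (x 0) * t < x 1 then 1
  else if x 1 < z (x 0) t - c (x 0) * t then -1
  else ∑ i ∈ Finset.Icc 1 (N - 1),
    ((if speed N c i (x 0) * t < x 1 - z (x 0) t ∧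
          x 1 - z (x 0) t < speed N c (i + 1) (x 0) * t then (i : ℝ) / N else 0) +
     (if speed N c i (x 0) * t < z (x 0) t - x 1 ∧
          z (x 0) t - x 1 < speed N c (i + 1) (x 0) * t then -((i : ℝ) / N) else 0))

open Classical in
/-- The initial density: `+1` above the graph of `z₀` and `-1` below it. -/
def initialDensity (z₀ : ℝ → ℝ) (x : Plane) : ℝ := if z₀ (x 0) < x 1 then 1 else -1

/-! ### Velocity -/

/-- The Biot–Savart kernel `y^⊥ / (2π|y|²)`, where `y^⊥ = (-y₂, y₁)`. -/
def bsKernel (y : Plane) : Plane := (2 * Real.pi * ‖y‖ ^ 2)⁻¹ • !₂[-(y 1), y 0]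

/-- The velocity at `x` of the vortex sheet on the graph of `ζ` with vorticity
`ζ'(s) ds` in the graph parametrization, truncated to `|x₁ - s| ≤ R`; `ξ = x₁ - s`. -/
def sheetVelocity (ζ : ℝ → ℝ) (R : ℝ) (x : Plane) : Plane :=
  ∫ ξ in (-R)..R, deriv ζ (x 0 - ξ) • bsKernel !₂[ξ, x 1 - ζ (x 0 - ξ)]

/-- The velocity `u` given by the Biot–Savart law from the vorticity `-∂_{x₁}ρ`.
As `ρ` jumps by `1/N` across every interface, `-∂_{x₁}ρ` is the sum over `j` of the measures
`(1/N) ∂_s z^{(j)}(s) ds` on the graphs of the `z^{(j)}`. The integral over the line is the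
principal value at infinity, `lim_{R → ∞} ∫_{-R}^{R}`. -/
def velocity (N : ℕ) (c : ℝ → ℝ) (z : ℝ → ℝ → ℝ) (p : Plane × ℝ) : Plane :=
  limUnder atTop (fun R : ℝ => ∑ j ∈ indices N,
    (1 / (N : ℝ)) • sheetVelocity (fun s => iface N c z j s p.2) R p.1)

/-- The complement of the interfaces at time `t`. -/
def offInterfaces (N : ℕ) (c : ℝ → ℝ) (z : ℝ → ℝ → ℝ) (t : ℝ) : Set Plane :=
  {x | ∀ j ∈ indices N, x 1 ≠ iface N c z j (x 0) t}

/-- The normal component `u_ν^{(i)}(s,t) = u(s, z^{(i)}(s,t), t) · (-∂_s z^{(i)}(s,t), 1)`, where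
the value on the interface is the trace: the limit along points off the interfaces. -/
def normalVelocity (N : ℕ) (c : ℝ → ℝ) (z : ℝ → ℝ → ℝ) (i : ℤ) (s t : ℝ) : ℝ :=
  limUnder (𝓝[offInterfaces N c z t] (!₂[s, iface N c z i s t] : Plane))
    (fun x => -(deriv (fun s' => iface N c z i s' t) s) * velocity N c z (x, t) 0
      + velocity N c z (x, t) 1)

/-! ### Mixing zone -/

/-- `Ω⁺`, up to time `T`. -/
def omegaPlus (c : ℝ → ℝ) (z : ℝ → ℝ → ℝ) (T : ℝ) : Set (Plane × ℝ) :=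
  {p | 0 < p.2 ∧ p.2 < T ∧ z (p.1 0) p.2 + c (p.1 0) * p.2 < p.1 1}

/-- `Ω⁻`, up to time `T`. -/
def omegaMinus (c : ℝ → ℝ) (z : ℝ → ℝ → ℝ) (T : ℝ) : Set (Plane × ℝ) :=
  {p | 0 < p.2 ∧ p.2 < T ∧ p.1 1 < z (p.1 0) p.2 - c (p.1 0) * p.2}

/-- The mixing zone `Ω_mix`, up to time `T`. -/
def omegaMix (c : ℝ → ℝ) (z : ℝ → ℝ → ℝ) (T : ℝ) : Set (Plane × ℝ) :=
  {p | 0 < p.2 ∧ p.2 < T ∧ z (p.1 0) p.2 - c (p.1 0) * p.2 < p.1 1 ∧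
    p.1 1 < z (p.1 0) p.2 + c (p.1 0) * p.2}

/-- The union of the interfaces in space-time, up to time `T`. -/
def interfaces (N : ℕ) (c : ℝ → ℝ) (z : ℝ → ℝ → ℝ) (T : ℝ) : Set (Plane × ℝ) :=
  {p | 0 ≤ p.2 ∧ p.2 < T ∧ ∃ j ∈ indices N, p.1 1 = iface N c z j (p.1 0) p.2}

/-! ### Admissible subsolutions -/

/-- The space-time slab `ℝ² × [0,T)`. -/
def slab (T : ℝ) : Set (Plane × ℝ) := {p | 0 ≤ p.2 ∧ p.2 < T}

/-- Test functions on `ℝ² × [0,T)`: smooth, compactly supported in `{t < T}`, not necessarily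
vanishing at `t = 0`. -/
def IsTest (T : ℝ) (φ : Plane × ℝ → ℝ) : Prop :=
  ContDiff ℝ ∞ φ ∧ HasCompactSupport φ ∧ tsupport φ ⊆ {p | p.2 < T}

/-- The time derivative. -/
def dt (φ : Plane × ℝ → ℝ) (p : Plane × ℝ) : ℝ := fderiv ℝ φ p (0, 1)

/-- The partial derivative in the `i`-th space variable. -/
def dx (i : Fin 2) (φ : Plane × ℝ → ℝ) (p : Plane × ℝ) : ℝ :=
  fderiv ℝ φ p (EuclideanSpace.single i 1, 0)

/-- `∂_t ρ + div m = 0`, `div u = 0`, `curl u = -∂_{x₁} ρ`, `ρ|_{t=0} = ρ₀` in the sense of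
distributions in `ℝ² × [0,T)`, where `curl u = ∂_{x₁}u₂ - ∂_{x₂}u₁`. -/
structure SolvesSystem (T : ℝ) (ρ₀ : Plane → ℝ) (ρ : Plane × ℝ → ℝ)
    (u m : Plane × ℝ → Plane) : Prop where
  transport : ∀ φ, IsTest T φ →
    (∫ p in slab T, (ρ p * dt φ p + (m p 0 * dx 0 φ p + m p 1 * dx 1 φ p)))
      + ∫ x, ρ₀ x * φ (x, 0) = 0
  divergence : ∀ φ, IsTest T φ →
    ∫ p in slab T, (u p 0 * dx 0 φ p + u p 1 * dx 1 φ p) = 0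
  curl : ∀ φ, IsTest T φ →
    ∫ p in slab T, (u p 1 * dx 0 φ p - u p 0 * dx 1 φ p) = - ∫ p in slab T, ρ p * dx 0 φ p

/-- The vector `m - ρ u + (0, (1-ρ²)/2)`. -/
def defect (ρ : ℝ) (u m : Plane) : Plane := m - ρ • u + (1 / 2 : ℝ) • !₂[0, 1 - ρ ^ 2]

/-- `(ρ,u,m)` is an admissible subsolution on `[0,T)` with initial density `ρ₀`, with the open
domains `Ωp = Ω⁺`, `Ωm = Ω⁻`, and mixing zone `Ωmix`, and with discontinuities inside the mixing
zone confined to the null set `S`, relatively closed in the mixing zone. -/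
structure IsAdmissibleSubsolution (T : ℝ) (ρ₀ : Plane → ℝ) (ρ : Plane × ℝ → ℝ)
    (u m : Plane × ℝ → Plane) (Ωp Ωm Ωmix S : Set (Plane × ℝ)) : Prop where
  bounded_ρ : MemLp ρ ∞ (volume.restrict (slab T))
  bounded_u : MemLp u ∞ (volume.restrict (slab T))
  bounded_m : MemLp m ∞ (volume.restrict (slab T))
  domain_p : IsOpen Ωp ∧ IsConnected Ωp ∧ Ωp ⊆ slab T
  domain_m : IsOpen Ωm ∧ IsConnected Ωm ∧ Ωm ⊆ slab T
  domain_mix : IsOpen Ωmix ∧ IsConnected Ωmix ∧ Ωmix ⊆ slab T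
  /-- closures are taken relative to `ℝ² × [0,T)` -/
  cover : (closure Ωp ∩ slab T) ∪ (closure Ωm ∩ slab T) ∪ Ωmix = slab T
  system : SolvesSystem T ρ₀ ρ u m
  inequality : ∀ᵐ p ∂(volume.restrict (slab T)),
    ‖defect (ρ p) (u p) (m p)‖ ≤ 1 / 2 * (1 - ρ p ^ 2)
  pure_phase : ∀ p ∈ Ωp ∪ Ωm, |ρ p| = 1
  null_S : volume S = 0
  isOpen_diff : IsOpen (Ωmix \ S)
  continuous_ρ : ContinuousOn ρ (Ωmix \ S)
  continuous_u : ContinuousOn u (Ωmix \ S)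
  continuous_m : ContinuousOn m (Ωmix \ S)
  strict : ∀ p ∈ Ωmix \ S, ‖defect (ρ p) (u p) (m p)‖ < 1 / 2 * (1 - ρ p ^ 2)

end Muskat

end

/-!
# Subsolutions from small normal defects

**The velocity.** For a sheet with vorticity `ζ' ds` on the graph of `ζ`, the derivative of
`½ log (ξ² + (y - ζ(x - ξ))²)` in `ξ` is `(ξ + (y - ζ(x - ξ)) ζ'(x - ξ)) / (ξ² + (y - ζ(x - ξ))²)`.
Up to boundary terms that vanish at infinity, the Biot–Savart integral is therefore the principal
value of `(2π)⁻¹ ∫ (1, ζ'(x - ξ)) ξ / (ξ² + (y - ζ(x - ξ))²) dξ`. Pairing `ξ` with `-ξ` leaves an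
integrable profile and a Poisson kernel, so that the velocity is bounded (`abs_tanPair_le`,
`abs_norPair_le`, `tendsto_sheetVelocity`), and continuous off the sheet. In the component along
`(-ζ'(x), 1)` the factor `ζ'(x - ξ) - ζ'(x)` removes the Poisson kernel, and this component is
continuous across the sheet (`continuousAt_norInt`): the trace is `nu` (`normalVelocity_eq`). With a
regularized kernel one obtains the weak forms `integral_above_vel` and `integral_vel_div` of
`div u = 0`; the fundamental solution of the Laplacian gives the curl (`integral_vel_curl`).

**The momentum.** Set `m = ρ u - Q`. At a fixed time, `div (ρ u)` is concentrated on the interfaces,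
where its density is `1/N` times the normal velocity `u_ν`, whereas `∂ₜρ` has the density
`-1/N (∂ₜz + c_j)`. The transport equation thus asks for `-div Q` to have on the `j`-th interface
the density `slip_j = 1/N (∂ₜz + c_j - u_ν)`. The field `-∑ slip_j 1_{above z_j} e₂` does so, but above
the mixing zone it equals `-∑ slip_j e₂`. To compensate, one adds the difference of two divergence
free fields, supported above `z₋₁` and above `z₁` and tangent there to these interfaces, with the
same horizontal component `-κ` (`integral_above_stream`). Above `z₁` the horizontal components
cancel, and the vertical ones add up to `∑ slip_j` if `κ` times the width of the middle layer is a
primitive of `∑ slip_j` in `s`. With this choice `Q` vanishes outside of the mixing zone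
(`corr_pure`). Reynolds' transport theorem (`transport_above`) and the weak form at a fixed time
(`integral_momentum`) give the transport equation.

**The inequality.** It amounts to `Q₁² + Q₂² ≤ (1 - ρ²) Q₂`, strict in the mixing zone. In an outer
layer `Q₁ = 0`, and since `∑_{i > k} (2i - 1) = N² - k²`, the assumption on the normal velocities
gives `Q₂ = (1 - ρ²) r` with `r` close to `N c / (2N - 1)` relative to `c` (`outer_sum`). The latter
lies in `(0, 1)`, uniformly away from `1`, as `c ≤ c_max < (2N - 1) / N`. In the middle layer the
integrated assumption bounds `κ` by a small multiple of `√c`, and the bounds of `∂ₛz` and `∂ₛc` by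
`√c` make the change of `Q₂` a small multiple of `c`, so that the strict inequality survives
(`IsSmall.middle`, `corr_strict`).
-/

/-! ### Vortex sheets on graphs: kernels and bounds -/

namespace Muskat

/-- `ζ` is a `C¹` function with derivative `ζ'`, at bounded distance `C` from the line of slope `β`,
whose derivative is Hölder continuous with exponent `a` and decays to `β` at the rate `1 + a`. The
constants are recorded so that estimates are uniform over families of sheets. -/
structure IsSheet (β C a : ℝ) (ζ ζ' : ℝ → ℝ) : Prop where
  hasDerivAt : ∀ s, HasDerivAt ζ (ζ' s) s
  cont : Continuous ζ'
  bdd : ∀ s, |ζ s - β * s| ≤ C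
  decay : ∀ s, |ζ' s - β| ≤ C * (1 + |s|) ^ (-(1 + a))
  holder : ∀ s r, |s - r| ≤ 1 → |ζ' s - ζ' r| ≤ C * |s - r| ^ a

/-- The kernel `ξ / (|(x, y) - (x - ξ, ζ(x - ξ))|² + e²)`, regularized by `e`. -/
noncomputable def hker (ζ : ℝ → ℝ) (e x y ξ : ℝ) : ℝ :=
  ξ / (ξ ^ 2 + (y - ζ (x - ξ)) ^ 2 + e ^ 2)

/-- The sum of the kernel at `ξ` and `-ξ`. -/
noncomputable def tanPair (ζ : ℝ → ℝ) (e x y ξ : ℝ) : ℝ :=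
  hker ζ e x y ξ + hker ζ e x y (-ξ)

/-- The integrand at `±ξ` of the component of the velocity along `(-ζ'(x), 1)`. -/
noncomputable def norPair (ζ ζ' : ℝ → ℝ) (e x y ξ : ℝ) : ℝ :=
  (ζ' (x - ξ) - ζ' x) * hker ζ e x y ξ + (ζ' (x - -ξ) - ζ' x) * hker ζ e x y (-ξ)

/-- The principal value of `∫ hker dξ`; it is `2π` times the first component of the velocity. -/
noncomputable def tanInt (ζ : ℝ → ℝ) (e x y : ℝ) : ℝ := ∫ ξ in Ioi 0, tanPair ζ e x y ξ

/-- The principal value of `∫ (ζ'(x - ξ) - ζ'(x)) hker dξ`; it is `2π` times the component of the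
velocity along `(-ζ'(x), 1)`. -/
noncomputable def norInt (ζ ζ' : ℝ → ℝ) (e x y : ℝ) : ℝ := ∫ ξ in Ioi 0, norPair ζ ζ' e x y ξ

/-- The integrable profile `ξ^(a-1)` for `ξ ≤ 1`, `ξ^(-2)` for `ξ > 1`. -/
noncomputable def profile (a ξ : ℝ) : ℝ := if ξ ≤ 1 then ξ ^ (a - 1) else ξ ^ (-2 : ℝ)

/-- The weight `(1 + |s|)^(-(1+a))`. -/
noncomputable def weight (a s : ℝ) : ℝ := (1 + |s|) ^ (-(1 + a))

lemma profile_nonneg (a : ℝ) {ξ : ℝ} (hξ : 0 < ξ) : 0 ≤ profile a ξ := by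
  unfold profile; split_ifs <;> positivity

lemma profile_one_lt (a : ℝ) {ξ : ℝ} (hξ : 1 < ξ) : profile a ξ = 1 / ξ ^ 2 := by
  have h0 : 0 < ξ := by linarith
  rw [profile, if_neg (not_le.2 hξ), Real.rpow_neg h0.le, one_div]
  norm_num

lemma integrableOn_profile {a : ℝ} (ha : 0 < a) : IntegrableOn (profile a) (Ioi 0) := by
  have hU : Ioi (0 : ℝ) = Ioc 0 1 ∪ Ioi 1 := (Ioc_union_Ioi_eq_Ioi zero_le_one).symm
  rw [hU]
  refine IntegrableOn.union ?_ ?_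
  · have h : IntegrableOn (fun ξ : ℝ => ξ ^ (a - 1)) (Ioc 0 1) :=
      (intervalIntegrable_iff_integrableOn_Ioc_of_le zero_le_one).1
        (intervalIntegral.intervalIntegrable_rpow' (by linarith))
    exact h.congr_fun (fun ξ hξ => by simp [profile, hξ.2]) measurableSet_Ioc
  · have h := integrableOn_Ioi_rpow_of_lt (a := -2) (by norm_num) (zero_lt_one' ℝ)
    exact h.congr_fun (fun ξ hξ => by simp [profile, not_le.2 (mem_Ioi.1 hξ)]) measurableSet_Ioi

lemma weight_nonneg (a s : ℝ) : 0 ≤ weight a s := by unfold weight; positivity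

lemma weight_le_one {a : ℝ} (ha : 0 < a) (s : ℝ) : weight a s ≤ 1 :=
  Real.rpow_le_one_of_one_le_of_nonpos (by linarith [abs_nonneg s]) (by linarith)

lemma integrable_weight {a : ℝ} (ha : 0 < a) : Integrable (weight a) := by
  have := integrable_one_add_norm (E := ℝ) (μ := volume) (r := 1 + a) (by simp; linarith)
  exact this

lemma weight_le_four_mul {a : ℝ} (ha : 0 < a) (ha1 : a < 1) {s r : ℝ} (h : |s - r| ≤ 1) :
    weight a s ≤ 4 * weight a r := by
  have h1 : 1 + |r| ≤ 2 * (1 + |s|) := by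
    have := abs_sub_abs_le_abs_sub r s
    rw [abs_sub_comm] at this
    linarith [abs_nonneg s]
  have hs : 0 < 1 + |s| := by positivity
  have hr : 0 < 1 + |r| := by positivity
  have h2 : (1 + |r|) ^ (1 + a) ≤ 4 * (1 + |s|) ^ (1 + a) := by
    calc (1 + |r|) ^ (1 + a) ≤ (2 * (1 + |s|)) ^ (1 + a) :=
          Real.rpow_le_rpow hr.le h1 (by linarith)
      _ = 2 ^ (1 + a) * (1 + |s|) ^ (1 + a) := Real.mul_rpow (by norm_num) hs.le
      _ ≤ 2 ^ (2 : ℝ) * (1 + |s|) ^ (1 + a) := by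
          gcongr
          · norm_num
          · linarith
      _ = _ := by norm_num
  unfold weight
  rw [Real.rpow_neg hs.le, Real.rpow_neg hr.le, ← div_eq_mul_inv, le_div_iff₀ (by positivity),
    inv_mul_le_iff₀ (by positivity)]
  linarith

namespace IsSheet

variable {β C a : ℝ} {ζ ζ' : ℝ → ℝ}

lemma nonneg (h : IsSheet β C a ζ ζ') : 0 ≤ C := (abs_nonneg _).trans (h.bdd 0)

lemma continuous (h : IsSheet β C a ζ ζ') : Continuous ζ :=
  continuous_iff_continuousAt.2 fun s => (h.hasDerivAt s).continuousAt

lemma abs_deriv_sub_le (h : IsSheet β C a ζ ζ') (ha : 0 < a) (s : ℝ) : |ζ' s - β| ≤ C :=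
  (h.decay s).trans (mul_le_of_le_one_right h.nonneg (weight_le_one ha s))

lemma abs_deriv_le (h : IsSheet β C a ζ ζ') (ha : 0 < a) (s : ℝ) : |ζ' s| ≤ |β| + C := by
  have := abs_add_le (ζ' s - β) β
  rw [sub_add_cancel] at this
  linarith [h.abs_deriv_sub_le ha s]

lemma abs_sub_le (h : IsSheet β C a ζ ζ') (ha : 0 < a) (s r : ℝ) :
    |ζ s - ζ r| ≤ (|β| + C) * |s - r| := by
  have := Convex.norm_image_sub_le_of_norm_hasDerivWithin_le (f := ζ) (f' := ζ') (s := univ)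
    (x := r) (y := s) (C := |β| + C) (fun x _ => (h.hasDerivAt x).hasDerivWithinAt)
    (fun x _ => h.abs_deriv_le ha x) convex_univ (mem_univ _) (mem_univ _)
  simpa using this

lemma abs_second_diff_le (h : IsSheet β C a ζ ζ') (x ξ : ℝ) :
    |ζ (x - ξ) + ζ (x - -ξ) - 2 * ζ x| ≤ 4 * C := by
  have h1 := abs_le.1 (h.bdd (x - ξ))
  have h2 := abs_le.1 (h.bdd (x - -ξ))
  have h3 := abs_le.1 (h.bdd x)
  rw [abs_le]
  constructor <;> nlinarith

/-- Taylor's formula with the remainder given by the Hölder bound. -/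
lemma abs_taylor_le (h : IsSheet β C a ζ ζ') (ha : 0 < a) (x ξ : ℝ) (hξ : |ξ| ≤ 1) :
    |ζ (x + ξ) - ζ x - ζ' x * ξ| ≤ C * |ξ| ^ a * |ξ| := by
  have := Convex.norm_image_sub_le_of_norm_hasDerivWithin_le
    (f := fun s => ζ s - ζ' x * s) (f' := fun s => ζ' s - ζ' x * 1) (s := uIcc x (x + ξ))
    (x := x) (y := x + ξ) (C := C * |ξ| ^ a)
    (fun s _ => ((h.hasDerivAt s).sub ((hasDerivAt_id s).const_mul _)).hasDerivWithinAt)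
    (fun s hs => ?_) (convex_uIcc _ _) left_mem_uIcc right_mem_uIcc
  · simp only [Real.norm_eq_abs, add_sub_cancel_left] at this
    convert this using 2
    ring
  · have hsx : |s - x| ≤ |ξ| := by
      have := abs_sub_left_of_mem_uIcc hs
      simpa using this
    rw [mul_one, Real.norm_eq_abs]
    refine (h.holder s x (hsx.trans hξ)).trans ?_
    have := h.nonneg
    gcongr

lemma abs_second_diff_le' (h : IsSheet β C a ζ ζ') (ha : 0 < a) (x : ℝ) {ξ : ℝ} (h0 : 0 < ξ)
    (hξ : ξ ≤ 1) :
    |ζ (x - ξ) + ζ (x - -ξ) - 2 * ζ x| ≤ 2 * C * ξ ^ a * ξ := by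
  have h1 := h.abs_taylor_le ha x ξ (by rwa [abs_of_pos h0])
  have h2 := h.abs_taylor_le ha x (-ξ) (by rwa [abs_neg, abs_of_pos h0])
  rw [abs_neg] at h2
  rw [abs_of_pos h0] at h1 h2
  have := abs_add_le (ζ (x + ξ) - ζ x - ζ' x * ξ) (ζ (x + -ξ) - ζ x - ζ' x * -ξ)
  rw [sub_neg_eq_add, sub_eq_add_neg x ξ]
  calc _ = |ζ (x + ξ) - ζ x - ζ' x * ξ + (ζ (x + -ξ) - ζ x - ζ' x * -ξ)| := by
        congr 1; ring
    _ ≤ _ := by linarith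

lemma abs_second_diff_le_profile (h : IsSheet β C a ζ ζ') (ha : 0 < a) (x : ℝ) {ξ : ℝ}
    (h0 : 0 < ξ) :
    |ζ (x - ξ) + ζ (x - -ξ) - 2 * ζ x| / ξ ^ 2 ≤ 4 * C * profile a ξ := by
  have hC := h.nonneg
  by_cases hξ : ξ ≤ 1
  · rw [profile, if_pos hξ, div_le_iff₀ (by positivity), Real.rpow_sub h0, Real.rpow_one]
    have := h.abs_second_diff_le' ha x h0 hξ
    have h2 : 4 * C * (ξ ^ a / ξ) * ξ ^ 2 = 2 * (2 * C * ξ ^ a * ξ) := by field_simp; ring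
    rw [h2]
    have : 0 ≤ 2 * C * ξ ^ a * ξ := by positivity
    linarith
  · rw [profile_one_lt a (not_le.1 hξ), mul_one_div]
    have := h.abs_second_diff_le x ξ
    gcongr

/-- The squared distance to any point of the graph is comparable from below with the one to a flat
sheet at height `ζ x`, as `ζ` is Lipschitz. -/
lemma quad_lower (h : IsSheet β C a ζ ζ') (ha : 0 < a) (e x y ξ : ℝ) :
    ξ ^ 2 + (y - ζ x) ^ 2 + e ^ 2 ≤
      (2 + 2 * (|β| + C) ^ 2) * (ξ ^ 2 + (y - ζ (x - ξ)) ^ 2 + e ^ 2) := by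
  have h1 := h.abs_sub_le ha (x - ξ) x
  rw [sub_sub_cancel_left, abs_neg] at h1
  have h2 : (ζ (x - ξ) - ζ x) ^ 2 ≤ (|β| + C) ^ 2 * ξ ^ 2 := by
    rw [← mul_pow, ← sq_abs (ζ (x - ξ) - ζ x), ← sq_abs (_ * ξ), abs_mul]
    have : 0 ≤ |β| + C := add_nonneg (abs_nonneg _) h.nonneg
    rw [abs_of_nonneg this]
    gcongr
  nlinarith [sq_nonneg ((y - ζ (x - ξ)) - (ζ (x - ξ) - ζ x)), sq_nonneg (y - ζ (x - ξ)),
    sq_nonneg e, sq_nonneg (|β| + C), sq_nonneg ξ,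
    mul_nonneg (sq_nonneg (|β| + C)) (sq_nonneg (y - ζ (x - ξ))),
    mul_nonneg (sq_nonneg (|β| + C)) (sq_nonneg e)]

end IsSheet

/-- The constant of the kernel estimates. -/
noncomputable def kconst (β C : ℝ) : ℝ := 8 * (2 + 2 * (|β| + C) ^ 2) ^ 2 * (|β| + C) * (1 + C)

/-- The algebra of the cancellation. Here `A` and `B` are the vertical distances to the sheet at
`±ξ`, and `d` is the one at `ξ = 0`: the difference of squares is `(B - A)(B + A)`, where the first
factor is Lipschitz and the second is `2 d` up to a second difference `D`. -/
lemma abs_pair_aux {ξ e d A B L C D p : ℝ} (h0 : 0 < ξ) (hL0 : 0 ≤ L) (hC : 0 ≤ C) (hp : 0 ≤ p)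
    (e1 : |B - A| ≤ 2 * L * ξ) (e2 : |B + A| ≤ 2 * |d| + |D|) (hP : |D| / ξ ^ 2 ≤ 4 * C * p)
    (hq1 : ξ ^ 2 + d ^ 2 + e ^ 2 ≤ (2 + 2 * L ^ 2) * (ξ ^ 2 + A ^ 2 + e ^ 2))
    (hq2 : ξ ^ 2 + d ^ 2 + e ^ 2 ≤ (2 + 2 * L ^ 2) * (ξ ^ 2 + B ^ 2 + e ^ 2)) :
    |ξ * (B ^ 2 - A ^ 2) / ((ξ ^ 2 + A ^ 2 + e ^ 2) * (ξ ^ 2 + B ^ 2 + e ^ 2))| ≤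
      8 * (2 + 2 * L ^ 2) ^ 2 * L * (1 + C) * (|d| / (ξ ^ 2 + d ^ 2 + e ^ 2) + p) := by
  have hqA : 0 < ξ ^ 2 + A ^ 2 + e ^ 2 := by positivity
  have hqB : 0 < ξ ^ 2 + B ^ 2 + e ^ 2 := by positivity
  have hQ0 : 0 < ξ ^ 2 + d ^ 2 + e ^ 2 := by positivity
  have hQξ : ξ ^ 2 ≤ ξ ^ 2 + d ^ 2 + e ^ 2 := by linarith [sq_nonneg d, sq_nonneg e]
  have hK0 : 0 < 2 + 2 * L ^ 2 := by positivity
  generalize 2 + 2 * L ^ 2 = K at *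
  generalize ξ ^ 2 + d ^ 2 + e ^ 2 = Q at *
  generalize ξ ^ 2 + A ^ 2 + e ^ 2 = qA at *
  generalize ξ ^ 2 + B ^ 2 + e ^ 2 = qB at *
  have hf : B ^ 2 - A ^ 2 = (B - A) * (B + A) := by ring
  rw [hf, abs_div, abs_mul, abs_mul, abs_of_pos h0, abs_of_pos (mul_pos hqA hqB)]
  have e4 : Q * Q ≤ K ^ 2 * (qA * qB) := by
    calc Q * Q ≤ (K * qA) * (K * qB) := mul_le_mul hq1 hq2 hQ0.le (by positivity)
      _ = _ := by ring
  have e5 : Q * Q / K ^ 2 ≤ qA * qB := by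
    rw [div_le_iff₀' (by positivity)]
    exact e4
  have hD0 := abs_nonneg D
  have hd0 := abs_nonneg d
  calc ξ * (|B - A| * |B + A|) / (qA * qB)
      ≤ ξ * (2 * L * ξ * (2 * |d| + |D|)) / (Q * Q / K ^ 2) := by gcongr
    _ = 2 * L * K ^ 2 * ((2 * |d| + |D|) / Q * (ξ ^ 2 / Q)) := by field_simp
    _ ≤ 2 * L * K ^ 2 * ((2 * |d| + |D|) / Q * 1) := by
        gcongr
        rwa [div_le_one hQ0]
    _ = 2 * L * K ^ 2 * (2 * (|d| / Q) + |D| / Q) := by ring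
    _ ≤ 2 * L * K ^ 2 * (2 * (|d| / Q) + 4 * C * p) := by
        gcongr
        refine le_trans ?_ hP
        gcongr
    _ ≤ 2 * L * K ^ 2 * ((4 * (1 + C)) * (|d| / Q) + (4 * (1 + C)) * p) := by
        gcongr <;> linarith
    _ = _ := by ring

lemma abs_hker_le (ζ : ℝ → ℝ) (e x y ξ : ℝ) : |hker ζ e x y ξ| ≤ 1 / |ξ| := by
  unfold hker
  rcases eq_or_ne ξ 0 with rfl | hξ
  · simp
  have hp : 0 < |ξ| := abs_pos.2 hξ
  rw [abs_div, abs_of_pos (a := ξ ^ 2 + _ + _) (by positivity), div_le_div_iff₀ (by positivity) hp]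
  rw [← sq, sq_abs]
  nlinarith [sq_nonneg (y - ζ (x - ξ)), sq_nonneg e]

namespace IsSheet

variable {β C a : ℝ} {ζ ζ' : ℝ → ℝ}

lemma kconst_nonneg (h : IsSheet β C a ζ ζ') : 0 ≤ kconst β C := by
  have := h.nonneg
  unfold kconst; positivity

/-- The cancellation between `ξ` and `-ξ`: apart from an integrable profile, only a Poisson kernel
in the height `y - ζ(x)` above the sheet survives. -/
lemma abs_tanPair_le (h : IsSheet β C a ζ ζ') (ha : 0 < a) (e x y : ℝ) {ξ : ℝ} (h0 : 0 < ξ) :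
    |tanPair ζ e x y ξ| ≤ kconst β C *
      (|y - ζ x| / (ξ ^ 2 + (y - ζ x) ^ 2 + e ^ 2) + profile a ξ) := by
  have hC := h.nonneg
  have hl := h.abs_sub_le ha (x - ξ) (x - -ξ)
  have hx : x - ξ - (x - -ξ) = -(2 * ξ) := by ring
  rw [hx, abs_neg, abs_of_pos (a := 2 * ξ) (by linarith)] at hl
  have hq2 := h.quad_lower ha e x y (-ξ)
  rw [neg_sq] at hq2
  have e3 : tanPair ζ e x y ξ = ξ * ((y - ζ (x - -ξ)) ^ 2 - (y - ζ (x - ξ)) ^ 2) /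
      ((ξ ^ 2 + (y - ζ (x - ξ)) ^ 2 + e ^ 2) * (ξ ^ 2 + (y - ζ (x - -ξ)) ^ 2 + e ^ 2)) := by
    have hqA : 0 < ξ ^ 2 + (y - ζ (x - ξ)) ^ 2 + e ^ 2 := by positivity
    have hqB : 0 < ξ ^ 2 + (y - ζ (x - -ξ)) ^ 2 + e ^ 2 := by positivity
    unfold tanPair hker
    rw [neg_sq]
    field_simp
    ring
  rw [e3]
  refine abs_pair_aux (L := |β| + C) (D := ζ (x - ξ) + ζ (x - -ξ) - 2 * ζ x) h0 (by positivity) hC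
    (profile_nonneg a h0) ?_ ?_ ?_
    (h.quad_lower ha e x y ξ) hq2
  · have : (y - ζ (x - -ξ)) - (y - ζ (x - ξ)) = ζ (x - ξ) - ζ (x - -ξ) := by ring
    rw [this]; linarith
  · have : (y - ζ (x - -ξ)) + (y - ζ (x - ξ)) =
        2 * (y - ζ x) - (ζ (x - ξ) + ζ (x - -ξ) - 2 * ζ x) := by ring
    rw [this]
    refine (abs_sub _ _).trans ?_
    rw [abs_mul, abs_two]
  · exact h.abs_second_diff_le_profile ha x h0

/-- The normal integrand: the Hölder bound replaces the Poisson kernel for `ξ ≤ 1`. -/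
lemma abs_norPair_le (h : IsSheet β C a ζ ζ') (ha : 0 < a) (e x y : ℝ) {ξ : ℝ} (h0 : 0 < ξ) :
    |norPair ζ ζ' e x y ξ| ≤ C * (2 + 2 * kconst β C) *
      ((if ξ ≤ 1 then 0 else |y - ζ x| / (ξ ^ 2 + (y - ζ x) ^ 2 + e ^ 2)) + profile a ξ
        + weight a (x - ξ) + weight a (x - -ξ)) := by
  have hC := h.nonneg
  have hk := h.kconst_nonneg
  have hw1 := weight_nonneg a (x - ξ)
  have hw2 := weight_nonneg a (x - -ξ)
  have hp := profile_nonneg a h0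
  have k1 := abs_hker_le ζ e x y ξ
  have k2 := abs_hker_le ζ e x y (-ξ)
  rw [abs_neg] at k2
  rw [abs_of_pos h0] at k1 k2
  by_cases hξ : ξ ≤ 1
  · rw [if_pos hξ]
    have h1 := h.holder (x - ξ) x (by rw [sub_sub_cancel_left, abs_neg, abs_of_pos h0]; exact hξ)
    have h2 := h.holder (x - -ξ) x (by rw [sub_sub_cancel_left, neg_neg, abs_of_pos h0]; exact hξ)
    rw [sub_sub_cancel_left, abs_neg, abs_of_pos h0] at h1
    rw [sub_sub_cancel_left, neg_neg, abs_of_pos h0] at h2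
    have hpe : profile a ξ = ξ ^ a * (1 / ξ) := by
      rw [profile, if_pos hξ, Real.rpow_sub h0, Real.rpow_one]; ring
    calc |norPair ζ ζ' e x y ξ| ≤ C * ξ ^ a * (1 / ξ) + C * ξ ^ a * (1 / ξ) := by
          unfold norPair
          refine (abs_add_le _ _).trans ?_
          rw [abs_mul, abs_mul]
          gcongr
      _ = C * 2 * profile a ξ := by rw [hpe]; ring
      _ ≤ _ := by
          have : profile a ξ ≤ 0 + profile a ξ + weight a (x - ξ) + weight a (x - -ξ) := by
            linarith
          gcongr
          linarith
  · rw [if_neg hξ]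
    have h1 := h.decay (x - ξ)
    have h2 := h.decay (x - -ξ)
    have h3 := h.abs_deriv_sub_le ha x
    have ht := h.abs_tanPair_le ha e x y h0
    have hinv : 1 / ξ ≤ 1 := by rw [div_le_one h0]; exact (not_le.1 hξ).le
    set G := |y - ζ x| / (ξ ^ 2 + (y - ζ x) ^ 2 + e ^ 2) with hG
    have hG0 : 0 ≤ G := by positivity
    have e1 : norPair ζ ζ' e x y ξ = (ζ' (x - ξ) - β) * hker ζ e x y ξ
        + (ζ' (x - -ξ) - β) * hker ζ e x y (-ξ) - (ζ' x - β) * tanPair ζ e x y ξ := by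
      unfold norPair tanPair; ring
    have e2 : |norPair ζ ζ' e x y ξ| ≤ C * weight a (x - ξ) * 1 + C * weight a (x - -ξ) * 1
        + C * (kconst β C * (G + profile a ξ)) := by
      rw [e1]
      refine (abs_sub _ _).trans ?_
      refine add_le_add ((abs_add_le _ _).trans (add_le_add ?_ ?_)) ?_
      · rw [abs_mul]
        exact mul_le_mul h1 (k1.trans hinv) (abs_nonneg _) (by positivity)
      · rw [abs_mul]
        exact mul_le_mul h2 (k2.trans hinv) (abs_nonneg _) (by positivity)
      · rw [abs_mul]
        exact mul_le_mul h3 ht (abs_nonneg _) hC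
    refine e2.trans ?_
    have e3 : 0 ≤ kconst β C * weight a (x - ξ) := by positivity
    have e4 : 0 ≤ kconst β C * weight a (x - -ξ) := by positivity
    have e5 : 0 ≤ kconst β C * (G + profile a ξ) := by positivity
    nlinarith [mul_nonneg hC hw1, mul_nonneg hC hw2, mul_nonneg hC hG0, mul_nonneg hC hp,
      mul_nonneg hC e3, mul_nonneg hC e4, mul_nonneg hC e5]

end IsSheet

end Muskat

/-! ### Bounds and continuity of the velocity integrals -/

namespace Muskat

lemma integrable_poisson (d : ℝ) : Integrable (fun ξ : ℝ => |d| / (ξ ^ 2 + d ^ 2)) := by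
  rcases eq_or_ne d 0 with rfl | hd
  · simp
  have h := (integrable_inv_one_add_sq.comp_mul_left' (inv_ne_zero hd)).const_mul |d|⁻¹
  refine h.congr (Eventually.of_forall fun ξ => ?_)
  have : |d| ≠ 0 := abs_ne_zero.2 hd
  simp only
  rw [← sq_abs d]
  have h2 : (d⁻¹ * ξ) ^ 2 = ξ ^ 2 / |d| ^ 2 := by rw [sq_abs]; field_simp
  rw [h2]
  have : |d| ^ 2 + ξ ^ 2 ≠ 0 := by positivity
  field_simp
  ring

lemma integral_poisson_le (d : ℝ) : ∫ ξ : ℝ, |d| / (ξ ^ 2 + d ^ 2) ≤ Real.pi := by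
  rcases eq_or_ne d 0 with rfl | hd
  · simp [Real.pi_pos.le]
  have h0 : |d| ≠ 0 := abs_ne_zero.2 hd
  have h : ∀ ξ : ℝ, |d| / (ξ ^ 2 + d ^ 2) = |d|⁻¹ * (fun r : ℝ => (1 + r ^ 2)⁻¹) (d⁻¹ * ξ) := by
    intro ξ
    simp only
    rw [← sq_abs d]
    have h2 : (d⁻¹ * ξ) ^ 2 = ξ ^ 2 / |d| ^ 2 := by rw [sq_abs]; field_simp
    rw [h2]
    have : |d| ^ 2 + ξ ^ 2 ≠ 0 := by positivity
    field_simp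
    ring
  rw [integral_congr_ae (Eventually.of_forall h), integral_const_mul,
    Measure.integral_comp_mul_left (fun r : ℝ => (1 + r ^ 2)⁻¹), integral_univ_inv_one_add_sq,
    inv_inv, smul_eq_mul, ← mul_assoc, inv_mul_cancel₀ h0, one_mul]

lemma poisson_reg_le {ξ : ℝ} (h0 : 0 < ξ) (d e : ℝ) :
    |d| / (ξ ^ 2 + d ^ 2 + e ^ 2) ≤ |d| / (ξ ^ 2 + d ^ 2) := by
  have := sq_nonneg e
  have : 0 < ξ ^ 2 + d ^ 2 := by positivity
  exact div_le_div_of_nonneg_left (abs_nonneg d) this (by linarith)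

lemma integral_Ioi_poisson_le (d : ℝ) : ∫ ξ in Ioi (0 : ℝ), |d| / (ξ ^ 2 + d ^ 2) ≤ Real.pi :=
  (setIntegral_le_integral (integrable_poisson d)
    (Eventually.of_forall fun ξ => by simp only [Pi.zero_apply]; positivity)).trans
    (integral_poisson_le d)

/-- The majorant of the tangential integrand. -/
noncomputable def tanMajor (β C a d ξ : ℝ) : ℝ :=
  kconst β C * (|d| / (ξ ^ 2 + d ^ 2) + profile a ξ)

/-- The majorant of the normal integrand. -/
noncomputable def norMajor (β C a d x ξ : ℝ) : ℝ :=
  C * (2 + 2 * kconst β C) *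
    (|d| / (ξ ^ 2 + d ^ 2) + profile a ξ + weight a (x - ξ) + weight a (x - -ξ))

/-- A bound for the tangential component of the velocity, up to the factor `2π`. -/
noncomputable def tanBound (β C a : ℝ) : ℝ :=
  kconst β C * (Real.pi + ∫ ξ in Ioi (0 : ℝ), profile a ξ)

/-- A bound for the normal component of the velocity, up to the factor `2π`. -/
noncomputable def norBound (β C a : ℝ) : ℝ :=
  C * (2 + 2 * kconst β C) *
    (Real.pi + (∫ ξ in Ioi (0 : ℝ), profile a ξ) + (∫ s, weight a s) + ∫ s, weight a s)

lemma integrable_weight_sub {a : ℝ} (ha : 0 < a) (x : ℝ) :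
    Integrable (fun ξ => weight a (x - ξ)) := (integrable_weight ha).comp_sub_left x

lemma integrable_weight_sub_neg {a : ℝ} (ha : 0 < a) (x : ℝ) :
    Integrable (fun ξ => weight a (x - -ξ)) := by
  simpa [sub_neg_eq_add] using (integrable_weight ha).comp_add_left x

lemma integral_Ioi_weight_sub_le {a : ℝ} (ha : 0 < a) (x : ℝ) :
    ∫ ξ in Ioi (0 : ℝ), weight a (x - ξ) ≤ ∫ s, weight a s := by
  rw [← integral_sub_left_eq_self (weight a) volume x]
  exact setIntegral_le_integral (integrable_weight_sub ha x)
    (Eventually.of_forall fun ξ => weight_nonneg _ _)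

lemma integral_Ioi_weight_sub_neg_le {a : ℝ} (ha : 0 < a) (x : ℝ) :
    ∫ ξ in Ioi (0 : ℝ), weight a (x - -ξ) ≤ ∫ s, weight a s := by
  have := integral_add_left_eq_self (μ := volume) (weight a) x
  rw [← this]
  simp_rw [sub_neg_eq_add]
  exact setIntegral_le_integral (by simpa using integrable_weight_sub_neg ha x)
    (Eventually.of_forall fun ξ => weight_nonneg _ _)

lemma integrableOn_tanMajor (β C d : ℝ) {a : ℝ} (ha : 0 < a) :
    IntegrableOn (tanMajor β C a d) (Ioi 0) :=
  ((integrable_poisson d).integrableOn.add (integrableOn_profile ha)).const_mul _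

lemma integrableOn_norMajor (β C d x : ℝ) {a : ℝ} (ha : 0 < a) :
    IntegrableOn (norMajor β C a d x) (Ioi 0) :=
  ((((integrable_poisson d).integrableOn.add (integrableOn_profile ha)).add
    (integrable_weight_sub ha x).integrableOn).add
    (integrable_weight_sub_neg ha x).integrableOn).const_mul _

lemma continuous_hker_aux {ζ : ℝ → ℝ} (hζ : Continuous ζ) {e x y : ℝ} {s : Set ℝ}
    (hs : ∀ ξ ∈ s, 0 < ξ ^ 2 + (y - ζ (x - ξ)) ^ 2 + e ^ 2) : ContinuousOn (hker ζ e x y) s := by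
  unfold hker
  exact ContinuousOn.div (by fun_prop) (by fun_prop) fun ξ hξ => (hs ξ hξ).ne'

namespace IsSheet

variable {β C a : ℝ} {ζ ζ' : ℝ → ℝ}

lemma continuousOn_tanPair (h : IsSheet β C a ζ ζ') (e x y : ℝ) :
    ContinuousOn (tanPair ζ e x y) (Ioi 0) := by
  have hc : ContinuousOn (hker ζ e x y) {0}ᶜ := continuous_hker_aux h.continuous fun ξ hξ => by
    have : ξ ≠ 0 := hξ
    positivity
  refine (hc.mono fun ξ hξ => (mem_Ioi.1 hξ).ne').add (hc.comp continuous_neg.continuousOn ?_)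
  intro ξ hξ
  simpa using (mem_Ioi.1 hξ).ne'

lemma continuousOn_norPair (h : IsSheet β C a ζ ζ') (e x y : ℝ) :
    ContinuousOn (norPair ζ ζ' e x y) (Ioi 0) := by
  have hc : ContinuousOn (hker ζ e x y) {0}ᶜ := continuous_hker_aux h.continuous fun ξ hξ => by
    have : ξ ≠ 0 := hξ
    positivity
  have hd := h.cont
  refine ContinuousOn.add (ContinuousOn.mul (by fun_prop) (hc.mono fun ξ hξ => (mem_Ioi.1 hξ).ne'))
    (ContinuousOn.mul (by fun_prop) (hc.comp continuous_neg.continuousOn ?_))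
  intro ξ hξ
  simpa using (mem_Ioi.1 hξ).ne'

lemma abs_tanPair_le_major (h : IsSheet β C a ζ ζ') (ha : 0 < a) (e x y : ℝ) {ξ : ℝ}
    (h0 : 0 < ξ) : |tanPair ζ e x y ξ| ≤ tanMajor β C a (y - ζ x) ξ := by
  refine (h.abs_tanPair_le ha e x y h0).trans ?_
  have := h.kconst_nonneg
  have := poisson_reg_le h0 (y - ζ x) e
  unfold tanMajor
  gcongr

lemma abs_norPair_le_major (h : IsSheet β C a ζ ζ') (ha : 0 < a) (e x y : ℝ) {ξ : ℝ}
    (h0 : 0 < ξ) : |norPair ζ ζ' e x y ξ| ≤ norMajor β C a (y - ζ x) x ξ := by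
  refine (h.abs_norPair_le ha e x y h0).trans ?_
  have := h.kconst_nonneg
  have := h.nonneg
  have := poisson_reg_le h0 (y - ζ x) e
  unfold norMajor
  gcongr
  split_ifs
  · positivity
  · exact this

lemma integrableOn_tanPair (h : IsSheet β C a ζ ζ') (ha : 0 < a) (e x y : ℝ) :
    IntegrableOn (tanPair ζ e x y) (Ioi 0) := by
  refine (integrableOn_tanMajor β C (y - ζ x) ha).mono'
    ((h.continuousOn_tanPair e x y).aestronglyMeasurable measurableSet_Ioi) ?_
  filter_upwards [ae_restrict_mem measurableSet_Ioi] with ξ hξ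
  exact h.abs_tanPair_le_major ha e x y hξ

lemma integrableOn_norPair (h : IsSheet β C a ζ ζ') (ha : 0 < a) (e x y : ℝ) :
    IntegrableOn (norPair ζ ζ' e x y) (Ioi 0) := by
  refine (integrableOn_norMajor β C (y - ζ x) x ha).mono'
    ((h.continuousOn_norPair e x y).aestronglyMeasurable measurableSet_Ioi) ?_
  filter_upwards [ae_restrict_mem measurableSet_Ioi] with ξ hξ
  exact h.abs_norPair_le_major ha e x y hξ

lemma integral_tanMajor_le (h : IsSheet β C a ζ ζ') (ha : 0 < a) (d : ℝ) :
    ∫ ξ in Ioi (0 : ℝ), tanMajor β C a d ξ ≤ tanBound β C a := by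
  unfold tanMajor tanBound
  rw [integral_const_mul, integral_add (integrable_poisson d).integrableOn
    (integrableOn_profile ha)]
  have := integral_Ioi_poisson_le d
  have := h.kconst_nonneg
  gcongr

lemma integral_norMajor_le (h : IsSheet β C a ζ ζ') (ha : 0 < a) (d x : ℝ) :
    ∫ ξ in Ioi (0 : ℝ), norMajor β C a d x ξ ≤ norBound β C a := by
  have i1 := (integrable_poisson d).integrableOn (s := Ioi 0)
  have i2 := integrableOn_profile ha
  have i3 := (integrable_weight_sub ha x).integrableOn (s := Ioi 0)
  have i4 := (integrable_weight_sub_neg ha x).integrableOn (s := Ioi 0)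
  unfold norMajor norBound
  have e : ∫ ξ in Ioi (0 : ℝ), (|d| / (ξ ^ 2 + d ^ 2) + profile a ξ + weight a (x - ξ)
      + weight a (x - -ξ)) = (∫ ξ in Ioi (0 : ℝ), |d| / (ξ ^ 2 + d ^ 2))
      + (∫ ξ in Ioi (0 : ℝ), profile a ξ) + (∫ ξ in Ioi (0 : ℝ), weight a (x - ξ))
      + ∫ ξ in Ioi (0 : ℝ), weight a (x - -ξ) := by
    exact (integral_add ((i1.add i2).add i3) i4).trans (congrArg (· + _)
      ((integral_add (i1.add i2) i3).trans (congrArg (· + _) (integral_add i1 i2))))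
  rw [integral_const_mul, e]
  have := integral_Ioi_poisson_le d
  have := integral_Ioi_weight_sub_le ha x
  have := integral_Ioi_weight_sub_neg_le ha x
  have := h.kconst_nonneg
  have := h.nonneg
  gcongr

lemma abs_setIntegral_tanPair_le (h : IsSheet β C a ζ ζ') (ha : 0 < a) (e x y : ℝ)
    {s : Set ℝ} (hs : s ⊆ Ioi 0) (hm : MeasurableSet s) :
    |∫ ξ in s, tanPair ζ e x y ξ| ≤ tanBound β C a := by
  rw [← Real.norm_eq_abs]
  refine (norm_integral_le_of_norm_le (g := tanMajor β C a (y - ζ x))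
    ((integrableOn_tanMajor β C _ ha).mono_set hs) ?_).trans
    ((setIntegral_mono_set (integrableOn_tanMajor β C (y - ζ x) ha) ?_
      (Eventually.of_forall hs)).trans (h.integral_tanMajor_le ha (y - ζ x)))
  · filter_upwards [ae_restrict_mem hm] with ξ hξ
    exact h.abs_tanPair_le_major ha e x y (hs hξ)
  · filter_upwards [ae_restrict_mem measurableSet_Ioi] with ξ hξ
    exact (abs_nonneg _).trans (h.abs_tanPair_le_major ha e x y hξ)

lemma abs_setIntegral_norPair_le (h : IsSheet β C a ζ ζ') (ha : 0 < a) (e x y : ℝ)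
    {s : Set ℝ} (hs : s ⊆ Ioi 0) (hm : MeasurableSet s) :
    |∫ ξ in s, norPair ζ ζ' e x y ξ| ≤ norBound β C a := by
  rw [← Real.norm_eq_abs]
  refine (norm_integral_le_of_norm_le (g := norMajor β C a (y - ζ x) x)
    ((integrableOn_norMajor β C _ x ha).mono_set hs) ?_).trans
    ((setIntegral_mono_set (integrableOn_norMajor β C (y - ζ x) x ha) ?_
      (Eventually.of_forall hs)).trans (h.integral_norMajor_le ha (y - ζ x) x))
  · filter_upwards [ae_restrict_mem hm] with ξ hξ
    exact h.abs_norPair_le_major ha e x y (hs hξ)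
  · filter_upwards [ae_restrict_mem measurableSet_Ioi] with ξ hξ
    exact (abs_nonneg _).trans (h.abs_norPair_le_major ha e x y hξ)

lemma abs_tanInt_le (h : IsSheet β C a ζ ζ') (ha : 0 < a) (e x y : ℝ) :
    |tanInt ζ e x y| ≤ tanBound β C a :=
  h.abs_setIntegral_tanPair_le ha e x y subset_rfl measurableSet_Ioi

lemma abs_norInt_le (h : IsSheet β C a ζ ζ') (ha : 0 < a) (e x y : ℝ) :
    |norInt ζ ζ' e x y| ≤ norBound β C a :=
  h.abs_setIntegral_norPair_le ha e x y subset_rfl measurableSet_Ioi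

end IsSheet

section Continuity

variable {P : Type*} [TopologicalSpace P] {ζ ζ' : P → ℝ → ℝ} {e x y : P → ℝ} {p₀ : P}

lemma continuousAt_hker (hζ : Continuous fun q : P × ℝ => ζ q.1 q.2) (he : ContinuousAt e p₀)
    (hx : ContinuousAt x p₀) (hy : ContinuousAt y p₀) {ξ : ℝ} (hξ : ξ ≠ 0) :
    ContinuousAt (fun p => hker (ζ p) (e p) (x p) (y p) ξ) p₀ := by
  have h1 : ContinuousAt (fun p => ζ p (x p - ξ)) p₀ :=
    ContinuousAt.comp (g := fun q : P × ℝ => ζ q.1 q.2) (f := fun p => (p, x p - ξ))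
      hζ.continuousAt (continuousAt_id.prodMk (hx.sub continuousAt_const))
  unfold hker
  exact ContinuousAt.div continuousAt_const
    ((continuousAt_const.add ((hy.sub h1).pow 2)).add (he.pow 2)) (by positivity)

variable [FirstCountableTopology P] {β C a : ℝ}

/-- The normal component of the velocity is continuous up to the sheet and across it. -/
lemma continuousAt_norInt (ha : 0 < a) (ha1 : a < 1) (hs : ∀ p, IsSheet β C a (ζ p) (ζ' p))
    (hζ : Continuous fun q : P × ℝ => ζ q.1 q.2) (hζ' : Continuous fun q : P × ℝ => ζ' q.1 q.2)
    (he : ContinuousAt e p₀) (hx : ContinuousAt x p₀) (hy : ContinuousAt y p₀) :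
    ContinuousAt (fun p => norInt (ζ p) (ζ' p) (e p) (x p) (y p)) p₀ := by
  have hζx : ContinuousAt (fun p => ζ p (x p)) p₀ :=
    ContinuousAt.comp (g := fun q : P × ℝ => ζ q.1 q.2) (f := fun p => (p, x p))
      hζ.continuousAt (continuousAt_id.prodMk hx)
  have hC := (hs p₀).nonneg
  have hk := (hs p₀).kconst_nonneg
  set d₀ := |y p₀ - ζ p₀ (x p₀)| with hd₀
  -- The weights centred at the nearby points `x p` are compared with the one at `x p₀`. The Poisson
  -- kernel is only present for `ξ > 1`, whence a majorant that is integrable even for `d₀ = 0`.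
  refine continuousAt_of_dominated (bound := fun ξ => C * (2 + 2 * kconst β C) *
    ((d₀ + 1) * profile a ξ + profile a ξ + 4 * weight a (x p₀ - ξ) + 4 * weight a (x p₀ - -ξ)))
    ?_ ?_ ?_ ?_
  · exact Eventually.of_forall fun p =>
      ((hs p).continuousOn_norPair _ _ _).aestronglyMeasurable measurableSet_Ioi
  · have h1 : ∀ᶠ p in 𝓝 p₀, |y p - ζ p (x p)| < d₀ + 1 :=
      (hy.sub hζx).abs.eventually_lt continuousAt_const (by simp [hd₀])
    have h2 : ∀ᶠ p in 𝓝 p₀, |x p - x p₀| < 1 :=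
      (hx.sub continuousAt_const).abs.eventually_lt continuousAt_const (by simp)
    filter_upwards [h1, h2] with p hp1 hp2
    filter_upwards [ae_restrict_mem measurableSet_Ioi] with ξ hξ
    have hξ0 : 0 < ξ := hξ
    refine ((hs p).abs_norPair_le ha _ _ _ hξ0).trans ?_
    have hpr := profile_nonneg a hξ0
    have w1 : weight a (x p - ξ) ≤ 4 * weight a (x p₀ - ξ) :=
      weight_le_four_mul ha ha1 (by rw [sub_sub_sub_cancel_right]; exact hp2.le)
    have w2 : weight a (x p - -ξ) ≤ 4 * weight a (x p₀ - -ξ) :=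
      weight_le_four_mul ha ha1 (by rw [sub_sub_sub_cancel_right]; exact hp2.le)
    have g : (if ξ ≤ 1 then 0 else |y p - ζ p (x p)| /
        (ξ ^ 2 + (y p - ζ p (x p)) ^ 2 + e p ^ 2)) ≤ (d₀ + 1) * profile a ξ := by
      split_ifs with h
      · have := abs_nonneg (y p₀ - ζ p₀ (x p₀))
        positivity
      · rw [profile_one_lt a (not_le.1 h), mul_one_div]
        have : 0 < d₀ + 1 := by positivity
        gcongr
        nlinarith [sq_nonneg (y p - ζ p (x p)), sq_nonneg (e p)]
    gcongr
  · exact ((((integrableOn_profile ha).const_mul _).add (integrableOn_profile ha)).add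
      ((integrable_weight_sub ha _).integrableOn.const_mul _) |>.add
      ((integrable_weight_sub_neg ha _).integrableOn.const_mul _)).const_mul _
  · filter_upwards [ae_restrict_mem measurableSet_Ioi] with ξ hξ
    have hξ0 : ξ ≠ 0 := (mem_Ioi.1 hξ).ne'
    have c1 : ∀ η : ℝ, ContinuousAt (fun p => ζ' p (x p - η)) p₀ := fun η =>
      ContinuousAt.comp (g := fun q : P × ℝ => ζ' q.1 q.2) (f := fun p => (p, x p - η))
        hζ'.continuousAt (continuousAt_id.prodMk (hx.sub continuousAt_const))
    have c0 : ContinuousAt (fun p => ζ' p (x p)) p₀ := by simpa using c1 0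
    unfold norPair
    exact (((c1 ξ).sub c0).mul (continuousAt_hker hζ he hx hy hξ0)).add
      (((c1 (-ξ)).sub c0).mul (continuousAt_hker hζ he hx hy (neg_ne_zero.2 hξ0)))

/-- The principal value depends continuously on parameters as long as the point is off the sheet or
the kernel is regularized. -/
lemma continuousAt_tanInt (ha : 0 < a) (hs : ∀ p, IsSheet β C a (ζ p) (ζ' p))
    (hζ : Continuous fun q : P × ℝ => ζ q.1 q.2)
    (he : ContinuousAt e p₀) (hx : ContinuousAt x p₀) (hy : ContinuousAt y p₀)
    (hpos : 0 < (y p₀ - ζ p₀ (x p₀)) ^ 2 + e p₀ ^ 2) :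
    ContinuousAt (fun p => tanInt (ζ p) (e p) (x p) (y p)) p₀ := by
  have hζx : ContinuousAt (fun p => ζ p (x p)) p₀ :=
    ContinuousAt.comp (g := fun q : P × ℝ => ζ q.1 q.2) (f := fun p => (p, x p))
      hζ.continuousAt (continuousAt_id.prodMk hx)
  have hk := (hs p₀).kconst_nonneg
  set d₀ := |y p₀ - ζ p₀ (x p₀)| with hd₀
  obtain ⟨r, hr0, hr⟩ := exists_between (Real.sqrt_pos.2 hpos)
  rw [Real.lt_sqrt hr0.le] at hr
  refine continuousAt_of_dominated (bound := fun ξ => kconst β C *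
    ((d₀ + 1) / |r| * (|r| / (ξ ^ 2 + r ^ 2)) + profile a ξ)) ?_ ?_ ?_ ?_
  · exact Eventually.of_forall fun p =>
      ((hs p).continuousOn_tanPair _ _ _).aestronglyMeasurable measurableSet_Ioi
  · have h1 : ∀ᶠ p in 𝓝 p₀, |y p - ζ p (x p)| < d₀ + 1 :=
      (hy.sub hζx).abs.eventually_lt continuousAt_const (by simp [hd₀])
    have h2 : ∀ᶠ p in 𝓝 p₀, r ^ 2 < (y p - ζ p (x p)) ^ 2 + e p ^ 2 :=
      continuousAt_const.eventually_lt (((hy.sub hζx).pow 2).add (he.pow 2)) hr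
    filter_upwards [h1, h2] with p hp1 hp2
    filter_upwards [ae_restrict_mem measurableSet_Ioi] with ξ hξ
    have hξ0 : 0 < ξ := hξ
    refine ((hs p).abs_tanPair_le ha _ _ _ hξ0).trans ?_
    rw [div_mul_div_cancel₀ (abs_pos.2 hr0.ne').ne']
    have : 0 < d₀ + 1 := by positivity
    gcongr ?_ * (?_ / ?_ + _)
    linarith
  · exact (((integrable_poisson r).integrableOn.const_mul _).add
      (integrableOn_profile ha)).const_mul _
  · filter_upwards [ae_restrict_mem measurableSet_Ioi] with ξ hξ
    have hξ0 : ξ ≠ 0 := (mem_Ioi.1 hξ).ne'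
    unfold tanPair
    exact (continuousAt_hker hζ he hx hy hξ0).add
      (continuousAt_hker hζ he hx hy (neg_ne_zero.2 hξ0))

end Continuity

end Muskat

/-! ### Truncated Biot–Savart integrals and their limits -/

namespace Muskat

/-- First component of the (regularized) Biot–Savart integrand, up to the factor `2π`. -/
noncomputable def bsFst (ζ ζ' : ℝ → ℝ) (e x y ξ : ℝ) : ℝ :=
  ζ' (x - ξ) * (-(y - ζ (x - ξ)) / (ξ ^ 2 + (y - ζ (x - ξ)) ^ 2 + e ^ 2))

/-- Second component of the (regularized) Biot–Savart integrand, up to the factor `2π`. -/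
noncomputable def bsSnd (ζ ζ' : ℝ → ℝ) (e x y ξ : ℝ) : ℝ := ζ' (x - ξ) * hker ζ e x y ξ

/-- First component of the velocity of a sheet. -/
noncomputable def velFst (ζ : ℝ → ℝ) (e x y : ℝ) : ℝ := (2 * Real.pi)⁻¹ * tanInt ζ e x y

/-- Second component of the velocity of a sheet. -/
noncomputable def velSnd (ζ ζ' : ℝ → ℝ) (e x y : ℝ) : ℝ :=
  (2 * Real.pi)⁻¹ * (norInt ζ ζ' e x y + ζ' x * tanInt ζ e x y)

lemma quad_pos {ζ : ℝ → ℝ} {e x y : ℝ} (hpos : 0 < (y - ζ x) ^ 2 + e ^ 2) (ξ : ℝ) :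
    0 < ξ ^ 2 + (y - ζ (x - ξ)) ^ 2 + e ^ 2 := by
  rcases eq_or_ne ξ 0 with rfl | hξ
  · simpa using hpos
  · positivity

lemma abs_div_quad_le (A e : ℝ) {ξ : ℝ} (hξ : ξ ≠ 0) :
    |-A / (ξ ^ 2 + A ^ 2 + e ^ 2)| ≤ 1 / |ξ| := by
  have hp : 0 < |ξ| := abs_pos.2 hξ
  rw [abs_div, abs_of_pos (a := ξ ^ 2 + _ + _) (by positivity), abs_neg,
    div_le_div_iff₀ (by positivity) hp, ← sq_abs ξ, ← sq_abs A]
  nlinarith [sq_nonneg (|ξ| - |A|), sq_nonneg e, abs_nonneg A]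

namespace IsSheet

variable {β C a : ℝ} {ζ ζ' : ℝ → ℝ}

lemma continuous_hker (h : IsSheet β C a ζ ζ') {e x y : ℝ} (hpos : 0 < (y - ζ x) ^ 2 + e ^ 2) :
    Continuous (hker ζ e x y) :=
  continuousOn_univ.1 (continuous_hker_aux h.continuous fun ξ _ => quad_pos hpos ξ)

lemma continuous_bsFst (h : IsSheet β C a ζ ζ') {e x y : ℝ} (hpos : 0 < (y - ζ x) ^ 2 + e ^ 2) :
    Continuous (bsFst ζ ζ' e x y) := by
  have h1 := h.cont
  have h2 := h.continuous
  unfold bsFst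
  exact (h1.comp (by fun_prop)).mul (Continuous.div (by fun_prop) (by fun_prop)
    fun ξ => (quad_pos hpos ξ).ne')

lemma continuous_bsSnd (h : IsSheet β C a ζ ζ') {e x y : ℝ} (hpos : 0 < (y - ζ x) ^ 2 + e ^ 2) :
    Continuous (bsSnd ζ ζ' e x y) := by
  have h1 := h.cont
  unfold bsSnd
  exact (h1.comp (by fun_prop)).mul (h.continuous_hker hpos)

lemma integral_hker_eq (h : IsSheet β C a ζ ζ') {e x y : ℝ} (hpos : 0 < (y - ζ x) ^ 2 + e ^ 2)
    (R : ℝ) : ∫ ξ in (-R)..R, hker ζ e x y ξ = ∫ ξ in (0 : ℝ)..R, tanPair ζ e x y ξ := by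
  have hc := h.continuous_hker hpos
  have hcn : Continuous fun ξ => hker ζ e x y (-ξ) := hc.comp continuous_neg
  have h1 := intervalIntegral.integral_comp_neg (a := 0) (b := R) (hker ζ e x y)
  rw [neg_zero] at h1
  rw [← intervalIntegral.integral_add_adjacent_intervals (b := 0) (hc.intervalIntegrable _ _)
    (hc.intervalIntegrable _ _), ← h1]
  unfold tanPair
  rw [intervalIntegral.integral_add (hc.intervalIntegrable _ _)
    (hcn.intervalIntegrable _ _), add_comm]

/-- Splitting of `ζ'(x - ξ)` into its value at `x` and the increment. -/
lemma integral_bsSnd_eq (h : IsSheet β C a ζ ζ') {e x y : ℝ} (hpos : 0 < (y - ζ x) ^ 2 + e ^ 2)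
    (R : ℝ) : ∫ ξ in (-R)..R, bsSnd ζ ζ' e x y ξ =
      (∫ ξ in (0 : ℝ)..R, norPair ζ ζ' e x y ξ)
        + ζ' x * ∫ ξ in (0 : ℝ)..R, tanPair ζ e x y ξ := by
  have hc := h.continuous_hker hpos
  have hs := h.continuous_bsSnd hpos
  have h1 := intervalIntegral.integral_comp_neg (a := 0) (b := R) (bsSnd ζ ζ' e x y)
  rw [neg_zero] at h1
  have hcn : Continuous fun ξ => hker ζ e x y (-ξ) := hc.comp continuous_neg
  have hsn : Continuous fun ξ => bsSnd ζ ζ' e x y (-ξ) := hs.comp continuous_neg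
  have hz := h.cont
  have c1 : Continuous (norPair ζ ζ' e x y) := by unfold norPair; fun_prop
  have c2 : Continuous (tanPair ζ e x y) := by unfold tanPair; fun_prop
  have c3 : Continuous fun ξ => ζ' x * tanPair ζ e x y ξ := continuous_const.mul c2
  rw [← intervalIntegral.integral_add_adjacent_intervals (b := 0) (hs.intervalIntegrable _ _)
    (hs.intervalIntegrable _ _), ← h1, ← intervalIntegral.integral_const_mul,
    ← intervalIntegral.integral_add (hsn.intervalIntegrable _ _)
      (hs.intervalIntegrable _ _),
    ← intervalIntegral.integral_add (c1.intervalIntegrable _ _)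
      (c3.intervalIntegrable _ _)]
  congr 1
  ext ξ
  unfold norPair tanPair bsSnd
  ring

/-- The first component of the Biot–Savart integrand differs from `hker` by a total derivative of
`log |·|²`, which contributes only boundary terms of order `1 / R`. -/
lemma abs_integral_bsFst_sub_le (h : IsSheet β C a ζ ζ') (ha : 0 < a) {e x y : ℝ}
    (hpos : 0 < (y - ζ x) ^ 2 + e ^ 2) {R : ℝ} (hR : 0 < R) :
    |(∫ ξ in (-R)..R, bsFst ζ ζ' e x y ξ) - ∫ ξ in (0 : ℝ)..R, tanPair ζ e x y ξ| ≤
      (|β| + C) * (2 * |y - ζ x| + 4 * C) / R := by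
  rw [← h.integral_hker_eq hpos, ← intervalIntegral.integral_sub
    ((h.continuous_bsFst hpos).intervalIntegrable _ _)
    ((h.continuous_hker hpos).intervalIntegrable _ _)]
  set q : ℝ → ℝ := fun ξ => ξ ^ 2 + (y - ζ (x - ξ)) ^ 2 + e ^ 2 with hq
  have hqpos : ∀ ξ, 0 < q ξ := quad_pos hpos
  have hd : ∀ ξ, HasDerivAt (fun ξ => -(1 / 2) * Real.log (q ξ))
      (bsFst ζ ζ' e x y ξ - hker ζ e x y ξ) ξ := by
    intro ξ
    have h1 : HasDerivAt (fun ξ => ζ (x - ξ)) (ζ' (x - ξ) * (-1)) ξ :=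
      (h.hasDerivAt (x - ξ)).comp ξ ((hasDerivAt_id ξ).const_sub x)
    have h2 : HasDerivAt q (2 * ξ + 2 * (y - ζ (x - ξ)) * ζ' (x - ξ)) ξ := by
      refine ((((hasDerivAt_id ξ).pow 2).add ((h1.const_sub y).pow 2)).add_const
        (e ^ 2)).congr_deriv ?_
      simp
    refine ((h2.log (hqpos ξ).ne').const_mul (-(1 / 2))).congr_deriv ?_
    have hne := (hqpos ξ).ne'
    unfold bsFst hker
    simp only [hq] at hne ⊢
    field_simp
    ring
  rw [intervalIntegral.integral_eq_sub_of_hasDerivAt (fun ξ _ => hd ξ)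
    (((h.continuous_bsFst hpos).sub (h.continuous_hker hpos)).intervalIntegrable _ _)]
  have hC := h.nonneg
  have hl := h.abs_sub_le ha (x - R) (x - -R)
  have hx : x - R - (x - -R) = -(2 * R) := by ring
  rw [hx, abs_neg, abs_of_pos (a := 2 * R) (by linarith)] at hl
  have hsd := h.abs_second_diff_le x R
  have e1 : |q R - q (-R)| ≤ 2 * (|β| + C) * R * (2 * |y - ζ x| + 4 * C) := by
    have : q R - q (-R) = -((ζ (x - R) - ζ (x - -R)) *
        (2 * (y - ζ x) - (ζ (x - R) + ζ (x - -R) - 2 * ζ x))) := by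
      simp only [hq]; ring
    rw [this, abs_neg, abs_mul]
    refine mul_le_mul (hl.trans (by linarith)) ?_ (abs_nonneg _) (by positivity)
    refine (abs_sub _ _).trans ?_
    rw [abs_mul, abs_two]
    linarith
  have hRq : ∀ ξ, ξ ^ 2 ≤ q ξ := fun ξ => by
    simp only [hq]; nlinarith [sq_nonneg (y - ζ (x - ξ)), sq_nonneg e]
  have hlog : ∀ u v : ℝ, R ^ 2 ≤ u → R ^ 2 ≤ v → Real.log u - Real.log v ≤ |u - v| / R ^ 2 := by
    intro u v hu hv
    have hR2 : 0 < R ^ 2 := by positivity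
    have hv0 : 0 < v := hR2.trans_le hv
    have hu0 : 0 < u := hR2.trans_le hu
    rw [← Real.log_div hu0.ne' hv0.ne']
    refine (Real.log_le_sub_one_of_pos (by positivity)).trans ?_
    rw [div_sub_one hv0.ne']
    calc (u - v) / v ≤ |u - v| / v := by gcongr; exact le_abs_self _
      _ ≤ _ := by gcongr
  have hq1 := hRq R
  have hq2 := hRq (-R)
  rw [neg_sq] at hq2
  have l1 := hlog _ _ hq1 hq2
  have l2 := hlog _ _ hq2 hq1
  rw [abs_sub_comm] at l2
  have e2 : |q R - q (-R)| / R ^ 2 ≤ 2 * ((|β| + C) * (2 * |y - ζ x| + 4 * C) / R) := by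
    rw [div_le_iff₀ (by positivity)]
    refine e1.trans (le_of_eq ?_)
    field_simp
  rw [abs_le]
  constructor <;> linarith

lemma abs_bsFst_le (h : IsSheet β C a ζ ζ') (ha : 0 < a) (e x y : ℝ) {ξ : ℝ} (hξ : ξ ≠ 0) :
    |bsFst ζ ζ' e x y ξ| ≤ (|β| + C) / |ξ| := by
  unfold bsFst
  rw [abs_mul, div_eq_mul_one_div (|β| + C)]
  have := h.nonneg
  exact mul_le_mul (h.abs_deriv_le ha _) (abs_div_quad_le _ _ hξ) (abs_nonneg _) (by positivity)

lemma abs_bsSnd_le (h : IsSheet β C a ζ ζ') (ha : 0 < a) (e x y ξ : ℝ) :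
    |bsSnd ζ ζ' e x y ξ| ≤ (|β| + C) / |ξ| := by
  unfold bsSnd
  rw [abs_mul, div_eq_mul_one_div (|β| + C)]
  have := h.nonneg
  exact mul_le_mul (h.abs_deriv_le ha _) (abs_hker_le _ _ _ _ _) (abs_nonneg _) (by positivity)

lemma tendsto_integral_bsFst (h : IsSheet β C a ζ ζ') (ha : 0 < a) {e x y : ℝ}
    (hpos : 0 < (y - ζ x) ^ 2 + e ^ 2) :
    Tendsto (fun R => ∫ ξ in (-R)..R, bsFst ζ ζ' e x y ξ) atTop (𝓝 (tanInt ζ e x y)) := by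
  have h1 := intervalIntegral_tendsto_integral_Ioi 0 (h.integrableOn_tanPair ha e x y) tendsto_id
  have h2 : Tendsto (fun R => (∫ ξ in (-R)..R, bsFst ζ ζ' e x y ξ)
      - ∫ ξ in (0 : ℝ)..R, tanPair ζ e x y ξ) atTop (𝓝 0) := by
    refine squeeze_zero_norm' ?_
      (tendsto_const_nhds (x := (|β| + C) * (2 * |y - ζ x| + 4 * C)).div_atTop tendsto_id)
    filter_upwards [eventually_gt_atTop 0] with R hR
    exact h.abs_integral_bsFst_sub_le ha hpos hR
  simpa [tanInt] using h2.add h1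

lemma tendsto_integral_bsSnd (h : IsSheet β C a ζ ζ') (ha : 0 < a) {e x y : ℝ}
    (hpos : 0 < (y - ζ x) ^ 2 + e ^ 2) :
    Tendsto (fun R => ∫ ξ in (-R)..R, bsSnd ζ ζ' e x y ξ) atTop
      (𝓝 (norInt ζ ζ' e x y + ζ' x * tanInt ζ e x y)) := by
  have h1 := intervalIntegral_tendsto_integral_Ioi 0 (h.integrableOn_tanPair ha e x y) tendsto_id
  have h2 := intervalIntegral_tendsto_integral_Ioi 0 (h.integrableOn_norPair ha e x y) tendsto_id
  simp_rw [h.integral_bsSnd_eq hpos]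
  exact h2.add (h1.const_mul _)

end IsSheet

/-- A window centred at `0` instead of `x` changes the integral only by pieces at distance `R`, of
length `|x|`, where the integrand is small. -/
lemma abs_integral_window_sub_le {f : ℝ → ℝ} (hf : Continuous f) {L : ℝ}
    (hL : ∀ ξ, ξ ≠ 0 → |f ξ| ≤ L / |ξ|) {x R : ℝ} (hR : |x| < R) :
    |(∫ s in (-R)..R, f (x - s)) - ∫ ξ in (-R)..R, f ξ| ≤ 2 * L * |x| / (R - |x|) := by
  have hd : 0 < R - |x| := by linarith
  have hL0 : 0 ≤ L := by
    have := (abs_nonneg _).trans (hL 1 one_ne_zero)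
    simpa using this
  have hx := abs_le.1 (le_refl |x|)
  rw [intervalIntegral.integral_comp_sub_left, sub_neg_eq_add,
    intervalIntegral.integral_interval_sub_interval_comm' (hf.intervalIntegrable _ _)
      (hf.intervalIntegrable _ _) (hf.intervalIntegrable _ _)]
  have key : ∀ u v : ℝ, (∀ ξ ∈ uIoc u v, R - |x| ≤ |ξ|) → |v - u| ≤ |x| →
      |∫ ξ in u..v, f ξ| ≤ L * |x| / (R - |x|) := by
    intro u v huv hvu
    have := intervalIntegral.norm_integral_le_of_norm_le_const (a := u) (b := v) (f := f)
      (C := L / (R - |x|)) (fun ξ hξ => ?_)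
    · refine this.trans ?_
      rw [div_mul_eq_mul_div]
      gcongr
    · have h1 := huv ξ hξ
      have h0 : ξ ≠ 0 := by
        rintro rfl
        rw [abs_zero] at h1
        linarith
      refine (hL ξ h0).trans ?_
      gcongr
  have k1 := key R (x + R) (fun ξ hξ => by
    rw [mem_uIoc] at hξ
    have := le_abs_self ξ
    rcases hξ with hξ | hξ <;> linarith) (by simp)
  have k2 := key (x - R) (-R) (fun ξ hξ => by
    rw [mem_uIoc] at hξ
    have := neg_le_abs ξ
    rcases hξ with hξ | hξ <;> linarith)
    (by rw [show -R - (x - R) = -x by ring, abs_neg])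
  have k3 := key (-R) (x - R) (fun ξ hξ => by
    rw [mem_uIoc] at hξ
    have := neg_le_abs ξ
    rcases hξ with hξ | hξ <;> linarith) (by simp)
  have e : 2 * L * |x| / (R - |x|) = L * |x| / (R - |x|) + L * |x| / (R - |x|) := by ring
  rw [e]
  refine (abs_sub _ _).trans ?_
  linarith

lemma tendsto_window_error (L x : ℝ) :
    Tendsto (fun R : ℝ => 2 * L * |x| / (R - |x|)) atTop (𝓝 0) :=
  tendsto_const_nhds.div_atTop (tendsto_atTop_add_const_right _ (-|x|) tendsto_id)

lemma tendsto_window {f : ℝ → ℝ} (hf : Continuous f) {L : ℝ}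
    (hL : ∀ ξ, ξ ≠ 0 → |f ξ| ≤ L / |ξ|) (x : ℝ) {l : ℝ}
    (hl : Tendsto (fun R => ∫ ξ in (-R)..R, f ξ) atTop (𝓝 l)) :
    Tendsto (fun R => ∫ s in (-R)..R, f (x - s)) atTop (𝓝 l) := by
  have h : Tendsto (fun R => (∫ s in (-R)..R, f (x - s)) - ∫ ξ in (-R)..R, f ξ) atTop (𝓝 0) := by
    refine squeeze_zero_norm' ?_ (tendsto_window_error L x)
    filter_upwards [eventually_gt_atTop |x|] with R hR
    exact abs_integral_window_sub_le hf hL hR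
  simpa using h.add hl

namespace IsSheet

variable {β C a : ℝ} {ζ ζ' : ℝ → ℝ}

lemma tendsto_window_bsFst (h : IsSheet β C a ζ ζ') (ha : 0 < a) {e x y : ℝ}
    (hpos : 0 < (y - ζ x) ^ 2 + e ^ 2) :
    Tendsto (fun R => ∫ s in (-R)..R, bsFst ζ ζ' e x y (x - s)) atTop
      (𝓝 (2 * Real.pi * velFst ζ e x y)) := by
  rw [velFst, mul_inv_cancel_left₀ (by positivity)]
  exact tendsto_window (h.continuous_bsFst hpos) (fun ξ hξ => h.abs_bsFst_le ha e x y hξ) x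
    (h.tendsto_integral_bsFst ha hpos)

lemma tendsto_window_bsSnd (h : IsSheet β C a ζ ζ') (ha : 0 < a) {e x y : ℝ}
    (hpos : 0 < (y - ζ x) ^ 2 + e ^ 2) :
    Tendsto (fun R => ∫ s in (-R)..R, bsSnd ζ ζ' e x y (x - s)) atTop
      (𝓝 (2 * Real.pi * velSnd ζ ζ' e x y)) := by
  rw [velSnd, mul_inv_cancel_left₀ (by positivity)]
  exact tendsto_window (h.continuous_bsSnd hpos) (fun ξ _ => h.abs_bsSnd_le ha e x y ξ) x
    (h.tendsto_integral_bsSnd ha hpos)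

/-- A bound for the velocity of a sheet. -/
noncomputable def velBound (β C a : ℝ) : ℝ := norBound β C a + (1 + |β| + C) * tanBound β C a

lemma tanBound_nonneg (h : IsSheet β C a ζ ζ') (ha : 0 < a) : 0 ≤ tanBound β C a :=
  (abs_nonneg _).trans (h.abs_tanInt_le ha 0 0 0)

lemma norBound_nonneg (h : IsSheet β C a ζ ζ') (ha : 0 < a) : 0 ≤ norBound β C a :=
  (abs_nonneg _).trans (h.abs_norInt_le ha 0 0 0)

lemma one_le_two_pi : 1 ≤ 2 * Real.pi := by linarith [Real.pi_gt_three]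

lemma abs_two_pi_inv_mul_le (r : ℝ) : |(2 * Real.pi)⁻¹ * r| ≤ |r| := by
  rw [abs_mul, abs_of_pos (a := (2 * Real.pi)⁻¹) (by positivity)]
  exact mul_le_of_le_one_left (abs_nonneg _) (inv_le_one_of_one_le₀ one_le_two_pi)

lemma abs_velFst_le (h : IsSheet β C a ζ ζ') (ha : 0 < a) (e x y : ℝ) :
    |velFst ζ e x y| ≤ velBound β C a := by
  refine (abs_two_pi_inv_mul_le _).trans ((h.abs_tanInt_le ha e x y).trans ?_)
  have := h.tanBound_nonneg ha
  have := h.norBound_nonneg ha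
  have : 0 ≤ (|β| + C) * tanBound β C a := by have := h.nonneg; positivity
  unfold velBound
  linarith

lemma abs_velSnd_le (h : IsSheet β C a ζ ζ') (ha : 0 < a) (e x y : ℝ) :
    |velSnd ζ ζ' e x y| ≤ velBound β C a := by
  refine (abs_two_pi_inv_mul_le _).trans ((abs_add_le _ _).trans ?_)
  have h1 := h.abs_norInt_le ha e x y
  have h2 := h.abs_tanInt_le ha e x y
  have h3 := h.abs_deriv_le ha x
  have h4 := h.tanBound_nonneg ha
  have h5 : 0 ≤ |β| + C := by have := h.nonneg; positivity
  rw [abs_mul]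
  have := mul_le_mul h3 h2 (abs_nonneg _) h5
  unfold velBound
  linarith

/-- The integrals over windows are bounded locally uniformly in the point and in the window. -/
lemma abs_window_le (h : IsSheet β C a ζ ζ') (ha : 0 < a) {e x y r d R : ℝ}
    (hpos : 0 < (y - ζ x) ^ 2 + e ^ 2) (hx : |x| ≤ r) (hd : |y - ζ x| ≤ d) (hR : 2 * r + 1 ≤ R) :
    |∫ s in (-R)..R, bsFst ζ ζ' e x y (x - s)| ≤
        velBound β C a + (|β| + C) * (2 * d + 4 * C) + 2 * (|β| + C) ∧
    |∫ s in (-R)..R, bsSnd ζ ζ' e x y (x - s)| ≤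
        velBound β C a + (|β| + C) * (2 * d + 4 * C) + 2 * (|β| + C) := by
  have hx0 := abs_nonneg x
  have hC := h.nonneg
  have hd0 := (abs_nonneg _).trans hd
  have hR1 : 1 ≤ R := by linarith
  have hL : 0 ≤ |β| + C := by positivity
  have hw : 2 * (|β| + C) * |x| / (R - |x|) ≤ 2 * (|β| + C) := by
    rw [div_le_iff₀ (by linarith)]
    gcongr
    linarith
  have w1 := (abs_integral_window_sub_le (h.continuous_bsFst hpos)
    (fun ξ hξ => h.abs_bsFst_le ha e x y hξ) (R := R) (by linarith)).trans hw
  have w2 := (abs_integral_window_sub_le (h.continuous_bsSnd hpos)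
    (fun ξ _ => h.abs_bsSnd_le ha e x y ξ) (R := R) (by linarith)).trans hw
  have t1 : |∫ ξ in (0 : ℝ)..R, tanPair ζ e x y ξ| ≤ tanBound β C a := by
    rw [intervalIntegral.integral_of_le (by linarith)]
    exact h.abs_setIntegral_tanPair_le ha e x y Ioc_subset_Ioi_self measurableSet_Ioc
  have n1 : |∫ ξ in (0 : ℝ)..R, norPair ζ ζ' e x y ξ| ≤ norBound β C a := by
    rw [intervalIntegral.integral_of_le (by linarith)]
    exact h.abs_setIntegral_norPair_le ha e x y Ioc_subset_Ioi_self measurableSet_Ioc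
  have f1 := h.abs_integral_bsFst_sub_le ha hpos (R := R) (by linarith)
  have f2 : (|β| + C) * (2 * |y - ζ x| + 4 * C) / R ≤ (|β| + C) * (2 * d + 4 * C) := by
    refine (div_le_self (by positivity) hR1).trans ?_
    gcongr
  have b0 := h.tanBound_nonneg ha
  have b1 := h.norBound_nonneg ha
  have b2 : 0 ≤ (|β| + C) * tanBound β C a := by positivity
  have b3 : 0 ≤ (|β| + C) * (2 * d + 4 * C) := by positivity
  have e1 : |∫ ξ in (-R)..R, bsSnd ζ ζ' e x y ξ| ≤
      norBound β C a + (|β| + C) * tanBound β C a := by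
    rw [h.integral_bsSnd_eq hpos]
    refine (abs_add_le _ _).trans (add_le_add n1 ?_)
    rw [abs_mul]
    exact mul_le_mul (h.abs_deriv_le ha x) t1 (abs_nonneg _) hL
  unfold velBound
  rw [abs_le] at *
  constructor
  · constructor <;> linarith
  · rw [abs_le]; constructor <;> linarith

end IsSheet

lemma Plane.tendsto_mk {ι : Type*} {l : Filter ι} {f g : ι → ℝ} {p q : ℝ}
    (hf : Tendsto f l (𝓝 p)) (hg : Tendsto g l (𝓝 q)) :
    Tendsto (fun i => (!₂[f i, g i] : Plane)) l (𝓝 !₂[p, q]) := by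
  refine ((PiLp.continuous_toLp 2 (fun _ : Fin 2 => ℝ)).tendsto _).comp (tendsto_pi_nhds.2 ?_)
  intro i
  fin_cases i
  · exact hf
  · exact hg

lemma Plane.continuous_mk : Continuous fun q : ℝ × ℝ => (!₂[q.1, q.2] : Plane) :=
  continuous_iff_continuousAt.2 fun _ => Plane.tendsto_mk continuousAt_fst continuousAt_snd

namespace IsSheet

variable {β C a : ℝ} {ζ ζ' : ℝ → ℝ}

lemma sheetVelocity_eq (h : IsSheet β C a ζ ζ') {x : Plane} (hx : x 1 ≠ ζ (x 0)) (R : ℝ) :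
    sheetVelocity ζ R x = !₂[(2 * Real.pi)⁻¹ * ∫ ξ in (-R)..R, bsFst ζ ζ' 0 (x 0) (x 1) ξ,
      (2 * Real.pi)⁻¹ * ∫ ξ in (-R)..R, bsSnd ζ ζ' 0 (x 0) (x 1) ξ] := by
  have hpos : 0 < (x 1 - ζ (x 0)) ^ 2 + (0 : ℝ) ^ 2 := by
    have : x 1 - ζ (x 0) ≠ 0 := sub_ne_zero.2 hx
    positivity
  have hd : deriv ζ = ζ' := funext fun s => (h.hasDerivAt s).deriv
  have hint : ∀ ξ, deriv ζ (x 0 - ξ) • bsKernel !₂[ξ, x 1 - ζ (x 0 - ξ)] =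
      !₂[(2 * Real.pi)⁻¹ * bsFst ζ ζ' 0 (x 0) (x 1) ξ,
        (2 * Real.pi)⁻¹ * bsSnd ζ ζ' 0 (x 0) (x 1) ξ] := by
    intro ξ
    rw [hd]
    have hn : ‖(!₂[ξ, x 1 - ζ (x 0 - ξ)] : Plane)‖ ^ 2 = ξ ^ 2 + (x 1 - ζ (x 0 - ξ)) ^ 2 := by
      rw [EuclideanSpace.norm_sq_eq]
      simp
    ext i
    fin_cases i
    · simp [bsKernel, hn, bsFst]
      ring
    · simp [bsKernel, hn, bsSnd, hker]
      ring
  have c1 := h.continuous_bsFst hpos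
  have c2 := h.continuous_bsSnd hpos
  have hcont : Continuous fun ξ => (!₂[(2 * Real.pi)⁻¹ * bsFst ζ ζ' 0 (x 0) (x 1) ξ,
        (2 * Real.pi)⁻¹ * bsSnd ζ ζ' 0 (x 0) (x 1) ξ] : Plane) :=
    Plane.continuous_mk.comp ((continuous_const.mul c1).prodMk (continuous_const.mul c2))
  unfold sheetVelocity
  simp_rw [hint]
  ext i
  have := (EuclideanSpace.proj i : Plane →L[ℝ] ℝ).intervalIntegral_comp_comm
    (hcont.intervalIntegrable (μ := volume) (-R) R)
  refine this.symm.trans ?_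
  fin_cases i
  · exact intervalIntegral.integral_const_mul _ _
  · exact intervalIntegral.integral_const_mul _ _

/-- The truncated velocities converge off the sheet, and the limit is given by the principal
values. -/
lemma tendsto_sheetVelocity (h : IsSheet β C a ζ ζ') (ha : 0 < a) {x : Plane}
    (hx : x 1 ≠ ζ (x 0)) :
    Tendsto (fun R => sheetVelocity ζ R x) atTop
      (𝓝 !₂[velFst ζ 0 (x 0) (x 1), velSnd ζ ζ' 0 (x 0) (x 1)]) := by
  have hpos : 0 < (x 1 - ζ (x 0)) ^ 2 + (0 : ℝ) ^ 2 := by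
    have : x 1 - ζ (x 0) ≠ 0 := sub_ne_zero.2 hx
    positivity
  simp_rw [h.sheetVelocity_eq hx]
  exact Plane.tendsto_mk ((h.tendsto_integral_bsFst ha hpos).const_mul _)
    ((h.tendsto_integral_bsSnd ha hpos).const_mul _)

end IsSheet

end Muskat

/-! ### Integration by parts above a graph -/

namespace Muskat

/-- The region above the graph of `g`. -/
def above (g : ℝ → ℝ) : Set (ℝ × ℝ) := {q | g q.1 < q.2}

lemma isOpen_above {g : ℝ → ℝ} (hg : Continuous g) : IsOpen (above g) :=
  isOpen_lt (hg.comp continuous_fst) continuous_snd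

lemma measurableSet_above {g : ℝ → ℝ} (hg : Continuous g) : MeasurableSet (above g) :=
  (isOpen_above hg).measurableSet

/-- Partial derivative of a function on `ℝ × ℝ` in the first variable. -/
noncomputable def d1 (F : ℝ × ℝ → ℝ) (q : ℝ × ℝ) : ℝ := fderiv ℝ F q (1, 0)

/-- Partial derivative of a function on `ℝ × ℝ` in the second variable. -/
noncomputable def d2 (F : ℝ × ℝ → ℝ) (q : ℝ × ℝ) : ℝ := fderiv ℝ F q (0, 1)

lemma hasDerivAt_comp_curve {F : ℝ × ℝ → ℝ} (hF : Differentiable ℝ F) {p q : ℝ → ℝ} {p' q' t : ℝ}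
    (hp : HasDerivAt p p' t) (hq : HasDerivAt q q' t) :
    HasDerivAt (fun t => F (p t, q t)) (p' * d1 F (p t, q t) + q' * d2 F (p t, q t)) t := by
  have h := (hF (p t, q t)).hasFDerivAt.comp_hasDerivAt t (hp.prodMk hq)
  refine h.congr_deriv ?_
  have e : ((p', q') : ℝ × ℝ) = p' • (1, 0) + q' • (0, 1) := by simp
  rw [e, map_add, map_smul, map_smul]
  rfl

lemma continuous_d1 {F : ℝ × ℝ → ℝ} (hF : ContDiff ℝ 1 F) : Continuous (d1 F) :=
  (hF.continuous_fderiv one_ne_zero).clm_apply continuous_const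

lemma continuous_d2 {F : ℝ × ℝ → ℝ} (hF : ContDiff ℝ 1 F) : Continuous (d2 F) :=
  (hF.continuous_fderiv one_ne_zero).clm_apply continuous_const

lemma hasCompactSupport_d1 {F : ℝ × ℝ → ℝ} (hF : HasCompactSupport F) :
    HasCompactSupport (d1 F) := hF.fderiv_apply ℝ _

lemma hasCompactSupport_d2 {F : ℝ × ℝ → ℝ} (hF : HasCompactSupport F) :
    HasCompactSupport (d2 F) := hF.fderiv_apply ℝ _

/-- The homeomorphism `(s, y) ↦ (s, g(s) + y)`. -/
def shear {g : ℝ → ℝ} (hg : Continuous g) : ℝ × ℝ ≃ₜ ℝ × ℝ where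
  toFun q := (q.1, g q.1 + q.2)
  invFun q := (q.1, q.2 - g q.1)
  left_inv q := by simp
  right_inv q := by simp
  continuous_toFun := by fun_prop
  continuous_invFun := by fun_prop

lemma setIntegral_above {g : ℝ → ℝ} (hg : Continuous g) {f : ℝ × ℝ → ℝ} (hf : Integrable f) :
    ∫ q in above g, f q = ∫ s, ∫ y in Ioi (g s), f (s, y) := by
  rw [← integral_indicator (measurableSet_above hg), Measure.volume_eq_prod,
    integral_prod _ (hf.indicator (measurableSet_above hg))]
  refine integral_congr_ae (Eventually.of_forall fun s => ?_)
  simp only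
  rw [← integral_indicator measurableSet_Ioi]
  rfl

lemma integral_Ioi_shift (f : ℝ → ℝ) (b : ℝ) :
    ∫ y in Ioi b, f y = ∫ y in Ioi (0 : ℝ), f (b + y) := by
  rw [← integral_indicator measurableSet_Ioi, ← integral_indicator measurableSet_Ioi,
    ← integral_add_left_eq_self (μ := volume) ((Ioi b).indicator f) b]
  congr 1
  ext y
  simp [indicator]

lemma eventually_snd_eq_zero {F : ℝ × ℝ → ℝ} (hc : HasCompactSupport F) :
    ∃ B : ℝ, 0 < B ∧ ∀ q : ℝ × ℝ, B < |q.1| ∨ B < |q.2| → F q = 0 := by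
  obtain ⟨B, hB⟩ := hc.isCompact.isBounded.exists_norm_le
  refine ⟨max B 1, by positivity, fun q hq => image_eq_zero_of_notMem_tsupport fun hmem => ?_⟩
  have h := hB q hmem
  rw [Prod.norm_def] at h
  have h1 := (le_max_left ‖q.1‖ ‖q.2‖).trans h
  have h2 := (le_max_right ‖q.1‖ ‖q.2‖).trans h
  rw [Real.norm_eq_abs] at h1 h2
  have := le_max_left B 1
  rcases hq with hq | hq <;> linarith

/-- Integration of a vertical derivative above a graph. -/
lemma integral_above_deriv_snd {g : ℝ → ℝ} (hg : Continuous g) {F F' : ℝ × ℝ → ℝ}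
    (hF : ∀ s y, HasDerivAt (fun y => F (s, y)) (F' (s, y)) y) (hF' : Continuous F')
    (hc : HasCompactSupport F) (hc' : HasCompactSupport F') :
    ∫ q in above g, F' q = -∫ s, F (s, g s) := by
  rw [setIntegral_above hg (hF'.integrable_of_hasCompactSupport hc'), ← integral_neg]
  congr 1
  ext s
  obtain ⟨B, -, hB⟩ := eventually_snd_eq_zero hc
  obtain ⟨B', -, hB'⟩ := eventually_snd_eq_zero hc'
  have ht : Tendsto (fun y => F (s, y)) atTop (𝓝 0) := by
    refine tendsto_const_nhds.congr' ?_
    filter_upwards [eventually_gt_atTop B] with y hy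
    exact (hB (s, y) (Or.inr (hy.trans_le (le_abs_self y)))).symm
  have hi : Integrable fun y => F' (s, y) := by
    refine (hF'.comp (Continuous.prodMk_right s)).integrable_of_hasCompactSupport ?_
    refine HasCompactSupport.intro (isCompact_Icc (a := -B') (b := B')) fun y hy => ?_
    refine hB' (s, y) (Or.inr ?_)
    by_contra h
    exact hy (abs_le.1 (not_lt.1 h))
  rw [integral_Ioi_of_hasDerivAt_of_tendsto (hF s (g s)).continuousAt.continuousWithinAt
    (fun y _ => hF s y) hi.integrableOn ht]
  simp

lemma hasCompactSupport_mul_left {F : ℝ × ℝ → ℝ} (hc : HasCompactSupport F) (k : ℝ × ℝ → ℝ) :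
    HasCompactSupport fun q => k q * F q := hc.mul_left

/-- The divergence theorem above a graph, for the horizontal derivative. -/
lemma integral_above_d1 {g g' : ℝ → ℝ} (hg : ∀ s, HasDerivAt g (g' s) s) (hg' : Continuous g')
    {G : ℝ × ℝ → ℝ} (hG : ContDiff ℝ 1 G) (hc : HasCompactSupport G) :
    ∫ q in above g, d1 G q = ∫ s, g' s * G (s, g s) := by
  have hgc : Continuous g := continuous_iff_continuousAt.2 fun s => (hg s).continuousAt
  have hGd : Differentiable ℝ G := hG.differentiable one_ne_zero
  have c1 := continuous_d1 hG
  have c2 := continuous_d2 hG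
  have s1 := hasCompactSupport_d1 hc
  have s2 := hasCompactSupport_mul_left (hasCompactSupport_d2 hc) (fun q => g' q.1)
  have hGy : ∀ s y, HasDerivAt (fun y => g' s * G (s, y)) (g' s * d2 G (s, y)) y := by
    intro s y
    have := hasDerivAt_comp_curve hGd (hasDerivAt_const y s) (hasDerivAt_id y)
    exact (this.const_mul (g' s)).congr_deriv (by simp)
  have cg2 : Continuous fun q : ℝ × ℝ => g' q.1 * d2 G q := by fun_prop
  have h1 := integral_above_deriv_snd hgc (F := fun q => g' q.1 * G q)
    (F' := fun q => g' q.1 * d2 G q) hGy cg2 (hasCompactSupport_mul_left hc (fun q => g' q.1)) s2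
  have i1 : Integrable (d1 G) := c1.integrable_of_hasCompactSupport s1
  have i2 : Integrable fun q : ℝ × ℝ => g' q.1 * d2 G q := cg2.integrable_of_hasCompactSupport s2
  have h2 : ∫ q in above g, (d1 G q + g' q.1 * d2 G q) = 0 := by
    have i3 : Integrable fun q : ℝ × ℝ => d1 G q + g' q.1 * d2 G q := i1.add i2
    rw [setIntegral_above hgc i3]
    simp_rw [integral_Ioi_shift _ (g _)]
    have hcont : Continuous fun q : ℝ × ℝ => d1 G q + g' q.1 * d2 G q := c1.add cg2
    rw [integral_integral_swap_of_hasCompactSupport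
      (f := fun s y => d1 G (s, g s + y) + g' s * d2 G (s, g s + y))
      (hcont.comp (shear hgc).continuous) ((s1.add s2).comp_homeomorph (shear hgc))]
    refine integral_eq_zero_of_ae (Eventually.of_forall fun y => ?_)
    have hd : ∀ s, HasDerivAt (fun s => G (s, g s + y))
        (d1 G (s, g s + y) + g' s * d2 G (s, g s + y)) s := fun s =>
      (hasDerivAt_comp_curve hGd (hasDerivAt_id s) ((hg s).add_const y)).congr_deriv (by simp)
    have supp : ∀ {H : ℝ × ℝ → ℝ}, Continuous H → HasCompactSupport H →
        Integrable fun s => H (s, g s + y) := by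
      intro H hH hHc
      obtain ⟨B, -, hB⟩ := eventually_snd_eq_zero hHc
      refine Continuous.integrable_of_hasCompactSupport (by fun_prop)
        (HasCompactSupport.intro (isCompact_Icc (a := -B) (b := B)) fun s hs => hB _ (Or.inl ?_))
      by_contra h
      exact hs (abs_le.1 (not_lt.1 h))
    exact integral_eq_zero_of_hasDerivAt_of_integrable hd (supp hcont (s1.add s2))
      (supp hG.continuous hc)
  rw [integral_add i1.integrableOn i2.integrableOn, h1] at h2
  simp only at h2
  linarith

/-- A field of the form `1_{y > ζ} ∇^⊥ (κ(s) (y - ζ(s)))` is divergence free: the stream function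
`κ(s) (y - ζ(s))₊` is continuous. -/
lemma integral_above_stream {g g' κ κ' : ℝ → ℝ} (hg : ∀ s, HasDerivAt g (g' s) s)
    (hg' : Continuous g') (hκ : ∀ s, HasDerivAt κ (κ' s) s) (hκ' : Continuous κ')
    {φ : ℝ × ℝ → ℝ} (hφ : ContDiff ℝ 1 φ) (hc : HasCompactSupport φ) :
    ∫ q in above g, (-κ q.1 * d1 φ q + (κ' q.1 * (q.2 - g q.1) - κ q.1 * g' q.1) * d2 φ q) = 0 := by
  have hgc : Continuous g := continuous_iff_continuousAt.2 fun s => (hg s).continuousAt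
  have hκc : Continuous κ := continuous_iff_continuousAt.2 fun s => (hκ s).continuousAt
  have hφd : Differentiable ℝ φ := hφ.differentiable one_ne_zero
  have hκd : ContDiff ℝ 1 κ := by
    rw [contDiff_one_iff_deriv]
    refine ⟨fun s => (hκ s).differentiableAt, ?_⟩
    rwa [show deriv κ = κ' from funext fun s => (hκ s).deriv]
  have hG : ContDiff ℝ 1 fun q : ℝ × ℝ => κ q.1 * φ q := (hκd.comp contDiff_fst).mul hφ
  have hGc : HasCompactSupport fun q : ℝ × ℝ => κ q.1 * φ q := hc.mul_left
  have e1 : ∀ q : ℝ × ℝ, d1 (fun q => κ q.1 * φ q) q = κ' q.1 * φ q + κ q.1 * d1 φ q := by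
    intro q
    have a1 := hasDerivAt_comp_curve (hG.differentiable one_ne_zero) (hasDerivAt_id q.1)
      (hasDerivAt_const q.1 q.2)
    have a2 := (hκ q.1).mul (hasDerivAt_comp_curve hφd (hasDerivAt_id q.1)
      (hasDerivAt_const q.1 q.2))
    have := a1.unique a2
    simpa using this
  have c1 := continuous_d1 hφ
  have c2 := continuous_d2 hφ
  have cφ := hφ.continuous
  have h1 := integral_above_d1 hg hg' hG hGc
  have cF : Continuous fun q : ℝ × ℝ => κ' q.1 * φ q +
      (κ' q.1 * (q.2 - g q.1) - κ q.1 * g' q.1) * d2 φ q := by fun_prop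
  have sF : HasCompactSupport fun q : ℝ × ℝ => κ' q.1 * φ q +
      (κ' q.1 * (q.2 - g q.1) - κ q.1 * g' q.1) * d2 φ q :=
    (HasCompactSupport.mul_left hc).add (HasCompactSupport.mul_left (hasCompactSupport_d2 hc))
  have h2 := integral_above_deriv_snd hgc
    (F := fun q => (κ' q.1 * (q.2 - g q.1) - κ q.1 * g' q.1) * φ q)
    (F' := fun q => κ' q.1 * φ q + (κ' q.1 * (q.2 - g q.1) - κ q.1 * g' q.1) * d2 φ q)
    (fun s y => by
      have a1 := hasDerivAt_comp_curve hφd (hasDerivAt_const y s) (hasDerivAt_id y)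
      have a2 := ((((hasDerivAt_id y).sub_const (g s)).const_mul (κ' s)).sub_const
        (κ s * g' s)).mul a1
      exact a2.congr_deriv (by simp)) cF hc.mul_left sF
  have i1 := (continuous_d1 hG).integrable_of_hasCompactSupport (μ := volume)
    (hasCompactSupport_d1 hGc)
  have i2 := cF.integrable_of_hasCompactSupport (μ := volume) sF
  have e2 : ∀ q : ℝ × ℝ, -κ q.1 * d1 φ q + (κ' q.1 * (q.2 - g q.1) - κ q.1 * g' q.1) * d2 φ q =
      (κ' q.1 * φ q + (κ' q.1 * (q.2 - g q.1) - κ q.1 * g' q.1) * d2 φ q)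
        - d1 (fun q => κ q.1 * φ q) q := by
    intro q; rw [e1]; ring
  simp_rw [e2]
  rw [integral_sub i2.integrableOn i1.integrableOn, h1, h2, sub_eq_zero, ← integral_neg]
  congr 1
  ext s
  simp only [sub_self, mul_zero, zero_sub]
  ring

end Muskat

/-! ### The velocity of a sheet in the sense of distributions -/

namespace Muskat

/-- The regularized Biot–Savart kernel with a source at an arbitrary point is divergence free. -/
lemma integral_above_kernel {g g' : ℝ → ℝ} (hg : ∀ s, HasDerivAt g (g' s) s)
    (hg' : Continuous g') {φ : ℝ × ℝ → ℝ} (hφ : ContDiff ℝ 1 φ) (hc : HasCompactSupport φ)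
    {e : ℝ} (he : e ≠ 0) (p₁ p₂ : ℝ) :
    ∫ q in above g, (-(q.2 - p₂) / ((q.1 - p₁) ^ 2 + (q.2 - p₂) ^ 2 + e ^ 2) * d1 φ q +
      (q.1 - p₁) / ((q.1 - p₁) ^ 2 + (q.2 - p₂) ^ 2 + e ^ 2) * d2 φ q) =
    ∫ s, φ (s, g s) *
      (g' s * (-(g s - p₂) / ((s - p₁) ^ 2 + (g s - p₂) ^ 2 + e ^ 2)) -
        (s - p₁) / ((s - p₁) ^ 2 + (g s - p₂) ^ 2 + e ^ 2)) := by
  have hgc : Continuous g := continuous_iff_continuousAt.2 fun s => (hg s).continuousAt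
  have hφd : Differentiable ℝ φ := hφ.differentiable one_ne_zero
  set D : ℝ × ℝ → ℝ := fun q => (q.1 - p₁) ^ 2 + (q.2 - p₂) ^ 2 + e ^ 2 with hD
  have hD0 : ∀ q, D q ≠ 0 := fun q => by simp only [hD]; positivity
  have cD : ContDiff ℝ 1 D := by simp only [hD]; fun_prop
  have hG : ContDiff ℝ 1 fun q : ℝ × ℝ => -(q.2 - p₂) / D q * φ q :=
    (ContDiff.div (by fun_prop) cD hD0).mul hφ
  have e1 : ∀ q : ℝ × ℝ, d1 (fun q => -(q.2 - p₂) / D q * φ q) q =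
      2 * (q.1 - p₁) * (q.2 - p₂) / D q ^ 2 * φ q + -(q.2 - p₂) / D q * d1 φ q := by
    intro q
    have a1 := hasDerivAt_comp_curve (hG.differentiable one_ne_zero) (hasDerivAt_id q.1)
      (hasDerivAt_const q.1 q.2)
    have aD : HasDerivAt (fun t => D (t, q.2)) (2 * (q.1 - p₁)) q.1 := by
      have := ((((hasDerivAt_id q.1).sub_const p₁).pow 2).add_const
        ((q.2 - p₂) ^ 2)).add_const (e ^ 2)
      exact this.congr_deriv (by simp)
    have a2 := ((hasDerivAt_const q.1 (-(q.2 - p₂))).div aD (hD0 (q.1, q.2))).mul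
      (hasDerivAt_comp_curve hφd (hasDerivAt_id q.1) (hasDerivAt_const q.1 q.2))
    have h := a1.unique a2
    simp only [Pi.div_apply, id, one_mul, zero_mul, add_zero, Prod.mk.eta, zero_sub] at h
    rw [h]
    have := hD0 q
    field_simp
  have e2 : ∀ s y : ℝ, HasDerivAt (fun y => (s - p₁) / D (s, y) * φ (s, y))
      (-(2 * (s - p₁) * (y - p₂) / D (s, y) ^ 2 * φ (s, y)) +
        (s - p₁) / D (s, y) * d2 φ (s, y)) y := by
    intro s y
    have aD : HasDerivAt (fun t => D (s, t)) (2 * (y - p₂)) y := by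
      have := ((((hasDerivAt_id y).sub_const p₂).pow 2).const_add
        ((s - p₁) ^ 2)).add_const (e ^ 2)
      exact this.congr_deriv (by simp)
    have a2 := ((hasDerivAt_const y (s - p₁)).div aD (hD0 (s, y))).mul
      (hasDerivAt_comp_curve hφd (hasDerivAt_const y s) (hasDerivAt_id y))
    refine a2.congr_deriv ?_
    have := hD0 (s, y)
    simp only [Pi.div_apply, id, one_mul, zero_mul, zero_add, zero_sub]
    field_simp
  have c1 := continuous_d1 hφ
  have c2 := continuous_d2 hφ
  have cφ := hφ.continuous
  have cDc := cD.continuous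
  have cF : Continuous fun q : ℝ × ℝ => -(2 * (q.1 - p₁) * (q.2 - p₂) / D q ^ 2 * φ q) +
        (q.1 - p₁) / D q * d2 φ q :=
    ((Continuous.div (by fun_prop) (by fun_prop) fun q => pow_ne_zero 2 (hD0 q)).mul cφ).neg.add
      ((Continuous.div (by fun_prop) cDc hD0).mul c2)
  have sF : HasCompactSupport fun q : ℝ × ℝ =>
      -(2 * (q.1 - p₁) * (q.2 - p₂) / D q ^ 2 * φ q) + (q.1 - p₁) / D q * d2 φ q := by
    refine HasCompactSupport.add ?_ (HasCompactSupport.mul_left (hasCompactSupport_d2 hc))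
    simp_rw [← neg_mul]
    exact HasCompactSupport.mul_left hc
  have h1 := integral_above_d1 hg hg' hG hc.mul_left
  have h2 := integral_above_deriv_snd hgc (F := fun q => (q.1 - p₁) / D q * φ q)
    (F' := fun q => -(2 * (q.1 - p₁) * (q.2 - p₂) / D q ^ 2 * φ q) +
      (q.1 - p₁) / D q * d2 φ q) e2 cF hc.mul_left sF
  have i1 := (continuous_d1 hG).integrable_of_hasCompactSupport (μ := volume)
    (hasCompactSupport_d1 hc.mul_left)
  have i2 := cF.integrable_of_hasCompactSupport (μ := volume) sF
  have e3 : ∀ q : ℝ × ℝ, -(q.2 - p₂) / D q * d1 φ q + (q.1 - p₁) / D q * d2 φ q =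
      d1 (fun q => -(q.2 - p₂) / D q * φ q) q +
      (-(2 * (q.1 - p₁) * (q.2 - p₂) / D q ^ 2 * φ q) + (q.1 - p₁) / D q * d2 φ q) := by
    intro q; rw [e1]; ring
  have hcurve : ∀ k : ℝ → ℝ, Continuous k → Integrable fun s => k s * φ (s, g s) := by
    intro k hk
    obtain ⟨B, -, hB⟩ := eventually_snd_eq_zero hc
    refine Continuous.integrable_of_hasCompactSupport (by fun_prop)
      (HasCompactSupport.intro (isCompact_Icc (a := -B) (b := B)) fun s hs => ?_)
    rw [hB (s, g s) (Or.inl ?_), mul_zero]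
    by_contra h
    exact hs (abs_le.1 (not_lt.1 h))
  have cDg : Continuous fun s => D (s, g s) := cDc.comp (by fun_prop)
  have j1 := hcurve (fun s => g' s * (-(g s - p₂) / D (s, g s)))
    (hg'.mul (Continuous.div (by fun_prop) cDg fun s => hD0 _))
  have j2 := hcurve (fun s => (s - p₁) / D (s, g s))
    (Continuous.div (by fun_prop) cDg fun s => hD0 _)
  calc _ = ∫ q in above g, (d1 (fun q => -(q.2 - p₂) / D q * φ q) q +
      (-(2 * (q.1 - p₁) * (q.2 - p₂) / D q ^ 2 * φ q) + (q.1 - p₁) / D q * d2 φ q)) := by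
        congr 1; ext q; exact e3 q
    _ = (∫ s, g' s * (-(g s - p₂) / D (s, g s)) * φ (s, g s)) -
        ∫ s, (s - p₁) / D (s, g s) * φ (s, g s) := by
      rw [integral_add i1.integrableOn i2.integrableOn, h1, h2, ← sub_eq_add_neg]
      simp only [mul_assoc]
    _ = _ := by
      rw [← integral_sub j1 j2]
      congr 1
      ext s
      ring

/-- The truncated Biot–Savart integral over a fixed piece of the sheet, first component. -/
noncomputable def winFst (ζ ζ' : ℝ → ℝ) (e R : ℝ) (q : ℝ × ℝ) : ℝ :=
  ∫ σ in (-R)..R, bsFst ζ ζ' e q.1 q.2 (q.1 - σ)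

/-- The truncated Biot–Savart integral over a fixed piece of the sheet, second component. -/
noncomputable def winSnd (ζ ζ' : ℝ → ℝ) (e R : ℝ) (q : ℝ × ℝ) : ℝ :=
  ∫ σ in (-R)..R, bsSnd ζ ζ' e q.1 q.2 (q.1 - σ)

lemma bsFst_sub (ζ ζ' : ℝ → ℝ) (e x y σ : ℝ) : bsFst ζ ζ' e x y (x - σ) =
    ζ' σ * (-(y - ζ σ) / ((x - σ) ^ 2 + (y - ζ σ) ^ 2 + e ^ 2)) := by
  simp [bsFst]

lemma bsSnd_sub (ζ ζ' : ℝ → ℝ) (e x y σ : ℝ) : bsSnd ζ ζ' e x y (x - σ) =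
    ζ' σ * ((x - σ) / ((x - σ) ^ 2 + (y - ζ σ) ^ 2 + e ^ 2)) := by
  simp [bsSnd, hker]

lemma integrable_prod_window {X : Type*} [TopologicalSpace X] [MeasurableSpace X]
    [OpensMeasurableSpace X] [SecondCountableTopology X] [T2Space X] {μ : Measure X} [SFinite μ]
    [IsFiniteMeasureOnCompacts μ] {f : X × ℝ → ℝ} (hf : Continuous f) {K : Set X}
    (hK : IsCompact K) (h0 : ∀ x ∉ K, ∀ σ, f (x, σ) = 0) {s : Set X} (hs : MeasurableSet s)
    (R : ℝ) :
    Integrable f ((μ.restrict s).prod (volume.restrict (Ioc (-R) R))) := by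
  rw [Measure.prod_restrict]
  have h1 : IntegrableOn f (K ×ˢ Icc (-R) R) (μ.prod volume) :=
    hf.continuousOn.integrableOn_compact (hK.prod isCompact_Icc)
  have h2 : IntegrableOn f ((s ∩ K) ×ˢ Ioc (-R) R) (μ.prod volume) :=
    h1.mono_set (prod_mono inter_subset_right Ioc_subset_Icc_self)
  refine h2.of_forall_sdiff_eq_zero (hs.prod measurableSet_Ioc) fun q hq => ?_
  refine h0 q.1 (fun hqK => hq.2 ⟨⟨hq.1.1, hqK⟩, hq.1.2⟩) q.2

lemma continuous_bsFst_sub {ζ ζ' : ℝ → ℝ} (hζ : Continuous ζ) (hζ' : Continuous ζ') {e : ℝ}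
    (he : e ≠ 0) :
    Continuous fun q : (ℝ × ℝ) × ℝ => bsFst ζ ζ' e q.1.1 q.1.2 (q.1.1 - q.2) := by
  simp_rw [bsFst_sub]
  exact (hζ'.comp continuous_snd).mul
    (Continuous.div (by fun_prop) (by fun_prop) fun q => by positivity)

lemma continuous_bsSnd_sub {ζ ζ' : ℝ → ℝ} (hζ : Continuous ζ) (hζ' : Continuous ζ') {e : ℝ}
    (he : e ≠ 0) :
    Continuous fun q : (ℝ × ℝ) × ℝ => bsSnd ζ ζ' e q.1.1 q.1.2 (q.1.1 - q.2) := by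
  simp_rw [bsSnd_sub]
  exact (hζ'.comp continuous_snd).mul
    (Continuous.div (by fun_prop) (by fun_prop) fun q => by positivity)

lemma exists_box {F : ℝ × ℝ → ℝ} (hc : HasCompactSupport F) :
    ∃ B : ℝ, 0 < B ∧ ∀ q : ℝ × ℝ, q ∉ Icc (-B) B ×ˢ Icc (-B) B → F q = 0 := by
  obtain ⟨B, hB0, hB⟩ := eventually_snd_eq_zero hc
  refine ⟨B, hB0, fun q hq => hB q ?_⟩
  by_contra h
  push Not at h
  exact hq ⟨abs_le.1 h.1, abs_le.1 h.2⟩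

section Window

variable {ζ ζ' g g' : ℝ → ℝ} {φ : ℝ × ℝ → ℝ}

/-- The flux of the regularized field of a piece of the sheet, by superposition of kernels. -/
lemma integral_above_window (hζ : Continuous ζ) (hζ' : Continuous ζ')
    (hg : ∀ s, HasDerivAt g (g' s) s) (hg' : Continuous g')
    (hφ : ContDiff ℝ 1 φ) (hc : HasCompactSupport φ) {e : ℝ} (he : e ≠ 0) {R : ℝ} (hR : 0 ≤ R) :
    ∫ q in above g, (winFst ζ ζ' e R q * d1 φ q + winSnd ζ ζ' e R q * d2 φ q) =
      ∫ s, (winFst ζ ζ' e R (s, g s) * (φ (s, g s) * g' s) +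
        winSnd ζ ζ' e R (s, g s) * (-φ (s, g s))) := by
  have hgc : Continuous g := continuous_iff_continuousAt.2 fun s => (hg s).continuousAt
  have c1 := continuous_d1 hφ
  have c2 := continuous_d2 hφ
  have cφ := hφ.continuous
  have k1 := continuous_bsFst_sub hζ hζ' he
  have k2 := continuous_bsSnd_sub hζ hζ' he
  have hle : -R ≤ R := by linarith
  obtain ⟨B, -, hB⟩ := exists_box hc
  have cG : ∀ {f : (ℝ × ℝ) × ℝ → ℝ}, Continuous f → ∀ q, IntervalIntegrable (fun σ => f (q, σ))
      volume (-R) R := fun hf q => (hf.comp (Continuous.prodMk_right q)).intervalIntegrable _ _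
  have e1 : ∀ (q : ℝ × ℝ) (u v : ℝ), winFst ζ ζ' e R q * u + winSnd ζ ζ' e R q * v =
      ∫ σ in Ioc (-R) R, (bsFst ζ ζ' e q.1 q.2 (q.1 - σ) * u +
        bsSnd ζ ζ' e q.1 q.2 (q.1 - σ) * v) := by
    intro q u v
    rw [← intervalIntegral.integral_of_le hle, intervalIntegral.integral_add
      ((cG k1 q).mul_const _) ((cG k2 q).mul_const _), intervalIntegral.integral_mul_const,
      intervalIntegral.integral_mul_const]
    rfl
  simp_rw [e1]
  have n0 : ∀ q : ℝ × ℝ, q ∉ tsupport φ → d1 φ q = 0 ∧ d2 φ q = 0 := by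
    intro q hq
    have : fderiv ℝ φ q = 0 := by
      by_contra h
      exact hq (support_fderiv_subset ℝ (f := φ) h)
    simp [d1, d2, this]
  refine (integral_integral_swap ?_).trans (Eq.trans ?_ (integral_integral_swap ?_).symm)
  · exact integrable_prod_window (K := tsupport φ) (s := above g)
      (R := R) (f := fun q : (ℝ × ℝ) × ℝ => bsFst ζ ζ' e q.1.1 q.1.2 (q.1.1 - q.2) * d1 φ q.1 +
        bsSnd ζ ζ' e q.1.1 q.1.2 (q.1.1 - q.2) * d2 φ q.1)
      (by fun_prop) hc (fun q hq σ => by simp [n0 q hq]) (measurableSet_above hgc)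
  · refine integral_congr_ae (Eventually.of_forall fun σ => ?_)
    have := integral_above_kernel hg hg' hφ hc he σ (ζ σ)
    simp only [bsFst_sub, bsSnd_sub, mul_assoc, ← mul_add]
    rw [integral_const_mul, this, ← integral_const_mul]
    congr 1
    ext s
    ring
  · have := integrable_prod_window (μ := (volume : Measure ℝ)) (K := Icc (-B) B) (s := univ)
      (R := R) (f := fun q : ℝ × ℝ => bsFst ζ ζ' e q.1 (g q.1) (q.1 - q.2) *
        (φ (q.1, g q.1) * g' q.1) + bsSnd ζ ζ' e q.1 (g q.1) (q.1 - q.2) * (-φ (q.1, g q.1)))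
      (by
        have m : Continuous fun q : ℝ × ℝ => (((q.1, g q.1), q.2) : (ℝ × ℝ) × ℝ) := by fun_prop
        have m1 := k1.comp m
        have m2 := k2.comp m
        simp only [Function.comp_def] at m1 m2
        fun_prop) isCompact_Icc (fun s hs σ => by
        simp only
        rw [hB (s, g s) (fun h => hs h.1)]
        simp) MeasurableSet.univ
    rw [Measure.restrict_univ] at this
    exact this

end Window

/-- Dominated convergence for a bounded planar field tested against integrable functions. -/
lemma tendsto_integral_pair {X ι : Type*} [MeasurableSpace X] {μ : Measure X} {l : Filter ι}
    [l.IsCountablyGenerated] {W₁ W₂ : ι → X → ℝ} {V₁ V₂ ψ₁ ψ₂ : X → ℝ} {M : ℝ}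
    (h₁ : Integrable ψ₁ μ) (h₂ : Integrable ψ₂ μ)
    (m₁ : ∀ᶠ n in l, AEStronglyMeasurable (W₁ n) μ) (m₂ : ∀ᶠ n in l, AEStronglyMeasurable (W₂ n) μ)
    (hb : ∀ᶠ n in l, ∀ᵐ x ∂μ, ψ₁ x ≠ 0 ∨ ψ₂ x ≠ 0 → |W₁ n x| ≤ M ∧ |W₂ n x| ≤ M)
    (hl : ∀ᵐ x ∂μ, Tendsto (fun n => W₁ n x) l (𝓝 (V₁ x)) ∧
      Tendsto (fun n => W₂ n x) l (𝓝 (V₂ x))) :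
    Tendsto (fun n => ∫ x, (W₁ n x * ψ₁ x + W₂ n x * ψ₂ x) ∂μ) l
      (𝓝 (∫ x, (V₁ x * ψ₁ x + V₂ x * ψ₂ x) ∂μ)) := by
  refine tendsto_integral_filter_of_dominated_convergence
    (fun x => M * (|ψ₁ x| + |ψ₂ x|)) ?_ ?_ ?_ ?_
  · filter_upwards [m₁, m₂] with n a b using (a.mul h₁.1).add (b.mul h₂.1)
  · filter_upwards [hb] with n hn
    filter_upwards [hn] with x hx
    by_cases h : ψ₁ x ≠ 0 ∨ ψ₂ x ≠ 0
    · obtain ⟨a, b⟩ := hx h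
      rw [Real.norm_eq_abs, mul_add]
      refine (abs_add_le _ _).trans ?_
      rw [abs_mul, abs_mul]
      gcongr
    · push Not at h
      simp [h.1, h.2]
  · exact (h₁.abs.add h₂.abs).const_mul M
  · filter_upwards [hl] with x hx using (hx.1.mul_const _).add (hx.2.mul_const _)

lemma volume_graph_eq_zero {ζ : ℝ → ℝ} (hζ : Continuous ζ) :
    volume {q : ℝ × ℝ | q.2 = ζ q.1} = 0 := by
  have hm : MeasurableSet {q : ℝ × ℝ | q.2 = ζ q.1} :=
    (isClosed_eq continuous_snd (hζ.comp continuous_fst)).measurableSet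
  rw [Measure.volume_eq_prod, Measure.measure_prod_null hm]
  refine Eventually.of_forall fun s => ?_
  have : Prod.mk s ⁻¹' {q : ℝ × ℝ | q.2 = ζ q.1} = {ζ s} := by ext y; simp
  simp [this]

lemma ae_off_graph {ζ : ℝ → ℝ} (hζ : Continuous ζ) : ∀ᵐ q : ℝ × ℝ, q.2 ≠ ζ q.1 := by
  rw [ae_iff]
  simpa using volume_graph_eq_zero hζ

end Muskat

namespace Muskat

/-- `u · (-k, 1)` at the point `(x, y)`, where `u` is the velocity of the sheet; at points of the
sheet itself the value is meaningful if `k = ζ'(x)`, as then the tangential part drops out. -/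
noncomputable def fluxAt (ζ ζ' : ℝ → ℝ) (e k x y : ℝ) : ℝ :=
  (2 * Real.pi)⁻¹ * (norInt ζ ζ' e x y + (ζ' x - k) * tanInt ζ e x y)

lemma fluxAt_eq (ζ ζ' : ℝ → ℝ) (e k x y : ℝ) :
    fluxAt ζ ζ' e k x y = -k * velFst ζ e x y + velSnd ζ ζ' e x y := by
  unfold fluxAt velFst velSnd; ring

namespace IsSheet

variable {β C a : ℝ} {ζ ζ' : ℝ → ℝ}

lemma continuous_velFst (h : IsSheet β C a ζ ζ') (ha : 0 < a) {e : ℝ} (he : e ≠ 0) :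
    Continuous fun q : ℝ × ℝ => velFst ζ e q.1 q.2 := by
  refine continuous_iff_continuousAt.2 fun q => ?_
  exact continuousAt_const.mul (continuousAt_tanInt (P := ℝ × ℝ) (ζ := fun _ => ζ)
    (ζ' := fun _ => ζ') ha (fun _ => h) (h.continuous.comp continuous_snd) continuousAt_const
    continuousAt_fst continuousAt_snd (by positivity))

lemma continuous_velSnd (h : IsSheet β C a ζ ζ') (ha : 0 < a) (ha1 : a < 1) {e : ℝ}
    (he : e ≠ 0) : Continuous fun q : ℝ × ℝ => velSnd ζ ζ' e q.1 q.2 := by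
  refine continuous_iff_continuousAt.2 fun q => ?_
  have h1 := continuousAt_tanInt (P := ℝ × ℝ) (ζ := fun _ => ζ) (p₀ := q)
    (ζ' := fun _ => ζ') ha (fun _ => h) (h.continuous.comp continuous_snd)
    (continuousAt_const (y := e)) continuousAt_fst continuousAt_snd (by positivity)
  have h2 := continuousAt_norInt (P := ℝ × ℝ) (ζ := fun _ => ζ) (p₀ := q)
    (ζ' := fun _ => ζ') ha ha1 (fun _ => h) (h.continuous.comp continuous_snd)
    (h.cont.comp continuous_snd) (continuousAt_const (y := e)) continuousAt_fst continuousAt_snd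
  have h3 : ContinuousAt (fun q : ℝ × ℝ => ζ' q.1) q := (h.cont.comp continuous_fst).continuousAt
  exact continuousAt_const.mul (h2.add (h3.mul h1))

lemma tendsto_tanInt (h : IsSheet β C a ζ ζ') (ha : 0 < a) {x y : ℝ} (hy : y ≠ ζ x) :
    Tendsto (fun e => tanInt ζ e x y) (𝓝 0) (𝓝 (tanInt ζ 0 x y)) := by
  have h0 : y - ζ x ≠ 0 := sub_ne_zero.2 hy
  exact continuousAt_tanInt (P := ℝ) (ζ := fun _ => ζ) (e := id)
    (ζ' := fun _ => ζ') ha (fun _ => h) (h.continuous.comp continuous_snd)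
    continuousAt_id continuousAt_const continuousAt_const (by simp only [id]; positivity)

lemma tendsto_norInt (h : IsSheet β C a ζ ζ') (ha : 0 < a) (ha1 : a < 1) (x y : ℝ) :
    Tendsto (fun e => norInt ζ ζ' e x y) (𝓝 0) (𝓝 (norInt ζ ζ' 0 x y)) :=
  continuousAt_norInt (P := ℝ) (ζ := fun _ => ζ) (e := id)
    (ζ' := fun _ => ζ') ha ha1 (fun _ => h) (h.continuous.comp continuous_snd)
    (h.cont.comp continuous_snd) continuousAt_id continuousAt_const continuousAt_const

lemma height_le (h : IsSheet β C a ζ ζ') {x y B : ℝ} (hx : x ∈ Icc (-B) B) (hy : y ∈ Icc (-B) B) :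
    |x| ≤ B ∧ |y - ζ x| ≤ B + (|β| * B + C) := by
  have hx' : |x| ≤ B := abs_le.2 hx
  have hy' : |y| ≤ B := abs_le.2 hy
  refine ⟨hx', ?_⟩
  have h1 := h.bdd x
  have h2 : |β * x| ≤ |β| * B := by rw [abs_mul]; gcongr
  rw [abs_le] at *
  constructor <;> linarith

lemma integrable_curve {g k : ℝ → ℝ} (hg : Continuous g) (hk : Continuous k) {φ : ℝ × ℝ → ℝ}
    (hφ : Continuous φ) (hc : HasCompactSupport φ) : Integrable fun s => φ (s, g s) * k s := by
  obtain ⟨B, -, hB⟩ := exists_box hc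
  refine Continuous.integrable_of_hasCompactSupport (by fun_prop)
    (HasCompactSupport.intro (isCompact_Icc (a := -B) (b := B)) fun s hs => ?_)
  rw [hB (s, g s) fun h => hs h.1, zero_mul]

/-- The limit `R → ∞` of `integral_above_window`, for a fixed regularization. -/
lemma integral_above_reg (h : IsSheet β C a ζ ζ') (ha : 0 < a) {g g' : ℝ → ℝ}
    (hg : ∀ s, HasDerivAt g (g' s) s) (hg' : Continuous g') {φ : ℝ × ℝ → ℝ} (hφ : ContDiff ℝ 1 φ)
    (hc : HasCompactSupport φ) {e : ℝ} (he : e ≠ 0) :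
    ∫ q in above g, (velFst ζ e q.1 q.2 * d1 φ q + velSnd ζ ζ' e q.1 q.2 * d2 φ q) =
      ∫ s, (velFst ζ e s (g s) * (φ (s, g s) * g' s) +
        velSnd ζ ζ' e s (g s) * (-φ (s, g s))) := by
  have hgc : Continuous g := continuous_iff_continuousAt.2 fun s => (hg s).continuousAt
  have k1 := continuous_bsFst_sub h.continuous h.cont he
  have k2 := continuous_bsSnd_sub h.continuous h.cont he
  have w1 : ∀ R, Continuous (winFst ζ ζ' e R) := fun R =>
    intervalIntegral.continuous_parametric_intervalIntegral_of_continuous' k1 _ _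
  have w2 : ∀ R, Continuous (winSnd ζ ζ' e R) := fun R =>
    intervalIntegral.continuous_parametric_intervalIntegral_of_continuous' k2 _ _
  obtain ⟨B, hB0, hB⟩ := exists_box hc
  obtain ⟨B₁, -, hB₁⟩ := exists_box (hasCompactSupport_d1 hc)
  obtain ⟨B₂, -, hB₂⟩ := exists_box (hasCompactSupport_d2 hc)
  set r := max B (max B₁ B₂) with hr
  have box : ∀ {b : ℝ}, b ≤ r → Icc (-b) b ×ˢ Icc (-b) b ⊆ Icc (-r) r ×ˢ Icc (-r) r :=
    fun hb => prod_mono (Icc_subset_Icc (by linarith) hb) (Icc_subset_Icc (by linarith) hb)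
  have hpos : ∀ x y : ℝ, 0 < (y - ζ x) ^ 2 + e ^ 2 := fun x y => by positivity
  obtain ⟨M, hM⟩ : ∃ M : ℝ, ∀ q ∈ Icc (-r) r ×ˢ Icc (-r) r, ∀ R, 2 * r + 1 ≤ R →
      |winFst ζ ζ' e R q| ≤ M ∧ |winSnd ζ ζ' e R q| ≤ M := by
    refine ⟨velBound β C a + (|β| + C) * (2 * (r + (|β| * r + C)) + 4 * C) + 2 * (|β| + C),
      fun q hq R hR => ?_⟩
    obtain ⟨b1, b2⟩ := h.height_le hq.1 hq.2
    exact h.abs_window_le ha (hpos _ _) b1 b2 hR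
  have lim : ∀ q : ℝ × ℝ,
      Tendsto (fun R => winFst ζ ζ' e R q) atTop (𝓝 (2 * Real.pi * velFst ζ e q.1 q.2)) ∧
      Tendsto (fun R => winSnd ζ ζ' e R q) atTop (𝓝 (2 * Real.pi * velSnd ζ ζ' e q.1 q.2)) :=
    fun q => ⟨h.tendsto_window_bsFst ha (hpos _ _), h.tendsto_window_bsSnd ha (hpos _ _)⟩
  have i1 := (continuous_d1 hφ).integrable_of_hasCompactSupport (μ := volume)
    (hasCompactSupport_d1 hc)
  have i2 := (continuous_d2 hφ).integrable_of_hasCompactSupport (μ := volume)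
    (hasCompactSupport_d2 hc)
  have L := tendsto_integral_pair (μ := volume.restrict (above g)) (l := atTop) (M := M)
    (W₁ := winFst ζ ζ' e) (W₂ := winSnd ζ ζ' e) i1.integrableOn i2.integrableOn
    (Eventually.of_forall fun R => (w1 R).aestronglyMeasurable)
    (Eventually.of_forall fun R => (w2 R).aestronglyMeasurable)
    (by
      filter_upwards [eventually_ge_atTop (2 * r + 1)] with R hR
      refine Eventually.of_forall fun q hq => hM q ?_ R hR
      by_contra hn
      rcases hq with hq | hq
      · exact hq (hB₁ q fun hm => hn (box (by simp [hr]) hm))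
      · exact hq (hB₂ q fun hm => hn (box (by simp [hr]) hm)))
    (Eventually.of_forall lim)
  have j1 := integrable_curve hgc hg' hφ.continuous hc
  have j2 : Integrable fun s => -φ (s, g s) := by
    simpa using integrable_curve hgc (continuous_const (y := (-1 : ℝ))) hφ.continuous hc
  have L' := tendsto_integral_pair (μ := volume) (l := atTop) (M := M)
    (W₁ := fun R s => winFst ζ ζ' e R (s, g s)) (W₂ := fun R s => winSnd ζ ζ' e R (s, g s)) j1 j2
    (Eventually.of_forall fun R => ((w1 R).comp (by fun_prop)).aestronglyMeasurable)
    (Eventually.of_forall fun R => ((w2 R).comp (by fun_prop)).aestronglyMeasurable)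
    (by
      filter_upwards [eventually_ge_atTop (2 * r + 1)] with R hR
      refine Eventually.of_forall fun s hs => hM (s, g s) ?_ R hR
      by_contra hn
      have : φ (s, g s) = 0 := hB _ fun hm => hn (box (by simp [hr]) hm)
      simp [this] at hs)
    (Eventually.of_forall fun s => lim (s, g s))
  have e0 : ∀ᶠ R in atTop, 
      (∫ q in above g, (winFst ζ ζ' e R q * d1 φ q + winSnd ζ ζ' e R q * d2 φ q))
      = ∫ s, (winFst ζ ζ' e R (s, g s) * (φ (s, g s) * g' s) +
        winSnd ζ ζ' e R (s, g s) * (-φ (s, g s))) := by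
    filter_upwards [eventually_ge_atTop 0] with R hR
    exact integral_above_window h.continuous h.cont hg hg' hφ hc he hR
  have := tendsto_nhds_unique (L.congr' e0) L'
  have hp : (2 * Real.pi) ≠ 0 := by positivity
  simp only [mul_assoc (2 * Real.pi), ← mul_add (2 * Real.pi)] at this
  rw [integral_const_mul, integral_const_mul] at this
  exact mul_left_cancel₀ hp this

/-- The velocity of a sheet is divergence free above any graph which is not transversal to the
sheet; its flux through that graph is `fluxAt`. -/
lemma integral_above_vel (h : IsSheet β C a ζ ζ') (ha : 0 < a) (ha1 : a < 1) {g g' : ℝ → ℝ}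
    (hg : ∀ s, HasDerivAt g (g' s) s) (hg' : Continuous g') (htr : ∀ s, g s = ζ s → g' s = ζ' s)
    {φ : ℝ × ℝ → ℝ} (hφ : ContDiff ℝ 1 φ) (hc : HasCompactSupport φ) :
    ∫ q in above g, (velFst ζ 0 q.1 q.2 * d1 φ q + velSnd ζ ζ' 0 q.1 q.2 * d2 φ q) =
      -∫ s, φ (s, g s) * fluxAt ζ ζ' 0 (g' s) s (g s) := by
  have hgc : Continuous g := continuous_iff_continuousAt.2 fun s => (hg s).continuousAt
  have i1 := (continuous_d1 hφ).integrable_of_hasCompactSupport (μ := volume)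
    (hasCompactSupport_d1 hc)
  have i2 := (continuous_d2 hφ).integrable_of_hasCompactSupport (μ := volume)
    (hasCompactSupport_d2 hc)
  have hne : ∀ᶠ e : ℝ in 𝓝[≠] 0, e ≠ 0 := eventually_mem_nhdsWithin
  have L := tendsto_integral_pair (μ := volume.restrict (above g)) (l := 𝓝[≠] (0 : ℝ))
    (M := velBound β C a)
    (W₁ := fun e q => velFst ζ e q.1 q.2) (W₂ := fun e q => velSnd ζ ζ' e q.1 q.2)
    (V₁ := fun q => velFst ζ 0 q.1 q.2) (V₂ := fun q => velSnd ζ ζ' 0 q.1 q.2)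
    i1.integrableOn i2.integrableOn
    (by filter_upwards [hne] with e he using (h.continuous_velFst ha he).aestronglyMeasurable)
    (by filter_upwards [hne] with e he using (h.continuous_velSnd ha ha1 he).aestronglyMeasurable)
    (Eventually.of_forall fun e => Eventually.of_forall fun q _ =>
      ⟨h.abs_velFst_le ha _ _ _, h.abs_velSnd_le ha _ _ _⟩)
    (by
      filter_upwards [ae_restrict_of_ae (ae_off_graph h.continuous)] with q hq
      have t1 := (h.tendsto_tanInt ha hq).mono_left (nhdsWithin_le_nhds (s := {0}ᶜ))
      have t2 := (h.tendsto_norInt ha ha1 q.1 q.2).mono_left (nhdsWithin_le_nhds (s := {0}ᶜ))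
      exact ⟨t1.const_mul _, (t2.add (t1.const_mul _)).const_mul _⟩)
  have j : Integrable fun s => -φ (s, g s) := by
    simpa using integrable_curve hgc (continuous_const (y := (-1 : ℝ))) hφ.continuous hc
  have hflux : ∀ e s, |fluxAt ζ ζ' e (g' s) s (g s)| ≤
      norBound β C a + (|β| + C + |g' s|) * tanBound β C a := by
    intro e s
    refine (abs_two_pi_inv_mul_le _).trans ((abs_add_le _ _).trans ?_)
    rw [abs_mul]
    refine add_le_add (h.abs_norInt_le ha _ _ _) (mul_le_mul ((abs_sub _ _).trans ?_)
      (h.abs_tanInt_le ha _ _ _) (abs_nonneg _) ?_)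
    · linarith [h.abs_deriv_le ha s]
    · have := h.nonneg
      positivity
  have L' : Tendsto (fun e => ∫ s, -φ (s, g s) * fluxAt ζ ζ' e (g' s) s (g s)) (𝓝[≠] (0 : ℝ))
      (𝓝 (∫ s, -φ (s, g s) * fluxAt ζ ζ' 0 (g' s) s (g s))) := by
    refine tendsto_integral_filter_of_dominated_convergence
      (fun s => |φ (s, g s) * (norBound β C a + (|β| + C + |g' s|) * tanBound β C a)|) ?_ ?_ ?_ ?_
    · filter_upwards [hne] with e he
      refine Continuous.aestronglyMeasurable ?_
      simp_rw [fluxAt_eq]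
      have c1 : Continuous fun s => velFst ζ e s (g s) :=
        (h.continuous_velFst ha he).comp (Continuous.prodMk continuous_id hgc)
      have c2 : Continuous fun s => velSnd ζ ζ' e s (g s) :=
        (h.continuous_velSnd ha ha1 he).comp (Continuous.prodMk continuous_id hgc)
      have := hφ.continuous
      fun_prop
    · refine Eventually.of_forall fun e => Eventually.of_forall fun s => ?_
      rw [Real.norm_eq_abs, abs_mul, abs_mul, abs_neg]
      exact mul_le_mul_of_nonneg_left ((hflux e s).trans (le_abs_self _)) (abs_nonneg _)
    · exact (integrable_curve hgc (k := fun s => norBound β C a + (|β| + C + |g' s|) *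
        tanBound β C a) (by fun_prop) hφ.continuous hc).abs
    · refine Eventually.of_forall fun s => Tendsto.const_mul _ ?_
      have t2 := (h.tendsto_norInt ha ha1 s (g s)).mono_left (nhdsWithin_le_nhds (s := {0}ᶜ))
      refine Tendsto.const_mul _ (t2.add ?_)
      -- on the sheet the slopes agree, so that the discontinuous tangential part has the factor `0`
      by_cases hs : g s = ζ s
      · simp [htr s hs]
      · exact ((h.tendsto_tanInt ha hs).mono_left (nhdsWithin_le_nhds (s := {0}ᶜ))).const_mul _
  have e0 : ∀ᶠ e : ℝ in 𝓝[≠] 0,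
      (∫ q in above g, (velFst ζ e q.1 q.2 * d1 φ q + velSnd ζ ζ' e q.1 q.2 * d2 φ q)) =
      ∫ s, -φ (s, g s) * fluxAt ζ ζ' e (g' s) s (g s) := by
    filter_upwards [hne] with e he
    rw [h.integral_above_reg ha hg hg' hφ hc he]
    congr 1
    ext s
    rw [fluxAt_eq]
    ring
  have := tendsto_nhds_unique (L.congr' e0) L'
  rw [this, ← integral_neg]
  simp only [neg_mul]

/-- The velocity of a sheet is divergence free in the plane. -/
lemma integral_vel_div (h : IsSheet β C a ζ ζ') (ha : 0 < a) (ha1 : a < 1)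
    {φ : ℝ × ℝ → ℝ} (hφ : ContDiff ℝ 1 φ) (hc : HasCompactSupport φ) :
    ∫ q : ℝ × ℝ, (velFst ζ 0 q.1 q.2 * d1 φ q + velSnd ζ ζ' 0 q.1 q.2 * d2 φ q) = 0 := by
  obtain ⟨B, hB0, hB⟩ := exists_box hc
  obtain ⟨B₁, hB₁0, hB₁⟩ := exists_box (hasCompactSupport_d1 hc)
  obtain ⟨B₂, hB₂0, hB₂⟩ := exists_box (hasCompactSupport_d2 hc)
  set r := max B (max B₁ B₂) with hr
  have hrB : B ≤ r := by simp [hr]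
  have hrB₁ : B₁ ≤ r := by simp [hr]
  have hrB₂ : B₂ ≤ r := by simp [hr]
  -- the sheet, translated below the support of `φ`
  set K := |β| * r + C + r + 1 with hK
  have hlow : ∀ s, |s| ≤ r → ζ s - K < -r := by
    intro s hs
    have h1 := abs_le.1 (h.bdd s)
    have h2 : |β * s| ≤ |β| * r := by rw [abs_mul]; gcongr
    have h3 := abs_le.1 h2
    linarith
  have hK0 : 0 < K := by
    have := h.nonneg
    positivity
  have key := h.integral_above_vel ha ha1 (g := fun s => ζ s - K) (g' := ζ')
    (fun s => (h.hasDerivAt s).sub_const K) h.cont (fun s _ => rfl) hφ hc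
  have hz : ∀ {F : ℝ × ℝ → ℝ} {b : ℝ}, b ≤ r → (∀ q ∉ Icc (-b) b ×ˢ Icc (-b) b, F q = 0) →
      ∀ s y, y ≤ ζ s - K → F (s, y) = 0 := by
    intro F b hbr hF s y hy
    refine hF _ fun hm => ?_
    have h1 : |s| ≤ r := (abs_le.2 hm.1).trans hbr
    have h2 := hm.2.1
    have h3 := hlow s h1
    simp only at h2
    linarith
  have e1 : ∫ s, φ (s, ζ s - K) * fluxAt ζ ζ' 0 (ζ' s) s (ζ s - K) = 0 := by
    refine integral_eq_zero_of_ae (Eventually.of_forall fun s => ?_)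
    simp [hz hrB hB s _ le_rfl]
  rw [e1, neg_zero] at key
  refine Eq.trans (setIntegral_eq_integral_of_forall_compl_eq_zero fun q hq => ?_).symm key
  have hq' : q.2 ≤ ζ q.1 - K := not_lt.1 hq
  have z1 := hz hrB₁ hB₁ q.1 q.2 hq'
  have z2 := hz hrB₂ hB₂ q.1 q.2 hq'
  simp only [Prod.mk.eta] at z1 z2
  rw [z1, z2]
  simp

end IsSheet

end Muskat

/-! ### The vorticity of a sheet -/

namespace Muskat

/-- The gradient of the fundamental solution of the Laplacian, tested against a gradient. -/
lemma integral_radial {φ : ℝ × ℝ → ℝ} (hφ : ContDiff ℝ 1 φ) (hc : HasCompactSupport φ)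
    (p : ℝ × ℝ) :
    ∫ q : ℝ × ℝ, ((q.1 - p.1) * d1 φ q + (q.2 - p.2) * d2 φ q) /
      ((q.1 - p.1) ^ 2 + (q.2 - p.2) ^ 2) = -(2 * Real.pi * φ p) := by
  have hφd : Differentiable ℝ φ := hφ.differentiable one_ne_zero
  have c1 := continuous_d1 hφ
  have c2 := continuous_d2 hφ
  set f : ℝ × ℝ → ℝ := fun v => (v.1 * d1 φ (v + p) + v.2 * d2 φ (v + p)) / (v.1 ^ 2 + v.2 ^ 2)
    with hf
  have e1 : ∀ q : ℝ × ℝ, ((q.1 - p.1) * d1 φ q + (q.2 - p.2) * d2 φ q) /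
      ((q.1 - p.1) ^ 2 + (q.2 - p.2) ^ 2) = f (q - p) := by
    intro q; simp [hf]
  simp_rw [e1]
  rw [integral_sub_right_eq_self f p, ← integral_comp_polarCoord_symm, polarCoord_target]
  -- the radial derivative of `φ`
  set k : ℝ × ℝ → ℝ := fun v =>
    Real.cos v.2 * d1 φ (v.1 * Real.cos v.2 + p.1, v.1 * Real.sin v.2 + p.2) +
    Real.sin v.2 * d2 φ (v.1 * Real.cos v.2 + p.1, v.1 * Real.sin v.2 + p.2) with hk
  have e2 : ∀ v ∈ Ioi (0 : ℝ) ×ˢ Ioo (-Real.pi) Real.pi, v.1 • f (polarCoord.symm v) = k v := by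
    intro v hv
    have hv0 : 0 < v.1 := hv.1
    have hcs := Real.cos_sq_add_sin_sq v.2
    have hq : (v.1 * Real.cos v.2) ^ 2 + (v.1 * Real.sin v.2) ^ 2 = v.1 ^ 2 := by
      rw [mul_pow, mul_pow, ← mul_add, hcs, mul_one]
    have hp : ((v.1 * Real.cos v.2, v.1 * Real.sin v.2) : ℝ × ℝ) + p =
      (v.1 * Real.cos v.2 + p.1, v.1 * Real.sin v.2 + p.2) := rfl
    simp only [hf, hk, polarCoord_symm_apply, smul_eq_mul, hq, hp]
    field_simp
  rw [setIntegral_congr_fun (measurableSet_Ioi.prod measurableSet_Ioo) e2]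
  have ck : Continuous k := by
    simp only [hk]; fun_prop
  obtain ⟨B, hB0, hB⟩ := exists_box hc
  have far : ∀ {v : ℝ × ℝ}, 2 * B + |p.1| + |p.2| < v.1 →
      (v.1 * Real.cos v.2 + p.1, v.1 * Real.sin v.2 + p.2) ∉ Icc (-B) B ×ˢ Icc (-B) B := by
    intro v hv hm
    obtain ⟨h1, h2⟩ := hm
    have h1' : |v.1 * Real.cos v.2 + p.1| ≤ B := abs_le.2 h1
    have h2' : |v.1 * Real.sin v.2 + p.2| ≤ B := abs_le.2 h2
    have hp1 := abs_nonneg p.1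
    have hp2 := abs_nonneg p.2
    have hv0 : 0 < v.1 := by linarith
    have a1 : |v.1 * Real.cos v.2| ≤ B + |p.1| := by
      have := abs_sub (v.1 * Real.cos v.2 + p.1) p.1
      rw [add_sub_cancel_right] at this
      linarith
    have a2 : |v.1 * Real.sin v.2| ≤ B + |p.2| := by
      have := abs_sub (v.1 * Real.sin v.2 + p.2) p.2
      rw [add_sub_cancel_right] at this
      linarith
    rw [abs_mul, abs_of_pos hv0] at a1 a2
    have h3 : 1 ≤ |Real.cos v.2| + |Real.sin v.2| := by
      have := Real.cos_sq_add_sin_sq v.2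
      rw [← sq_abs (Real.cos v.2), ← sq_abs (Real.sin v.2)] at this
      nlinarith [Real.abs_cos_le_one v.2, Real.abs_sin_le_one v.2, abs_nonneg (Real.cos v.2),
        abs_nonneg (Real.sin v.2)]
    nlinarith
  have hd0 : ∀ {q : ℝ × ℝ}, q ∉ Icc (-B) B ×ˢ Icc (-B) B → d1 φ q = 0 ∧ d2 φ q = 0 := by
    intro q hq
    have : fderiv ℝ φ q = 0 := by
      by_contra h
      have hm : q ∈ tsupport φ := support_fderiv_subset ℝ (f := φ) h
      refine hq (closure_minimal (fun x hx => ?_) (isClosed_Icc.prod isClosed_Icc) hm)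
      by_contra hx'
      exact hx (hB x hx')
    simp [d1, d2, this]
  -- beyond the radius in `far`, the ray has left the support of `φ`
  have ik : IntegrableOn k (Ioi (0 : ℝ) ×ˢ Ioo (-Real.pi) Real.pi) := by
    have h1 : IntegrableOn k (Ioc 0 (2 * B + |p.1| + |p.2|) ×ˢ Ioo (-Real.pi) Real.pi) :=
      (ck.continuousOn.integrableOn_compact (isCompact_Icc.prod isCompact_Icc)).mono_set
        (prod_mono Ioc_subset_Icc_self Ioo_subset_Icc_self)
    refine h1.of_forall_sdiff_eq_zero (measurableSet_Ioi.prod measurableSet_Ioo) fun v hv => ?_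
    have hv1 : 2 * B + |p.1| + |p.2| < v.1 := by
      by_contra h
      exact hv.2 ⟨⟨hv.1.1, not_lt.1 h⟩, hv.1.2⟩
    obtain ⟨z1, z2⟩ := hd0 (far hv1)
    simp only [hk, z1, z2]
    simp
  have ik' : IntegrableOn k (Ioi (0 : ℝ) ×ˢ Ioo (-Real.pi) Real.pi) (volume.prod volume) := ik
  have ik'' : IntegrableOn (fun z : ℝ × ℝ => k z.swap) (Ioo (-Real.pi) Real.pi ×ˢ Ioi (0 : ℝ))
    (volume.prod volume) := ik'.swap
  rw [Measure.volume_eq_prod, ← setIntegral_prod_swap, setIntegral_prod _ ik'']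
  have e3 : ∀ θ : ℝ, ∫ r in Ioi (0 : ℝ), k (Prod.swap (θ, r)) = -φ p := by
    intro θ
    have hd : ∀ r : ℝ, HasDerivAt (fun r => φ (r * Real.cos θ + p.1, r * Real.sin θ + p.2))
        (k (r, θ)) r := by
      intro r
      have := hasDerivAt_comp_curve hφd
        (((hasDerivAt_id r).mul_const (Real.cos θ)).add_const p.1)
        (((hasDerivAt_id r).mul_const (Real.sin θ)).add_const p.2)
      exact this.congr_deriv (by simp [hk])
    have ht : Tendsto (fun r => φ (r * Real.cos θ + p.1, r * Real.sin θ + p.2)) atTop (𝓝 0) := by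
      refine tendsto_const_nhds.congr' ?_
      filter_upwards [eventually_gt_atTop (2 * B + |p.1| + |p.2|)] with r hr
      exact (hB _ (far (v := (r, θ)) hr)).symm
    have hi : IntegrableOn (fun r => k (r, θ)) (Ioi 0) := by
      have c : Continuous fun r => k (r, θ) := ck.comp (Continuous.prodMk_left θ)
      have h1 : IntegrableOn (fun r => k (r, θ)) (Ioc 0 (2 * B + |p.1| + |p.2|)) :=
        (c.continuousOn.integrableOn_compact isCompact_Icc).mono_set Ioc_subset_Icc_self
      refine h1.of_forall_sdiff_eq_zero measurableSet_Ioi fun r hr => ?_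
      have hr1 : 2 * B + |p.1| + |p.2| < r := by
        by_contra h
        exact hr.2 ⟨hr.1, not_lt.1 h⟩
      obtain ⟨z1, z2⟩ := hd0 (far (v := (r, θ)) hr1)
      simp only at z1 z2
      simp only [hk, z1, z2]
      simp
    simp only [Prod.swap_prod_mk]
    rw [integral_Ioi_of_hasDerivAt_of_tendsto (hd 0).continuousAt.continuousWithinAt
      (fun r _ => hd r) hi ht]
    simp
  simp_rw [e3]
  rw [setIntegral_const]
  simp [Real.pi_pos.le]
  left
  ring

/-- The kernel `1 / ‖v‖`, truncated to `‖v‖ ≤ ρ`, is integrable in the plane. -/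
lemma integrable_inv_norm (ρ : ℝ) :
    Integrable fun v : ℝ × ℝ => (Iic ρ).indicator (fun r : ℝ => r⁻¹) ‖v‖ := by
  rw [integrable_fun_norm_addHaar (volume : Measure (ℝ × ℝ))
    (f := (Iic ρ).indicator (fun r : ℝ => r⁻¹))]
  have hdim : Module.finrank ℝ (ℝ × ℝ) - 1 = 1 := by simp
  rw [hdim]
  have h1 : IntegrableOn (fun _ : ℝ => (1 : ℝ)) (Ioc 0 ρ) := by simp
  have h2 : IntegrableOn (fun y : ℝ => y ^ 1 • (Iic ρ).indicator (fun r : ℝ => r⁻¹) y)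
      (Ioc 0 ρ) := by
    refine h1.congr_fun (fun y hy => ?_) measurableSet_Ioc
    have : y ≠ 0 := hy.1.ne'
    have h3 : y ∈ Iic ρ := hy.2
    simp [h3, this]
  refine h2.of_forall_sdiff_eq_zero measurableSet_Ioi fun y hy => ?_
  have : y ∉ Iic ρ := fun h => hy.2 ⟨hy.1, h⟩
  simp [this]

lemma abs_div_sq_add_sq_le (u v : ℝ) : |u / (u ^ 2 + v ^ 2)| ≤ ‖(u, v)‖⁻¹ := by
  rcases eq_or_ne (u, v) 0 with h | h
  · obtain ⟨rfl, rfl⟩ := Prod.mk_eq_zero.1 h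
    simp
  have hpos : 0 < ‖(u, v)‖ := norm_pos_iff.2 h
  have h2 : ‖(u, v)‖ * |u| ≤ u ^ 2 + v ^ 2 := by
    rw [Prod.norm_def, Real.norm_eq_abs, Real.norm_eq_abs, ← sq_abs u, ← sq_abs v]
    rcases max_choice |u| |v| with e | e <;> simp only [e] <;>
      nlinarith [sq_nonneg (|u| - |v|), abs_nonneg u, abs_nonneg v]
  have hq : 0 < u ^ 2 + v ^ 2 := by
    rcases not_and_or.1 (fun h' => h (Prod.mk_eq_zero.2 h')) with h' | h' <;> positivity
  rw [abs_div, abs_of_pos hq, div_le_iff₀ hq, ← div_eq_inv_mul, le_div_iff₀ hpos, mul_comm]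
  exact h2

namespace IsSheet

variable {β C a : ℝ} {ζ ζ' : ℝ → ℝ}

/-- The kernel is singular on the sheet, but only of order `1 / ‖v‖`, which is integrable in the
plane; this justifies the exchange of the integrals over the plane and over the sheet. -/
lemma integrable_curl_window (h : IsSheet β C a ζ ζ') (ha : 0 < a)
    {φ : ℝ × ℝ → ℝ} (hφ : ContDiff ℝ 1 φ) (hc : HasCompactSupport φ) (R : ℝ) :
    Integrable (fun q : (ℝ × ℝ) × ℝ => bsFst ζ ζ' 0 q.1.1 q.1.2 (q.1.1 - q.2) * (-d2 φ q.1) +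
        bsSnd ζ ζ' 0 q.1.1 q.1.2 (q.1.1 - q.2) * d1 φ q.1)
      (volume.prod (volume.restrict (Ioc (-R) R))) := by
  have c1 := continuous_d1 hφ
  have c2 := continuous_d2 hφ
  obtain ⟨B₁, hB₁0, hB₁⟩ := exists_box (hasCompactSupport_d1 hc)
  obtain ⟨B₂, hB₂0, hB₂⟩ := exists_box (hasCompactSupport_d2 hc)
  obtain ⟨M₁, hM₁⟩ := (hasCompactSupport_d1 hc).exists_bound_of_continuous c1
  obtain ⟨M₂, hM₂⟩ := (hasCompactSupport_d2 hc).exists_bound_of_continuous c2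
  have hm : AEStronglyMeasurable (fun q : (ℝ × ℝ) × ℝ =>
      bsFst ζ ζ' 0 q.1.1 q.1.2 (q.1.1 - q.2) * (-d2 φ q.1) +
        bsSnd ζ ζ' 0 q.1.1 q.1.2 (q.1.1 - q.2) * d1 φ q.1)
      (volume.prod (volume.restrict (Ioc (-R) R))) := by
    have hζ := h.continuous.measurable
    have hζ' := h.cont.measurable
    have m1 := c1.measurable
    have m2 := c2.measurable
    simp_rw [bsFst_sub, bsSnd_sub]
    exact (by fun_prop : Measurable _).aestronglyMeasurable
  set r := max B₁ B₂ with hr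
  set ρ := r + |R| + (|β| * |R| + C) with hρ
  set I : ℝ × ℝ → ℝ := fun v => (Iic ρ).indicator (fun r : ℝ => r⁻¹) ‖v‖ with hI
  have iI : Integrable I := integrable_inv_norm ρ
  have hIm : Measurable I :=
    (measurable_inv.indicator measurableSet_Iic).comp measurable_norm
  have hI0 : ∀ v, 0 ≤ I v := fun v => by
    simp only [hI, indicator]
    split_ifs
    · positivity
    · exact le_rfl
  have hC := h.nonneg
  have hL : 0 ≤ |β| + C := by positivity
  have hM₁0 : 0 ≤ M₁ := (norm_nonneg _).trans (hM₁ 0)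
  have hM₂0 : 0 ≤ M₂ := (norm_nonneg _).trans (hM₂ 0)
  set K := (|β| + C) * (M₁ + M₂) with hK
  have hζ := h.continuous
  have hJ : Integrable (fun q : (ℝ × ℝ) × ℝ => K * I (q.1 - (q.2, ζ q.2)))
      (volume.prod (volume.restrict (Ioc (-R) R))) := by
    have hJm : Measurable fun q : (ℝ × ℝ) × ℝ => K * I (q.1 - (q.2, ζ q.2)) :=
      (hIm.comp (by fun_prop)).const_mul K
    rw [integrable_prod_iff' hJm.aestronglyMeasurable]
    refine ⟨Eventually.of_forall fun σ => (iI.comp_sub_right (σ, ζ σ)).const_mul K, ?_⟩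
    have : ∀ σ : ℝ, ∫ q : ℝ × ℝ, ‖K * I (q - (σ, ζ σ))‖ = ∫ q : ℝ × ℝ, ‖K * I q‖ := fun σ =>
      integral_sub_right_eq_self (fun q : ℝ × ℝ => ‖K * I q‖) (σ, ζ σ)
    simp_rw [this]
    exact integrable_const _
  refine hJ.mono' hm ?_
  have hmem : ∀ᵐ q : (ℝ × ℝ) × ℝ ∂(volume.prod (volume.restrict (Ioc (-R) R))),
      q.2 ∈ Ioc (-R) R :=
    Measure.quasiMeasurePreserving_snd.ae (ae_restrict_mem measurableSet_Ioc)
  filter_upwards [hmem] with q hq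
  by_cases hbox : q.1 ∈ Icc (-r) r ×ˢ Icc (-r) r
  · have hx : |q.1.1| ≤ r := abs_le.2 hbox.1
    have hy : |q.1.2| ≤ r := abs_le.2 hbox.2
    have hσ : |q.2| ≤ |R| := (abs_le.2 ⟨hq.1.le, hq.2⟩).trans (le_abs_self R)
    have hn : ‖q.1 - (q.2, ζ q.2)‖ ≤ ρ := by
      have hb : |ζ q.2| ≤ |β| * |R| + C := by
        have h1 := abs_le.1 (h.bdd q.2)
        have h2 : |β * q.2| ≤ |β| * |R| := by rw [abs_mul]; gcongr
        rw [abs_le] at h2 ⊢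
        constructor <;> linarith
      have hR0 := abs_nonneg R
      have hb0 := (abs_nonneg _).trans hb
      have h0 : (0 : ℝ) ≤ |β| * |R| := by positivity
      rw [Prod.norm_def]
      refine max_le ?_ ?_
      · exact (abs_sub _ _).trans (by simp only [hρ]; linarith)
      · exact (abs_sub _ _).trans (by simp only [hρ]; linarith)
    have hIq : I (q.1 - (q.2, ζ q.2)) = ‖q.1 - (q.2, ζ q.2)‖⁻¹ := by
      simp only [hI, indicator, mem_Iic, hn, if_true]
    have k1 : |bsFst ζ ζ' 0 q.1.1 q.1.2 (q.1.1 - q.2)| ≤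
        (|β| + C) * I (q.1 - (q.2, ζ q.2)) := by
      rw [bsFst_sub, hIq, abs_mul]
      refine mul_le_mul (h.abs_deriv_le ha _) ?_ (abs_nonneg _) hL
      have := abs_div_sq_add_sq_le (q.1.2 - ζ q.2) (q.1.1 - q.2)
      rw [Prod.norm_mk, max_comm, ← Prod.norm_mk] at this
      rw [neg_div, abs_neg, zero_pow two_ne_zero, add_zero, add_comm ((q.1.1 - q.2) ^ 2)]
      exact this
    have k2 : |bsSnd ζ ζ' 0 q.1.1 q.1.2 (q.1.1 - q.2)| ≤
        (|β| + C) * I (q.1 - (q.2, ζ q.2)) := by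
      rw [bsSnd_sub, hIq, abs_mul]
      refine mul_le_mul (h.abs_deriv_le ha _) ?_ (abs_nonneg _) hL
      have := abs_div_sq_add_sq_le (q.1.1 - q.2) (q.1.2 - ζ q.2)
      rw [zero_pow two_ne_zero, add_zero]
      exact this
    have b1 : |d1 φ q.1| ≤ M₁ := hM₁ _
    have b2 : |d2 φ q.1| ≤ M₂ := hM₂ _
    have hi := hI0 (q.1 - (q.2, ζ q.2))
    rw [Real.norm_eq_abs]
    refine (abs_add_le _ _).trans ?_
    rw [abs_mul, abs_mul, abs_neg]
    calc _ ≤ (|β| + C) * I (q.1 - (q.2, ζ q.2)) * M₂ + (|β| + C) * I (q.1 - (q.2, ζ q.2)) * M₁ := by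
          gcongr
      _ = _ := by rw [hK]; ring
  · have z1 : d1 φ q.1 = 0 := hB₁ _ fun hm => hbox (prod_mono
      (Icc_subset_Icc (neg_le_neg (le_max_left _ _)) (le_max_left _ _))
      (Icc_subset_Icc (neg_le_neg (le_max_left _ _)) (le_max_left _ _)) hm)
    have z2 : d2 φ q.1 = 0 := hB₂ _ fun hm => hbox (prod_mono
      (Icc_subset_Icc (neg_le_neg (le_max_right _ _)) (le_max_right _ _))
      (Icc_subset_Icc (neg_le_neg (le_max_right _ _)) (le_max_right _ _)) hm)
    rw [z1, z2]
    have := hI0 (q.1 - (q.2, ζ q.2))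
    simp only [neg_zero, mul_zero, add_zero, norm_zero]
    positivity

/-- The vorticity of a piece of the sheet, by superposition of point vortices. -/
lemma integral_curl_window (h : IsSheet β C a ζ ζ') (ha : 0 < a)
    {φ : ℝ × ℝ → ℝ} (hφ : ContDiff ℝ 1 φ) (hc : HasCompactSupport φ) {R : ℝ} (hR : 0 ≤ R) :
    ∫ q : ℝ × ℝ, (winFst ζ ζ' 0 R q * (-d2 φ q) + winSnd ζ ζ' 0 R q * d1 φ q) =
      -(2 * Real.pi) * ∫ σ in (-R)..R, φ (σ, ζ σ) * ζ' σ := by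
  have hle : -R ≤ R := by linarith
  have hint := h.integrable_curl_window ha hφ hc R
  have hoff : ∀ᵐ q : ℝ × ℝ, winFst ζ ζ' 0 R q * (-d2 φ q) + winSnd ζ ζ' 0 R q * d1 φ q =
      ∫ σ in Ioc (-R) R, (bsFst ζ ζ' 0 q.1 q.2 (q.1 - σ) * (-d2 φ q) +
        bsSnd ζ ζ' 0 q.1 q.2 (q.1 - σ) * d1 φ q) := by
    filter_upwards [ae_off_graph h.continuous] with q hq
    have hpos : 0 < (q.2 - ζ q.1) ^ 2 + (0 : ℝ) ^ 2 := by
      have : q.2 - ζ q.1 ≠ 0 := sub_ne_zero.2 hq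
      positivity
    have g1 : IntervalIntegrable (fun σ => bsFst ζ ζ' 0 q.1 q.2 (q.1 - σ)) volume (-R) R :=
      ((h.continuous_bsFst hpos).comp (continuous_const.sub continuous_id)).intervalIntegrable _ _
    have g2 : IntervalIntegrable (fun σ => bsSnd ζ ζ' 0 q.1 q.2 (q.1 - σ)) volume (-R) R :=
      ((h.continuous_bsSnd hpos).comp (continuous_const.sub continuous_id)).intervalIntegrable _ _
    rw [← intervalIntegral.integral_of_le hle, intervalIntegral.integral_add
      (g1.mul_const _) (g2.mul_const _), intervalIntegral.integral_mul_const,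
      intervalIntegral.integral_mul_const]
    rfl
  rw [integral_congr_ae hoff]
  refine (integral_integral_swap hint).trans ?_
  rw [intervalIntegral.integral_of_le hle, ← integral_const_mul]
  refine integral_congr_ae (Eventually.of_forall fun σ => ?_)
  have := integral_radial hφ hc (σ, ζ σ)
  simp only at this ⊢
  calc _ = ∫ q : ℝ × ℝ, ζ' σ * (((q.1 - σ) * d1 φ q + (q.2 - ζ σ) * d2 φ q) /
      ((q.1 - σ) ^ 2 + (q.2 - ζ σ) ^ 2)) := by
        congr 1
        ext q
        rw [bsFst_sub, bsSnd_sub, zero_pow two_ne_zero, add_zero]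
        ring
    _ = _ := by rw [integral_const_mul, this]; ring

lemma aestronglyMeasurable_win (h : IsSheet β C a ζ ζ') {R : ℝ} (hR : 0 ≤ R) :
    AEStronglyMeasurable (winFst ζ ζ' 0 R) volume ∧
    AEStronglyMeasurable (winSnd ζ ζ' 0 R) volume := by
  have hζ := h.continuous.measurable
  have hζ' := h.cont.measurable
  have hle : -R ≤ R := by linarith
  have m1 : Measurable fun q : (ℝ × ℝ) × ℝ => bsFst ζ ζ' 0 q.1.1 q.1.2 (q.1.1 - q.2) := by
    simp_rw [bsFst_sub]; fun_prop
  have m2 : Measurable fun q : (ℝ × ℝ) × ℝ => bsSnd ζ ζ' 0 q.1.1 q.1.2 (q.1.1 - q.2) := by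
    simp_rw [bsSnd_sub]; fun_prop
  constructor
  · have := (m1.stronglyMeasurable.integral_prod_right'
      (ν := volume.restrict (Ioc (-R) R))).aestronglyMeasurable (μ := (volume : Measure (ℝ × ℝ)))
    refine this.congr (Eventually.of_forall fun q => ?_)
    simp only [winFst, intervalIntegral.integral_of_le hle]
  · have := (m2.stronglyMeasurable.integral_prod_right'
      (ν := volume.restrict (Ioc (-R) R))).aestronglyMeasurable (μ := (volume : Measure (ℝ × ℝ)))
    refine this.congr (Eventually.of_forall fun q => ?_)
    simp only [winSnd, intervalIntegral.integral_of_le hle]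

/-- The vorticity of a sheet is the measure `ζ'(s) ds` on its graph. -/
lemma integral_vel_curl (h : IsSheet β C a ζ ζ') (ha : 0 < a)
    {φ : ℝ × ℝ → ℝ} (hφ : ContDiff ℝ 1 φ) (hc : HasCompactSupport φ) :
    ∫ q : ℝ × ℝ, (velFst ζ 0 q.1 q.2 * (-d2 φ q) + velSnd ζ ζ' 0 q.1 q.2 * d1 φ q) =
      -∫ s, φ (s, ζ s) * ζ' s := by
  obtain ⟨B₁, hB₁0, hB₁⟩ := exists_box (hasCompactSupport_d1 hc)
  obtain ⟨B₂, hB₂0, hB₂⟩ := exists_box (hasCompactSupport_d2 hc)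
  set r := max B₁ B₂ with hr
  have box : ∀ {b : ℝ}, b ≤ r → Icc (-b) b ×ˢ Icc (-b) b ⊆ Icc (-r) r ×ˢ Icc (-r) r :=
    fun hb => prod_mono (Icc_subset_Icc (by linarith) hb) (Icc_subset_Icc (by linarith) hb)
  have hpos : ∀ q : ℝ × ℝ, q.2 ≠ ζ q.1 → 0 < (q.2 - ζ q.1) ^ 2 + (0 : ℝ) ^ 2 := fun q hq => by
    have : q.2 - ζ q.1 ≠ 0 := sub_ne_zero.2 hq
    positivity
  have i1 := (continuous_d1 hφ).integrable_of_hasCompactSupport (μ := volume)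
    (hasCompactSupport_d1 hc)
  have i2 := (continuous_d2 hφ).integrable_of_hasCompactSupport (μ := volume)
    (hasCompactSupport_d2 hc)
  have L := tendsto_integral_pair (μ := volume) (l := atTop)
    (M := velBound β C a + (|β| + C) * (2 * (r + (|β| * r + C)) + 4 * C) + 2 * (|β| + C))
    (W₁ := winFst ζ ζ' 0) (W₂ := winSnd ζ ζ' 0)
    (V₁ := fun q => 2 * Real.pi * velFst ζ 0 q.1 q.2)
    (V₂ := fun q => 2 * Real.pi * velSnd ζ ζ' 0 q.1 q.2) i2.neg i1
    (by filter_upwards [eventually_ge_atTop 0] with R hR using (h.aestronglyMeasurable_win hR).1)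
    (by filter_upwards [eventually_ge_atTop 0] with R hR using (h.aestronglyMeasurable_win hR).2)
    (by
      filter_upwards [eventually_ge_atTop (2 * r + 1)] with R hR
      filter_upwards [ae_off_graph h.continuous] with q hoff hq
      have hm : q ∈ Icc (-r) r ×ˢ Icc (-r) r := by
        by_contra hn
        rcases hq with hq | hq
        · refine hq ?_
          simp [hB₂ q fun hm => hn (box (by simp [hr]) hm)]
        · exact hq (hB₁ q fun hm => hn (box (by simp [hr]) hm))
      obtain ⟨b1, b2⟩ := h.height_le hm.1 hm.2
      exact h.abs_window_le ha (hpos q hoff) b1 b2 hR)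
    (by
      filter_upwards [ae_off_graph h.continuous] with q hoff
      exact ⟨h.tendsto_window_bsFst ha (hpos q hoff), h.tendsto_window_bsSnd ha (hpos q hoff)⟩)
  have L' : Tendsto (fun R : ℝ => -(2 * Real.pi) * ∫ σ in (-R)..R, φ (σ, ζ σ) * ζ' σ) atTop
      (𝓝 (-(2 * Real.pi) * ∫ σ, φ (σ, ζ σ) * ζ' σ)) :=
    (intervalIntegral_tendsto_integral (integrable_curve h.continuous h.cont hφ.continuous hc)
      tendsto_neg_atTop_atBot tendsto_id).const_mul _
  have e0 : ∀ᶠ R in atTop, (∫ q : ℝ × ℝ, (winFst ζ ζ' 0 R q * (-d2 φ) q +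
      winSnd ζ ζ' 0 R q * d1 φ q)) = -(2 * Real.pi) * ∫ σ in (-R)..R, φ (σ, ζ σ) * ζ' σ := by
    filter_upwards [eventually_ge_atTop 0] with R hR
    exact h.integral_curl_window ha hφ hc hR
  have := tendsto_nhds_unique (L.congr' e0) L'
  have hp : (2 * Real.pi) ≠ 0 := by positivity
  simp only [mul_assoc (2 * Real.pi), ← mul_add (2 * Real.pi), neg_mul] at this
  rw [integral_const_mul, ← mul_neg] at this
  exact mul_left_cancel₀ hp this

end IsSheet

end Muskat

/-! ### Weighted Hölder norms -/

namespace Muskat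

lemma mul_abs_iteratedDeriv_le {k : ℕ} {α K : ℝ} {g : ℝ → ℝ} (hK : 0 ≤ K)
    (h : starNorm k α g ≤ ENNReal.ofReal K) {j : ℕ} (hj : j ≤ k) (s : ℝ) :
    (1 + |s| ^ (1 + α)) * |iteratedDeriv j g s| ≤ K := by
  rw [← ENNReal.ofReal_le_ofReal_iff hK]
  refine le_trans ?_ (le_self_add.trans h)
  exact le_iSup_of_le s (le_iSup_of_le j (le_iSup_of_le hj le_rfl))

lemma abs_iteratedDeriv_sub_le {k : ℕ} {α K : ℝ} {g : ℝ → ℝ} (hK : 0 ≤ K)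
    (h : starNorm k α g ≤ ENNReal.ofReal K) (s ξ : ℝ) (hξ : |ξ| ≤ 1) :
    |iteratedDeriv k g (s - ξ) - iteratedDeriv k g s| ≤ K * |ξ| ^ α := by
  have h1 : (1 + |s| ^ (1 + α)) *
      (|iteratedDeriv k g (s - ξ) - iteratedDeriv k g s| / |ξ| ^ α) ≤ K := by
    rw [← ENNReal.ofReal_le_ofReal_iff hK]
    refine le_trans ?_ (le_add_self.trans h)
    exact le_iSup_of_le s (le_iSup_of_le ξ (le_iSup_of_le hξ le_rfl))
  rcases eq_or_ne ξ 0 with rfl | h0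
  · simp only [sub_zero, sub_self, abs_zero]
    positivity
  have hp : 0 < |ξ| ^ α := Real.rpow_pos_of_pos (abs_pos.2 h0) _
  rw [← div_le_iff₀ hp]
  refine le_trans ?_ h1
  refine le_mul_of_one_le_left (by positivity) ?_
  have : 0 ≤ |s| ^ (1 + α) := by positivity
  linarith

/-- The quantitative content of a bound of the norm of `C_*^{1,α}`. -/
structure StarLe (α K : ℝ) (g : ℝ → ℝ) : Prop where
  nonneg : 0 ≤ K
  val : ∀ s, (1 + |s| ^ (1 + α)) * |g s| ≤ K
  der : ∀ s, (1 + |s| ^ (1 + α)) * |deriv g s| ≤ K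
  holder : ∀ s ξ, |ξ| ≤ 1 → |deriv g (s - ξ) - deriv g s| ≤ K * |ξ| ^ α

lemma starLe_of_starNorm_le {α K : ℝ} {g : ℝ → ℝ} (hK : 0 ≤ K)
    (h : starNorm 1 α g ≤ ENNReal.ofReal K) : StarLe α K g where
  nonneg := hK
  val s := by simpa using mul_abs_iteratedDeriv_le hK h zero_le_one s
  der s := by simpa using mul_abs_iteratedDeriv_le hK h le_rfl s
  holder s ξ hξ := by simpa using abs_iteratedDeriv_sub_le hK h s ξ hξ

lemma MemStar.exists_starLe {α : ℝ} {g : ℝ → ℝ} (h : MemStar 1 α g) : ∃ K, StarLe α K g :=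
  ⟨_, starLe_of_starNorm_le ENNReal.toReal_nonneg (ENNReal.ofReal_toReal h.2.ne).ge⟩

namespace StarLe

variable {α K K₁ K₂ : ℝ} {g g₁ g₂ : ℝ → ℝ}

lemma mono (h : StarLe α K₁ g) (hK : K₁ ≤ K₂) : StarLe α K₂ g where
  nonneg := h.nonneg.trans hK
  val s := (h.val s).trans hK
  der s := (h.der s).trans hK
  holder s ξ hξ := (h.holder s ξ hξ).trans (by gcongr)

lemma add (h₁ : StarLe α K₁ g₁) (h₂ : StarLe α K₂ g₂) (d₁ : Differentiable ℝ g₁)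
    (d₂ : Differentiable ℝ g₂) : StarLe α (K₁ + K₂) (fun s => g₁ s + g₂ s) := by
  have hd : deriv (fun s => g₁ s + g₂ s) = fun s => deriv g₁ s + deriv g₂ s :=
    funext fun s => deriv_fun_add (d₁ s) (d₂ s)
  have hw : ∀ s : ℝ, 0 ≤ 1 + |s| ^ (1 + α) := fun s => by positivity
  refine ⟨add_nonneg h₁.nonneg h₂.nonneg, fun s => ?_, fun s => ?_, fun s ξ hξ => ?_⟩
  · have := mul_le_mul_of_nonneg_left (abs_add_le (g₁ s) (g₂ s)) (hw s)
    linarith [h₁.val s, h₂.val s]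
  · rw [hd]
    have := mul_le_mul_of_nonneg_left (abs_add_le (deriv g₁ s) (deriv g₂ s)) (hw s)
    linarith [h₁.der s, h₂.der s]
  · rw [hd]
    have := abs_add_le (deriv g₁ (s - ξ) - deriv g₁ s) (deriv g₂ (s - ξ) - deriv g₂ s)
    have e : deriv g₁ (s - ξ) + deriv g₂ (s - ξ) - (deriv g₁ s + deriv g₂ s) =
      (deriv g₁ (s - ξ) - deriv g₁ s) + (deriv g₂ (s - ξ) - deriv g₂ s) := by ring
    simp only [e]
    linarith [h₁.holder s ξ hξ, h₂.holder s ξ hξ]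

lemma const_mul (h : StarLe α K g) (r : ℝ) : StarLe α (|r| * K) (fun s => r * g s) := by
  have hd : deriv (fun s => r * g s) = fun s => r * deriv g s :=
    funext fun s => deriv_const_mul_field r
  refine ⟨mul_nonneg (abs_nonneg r) h.nonneg, fun s => ?_, fun s => ?_, fun s ξ hξ => ?_⟩
  · rw [abs_mul]
    have := mul_le_mul_of_nonneg_left (h.val s) (abs_nonneg r)
    linarith
  · rw [hd, abs_mul]
    have := mul_le_mul_of_nonneg_left (h.der s) (abs_nonneg r)
    linarith
  · rw [hd]
    have := mul_le_mul_of_nonneg_left (h.holder s ξ hξ) (abs_nonneg r)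
    simp only [← mul_sub, abs_mul]
    linarith

lemma abs_le (h : StarLe α K g) (s : ℝ) : |g s| ≤ K := by
  refine le_trans (le_mul_of_one_le_left (abs_nonneg _) ?_) (h.val s)
  have : 0 ≤ |s| ^ (1 + α) := by positivity
  linarith

lemma abs_deriv_le (h : StarLe α K g) (s : ℝ) : |deriv g s| ≤ K := by
  refine le_trans (le_mul_of_one_le_left (abs_nonneg _) ?_) (h.der s)
  have : 0 ≤ |s| ^ (1 + α) := by positivity
  linarith

end StarLe

lemma eventually_starLe {ι : Type*} {l : Filter ι} {α : ℝ} {g : ι → ℝ → ℝ}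
    (h : Tendsto (fun i => starNorm 1 α (g i)) l (𝓝 0)) {ε : ℝ} (hε : 0 < ε) :
    ∀ᶠ i in l, StarLe α ε (g i) := by
  have := h.eventually (gt_mem_nhds (ENNReal.ofReal_pos.2 hε))
  filter_upwards [this] with i hi using starLe_of_starNorm_le hε.le hi.le

/-- Continuity in time, uniformly in space, and continuity in space give joint continuity. -/
lemma continuousOn_of_uniform {F : ℝ → ℝ → ℝ} {S : Set ℝ}
    (hs : ∀ t ∈ S, Continuous fun s => F s t)
    (ht : ∀ t ∈ S, ∀ ε > 0, ∀ᶠ τ in 𝓝[S] t, ∀ s, |F s τ - F s t| ≤ ε) :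
    ContinuousOn (fun q : ℝ × ℝ => F q.1 q.2) (univ ×ˢ S) := by
  rintro ⟨s, t⟩ ⟨-, hmem⟩
  rw [ContinuousWithinAt, Metric.tendsto_nhds]
  intro ε hε
  have h1 : ∀ᶠ q : ℝ × ℝ in 𝓝[univ ×ˢ S] (s, t), ∀ r, |F r q.2 - F r t| ≤ ε / 3 := by
    rw [nhdsWithin_prod_eq]
    exact tendsto_snd.eventually (ht t hmem (ε / 3) (by positivity))
  have h2 : ∀ᶠ q : ℝ × ℝ in 𝓝[univ ×ˢ S] (s, t), |F q.1 t - F s t| < ε / 3 := by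
    have := Metric.tendsto_nhds.1 ((hs t hmem).tendsto s) (ε / 3) (by positivity)
    rw [nhdsWithin_prod_eq, nhdsWithin_univ]
    exact tendsto_fst.eventually this
  filter_upwards [h1, h2] with q h1 h2
  rw [Real.dist_eq]
  have e : F q.1 q.2 - F s t = (F q.1 q.2 - F q.1 t) + (F q.1 t - F s t) := by ring
  calc |F q.1 q.2 - F s t| ≤ |F q.1 q.2 - F q.1 t| + |F q.1 t - F s t| := by
        rw [e]; exact abs_add_le _ _
    _ < ε := by linarith [h1 q.1]

/-- The classical content of `C1InTime`, for `k = 1`. -/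
lemma C1InTime.exists_fields {α T : ℝ} {f : ℝ → ℝ → ℝ} (h : C1InTime 1 α T f) :
    ∃ f' : ℝ → ℝ → ℝ,
      (∀ t ∈ Icc 0 T, ∀ s, HasDerivAt (fun s => f s t) (deriv (fun s => f s t) s) s) ∧
      (∀ t ∈ Icc 0 T, ∀ s, HasDerivWithinAt (fun τ => f s τ) (f' s t) (Icc 0 T) t) ∧
      ContinuousOn (fun q : ℝ × ℝ => f q.1 q.2) (univ ×ˢ Icc 0 T) ∧
      ContinuousOn (fun q : ℝ × ℝ => deriv (fun s => f s q.2) q.1) (univ ×ˢ Icc 0 T) ∧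
      ContinuousOn (fun q : ℝ × ℝ => f' q.1 q.2) (univ ×ˢ Icc 0 T) ∧
      ∃ K, ∀ t ∈ Icc 0 T, StarLe α K fun s => f s t := by
  obtain ⟨f', hmem, hd, hc⟩ := h
  have df : ∀ t ∈ Icc 0 T, Differentiable ℝ fun s => f s t := fun t ht =>
    (hmem t ht).1.1.differentiable one_ne_zero
  have df' : ∀ t ∈ Icc 0 T, Differentiable ℝ fun s => f' s t := fun t ht =>
    (hmem t ht).2.1.differentiable one_ne_zero
  -- local Lipschitz continuity in time with values in the weighted space
  have hlip : ∀ t ∈ Icc 0 T, ∃ K', 0 ≤ K' ∧ ∀ᶠ τ in 𝓝[Icc 0 T] t,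
      StarLe α (|τ - t| * K') fun s => f s τ - f s t := by
    intro t ht
    obtain ⟨K', hK'⟩ := (hmem t ht).2.exists_starLe
    refine ⟨1 + K', add_nonneg zero_le_one hK'.nonneg, ?_⟩
    have h1 := eventually_starLe (hd t ht) one_pos
    rw [eventually_nhdsWithin_iff] at h1 ⊢
    filter_upwards [h1] with τ hτ hτT
    by_cases hne : τ = t
    · subst hne
      have : (fun s => f s τ - f s τ) = fun _ => 0 := by ext; simp
      rw [this]
      exact ⟨by simp, by simp, by simp, by simp⟩
    · have h2 := hτ ⟨hτT, hne⟩
      have d1 : Differentiable ℝ fun s => (f s τ - f s t) / (τ - t) - f' s t :=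
        (((df τ hτT).sub (df t ht)).div_const _).sub (df' t ht)
      have h3 := (h2.add hK' d1 (df' t ht)).const_mul (τ - t)
      have e : (fun s => (τ - t) * ((f s τ - f s t) / (τ - t) - f' s t + f' s t)) =
          fun s => f s τ - f s t := by
        ext s
        have : τ - t ≠ 0 := sub_ne_zero.2 hne
        field_simp
        ring
      rwa [e] at h3
  have hsmall : ∀ t ∈ Icc 0 T, ∀ ε > 0, ∀ᶠ τ in 𝓝[Icc 0 T] t,
      StarLe α ε fun s => f s τ - f s t := by
    intro t ht ε hε
    obtain ⟨K', hK'0, hK'⟩ := hlip t ht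
    have h1 : Tendsto (fun τ => |τ - t| * K') (𝓝[Icc 0 T] t) (𝓝 0) := by
      have : Tendsto (fun τ => |τ - t| * K') (𝓝 t) (𝓝 (|t - t| * K')) :=
        (by fun_prop : Continuous fun τ => |τ - t| * K').tendsto t
      simp only [sub_self, abs_zero, zero_mul] at this
      exact this.mono_left nhdsWithin_le_nhds
    filter_upwards [hK', h1.eventually (gt_mem_nhds hε)] with τ a b using a.mono b.le
  refine ⟨f', fun t ht s => ((df t ht) s).hasDerivAt, fun t ht s => ?_, ?_, ?_, ?_, ?_⟩
  · rw [hasDerivWithinAt_iff_tendsto_slope, Metric.tendsto_nhds]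
    intro ε hε
    filter_upwards [eventually_starLe (hd t ht) (half_pos hε)] with τ hτ
    have := hτ.abs_le s
    rw [Real.dist_eq, slope_def_field]
    linarith
  · refine continuousOn_of_uniform (fun t ht => (df t ht).continuous) fun t ht ε hε => ?_
    filter_upwards [hsmall t ht ε hε] with τ hτ s using hτ.abs_le s
  · refine continuousOn_of_uniform (F := fun s t => deriv (fun s => f s t) s)
      (fun t ht => (hmem t ht).1.1.continuous_deriv le_rfl) fun t ht ε hε => ?_
    filter_upwards [hsmall t ht ε hε, self_mem_nhdsWithin] with τ hτ hτT s
    have := hτ.abs_deriv_le s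
    rwa [deriv_fun_sub (df τ hτT s) (df t ht s)] at this
  · refine continuousOn_of_uniform (fun t ht => (df' t ht).continuous) fun t ht ε hε => ?_
    filter_upwards [eventually_starLe (hc t ht) hε] with τ hτ s using hτ.abs_le s
  -- the local bounds give a uniform one by compactness of the time interval
  · refine isCompact_Icc.induction_on (p := fun S => ∃ K, ∀ t ∈ S, StarLe α K fun s => f s t)
      ⟨0, by simp⟩ ?_ ?_ ?_
    · rintro S S' hS ⟨K, hK⟩
      exact ⟨K, fun t ht => hK t (hS ht)⟩
    · rintro S S' ⟨K, hK⟩ ⟨K', hK'⟩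
      refine ⟨max K K', fun t ht => ?_⟩
      rcases ht with ht | ht
      · exact (hK t ht).mono (le_max_left _ _)
      · exact (hK' t ht).mono (le_max_right _ _)
    · intro t ht
      obtain ⟨K, hK⟩ := (hmem t ht).1.exists_starLe
      have h1 : ∀ᶠ τ in 𝓝[Icc 0 T] t, StarLe α (1 + K) fun s => f s τ := by
        filter_upwards [hsmall t ht 1 one_pos, self_mem_nhdsWithin] with τ hτ hτT
        have := hτ.add hK ((df τ hτT).sub (df t ht)) (df t ht)
        simpa using this
      exact ⟨{τ | StarLe α (1 + K) fun s => f s τ}, h1, 1 + K, fun τ hτ => hτ⟩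

lemma one_add_abs_rpow_le {α : ℝ} (hα : 0 < α) (hα1 : α < 1) (s : ℝ) :
    (1 + |s|) ^ (1 + α) ≤ 4 * (1 + |s| ^ (1 + α)) := by
  have h0 := abs_nonneg s
  have h1 : 1 + |s| ≤ 2 * max 1 |s| := by
    have := le_max_left 1 |s|
    have := le_max_right 1 |s|
    linarith
  have hm : (0 : ℝ) ≤ max 1 |s| := by positivity
  calc (1 + |s|) ^ (1 + α) ≤ (2 * max 1 |s|) ^ (1 + α) :=
        Real.rpow_le_rpow (by linarith) h1 (by linarith)
    _ = 2 ^ (1 + α) * (max 1 |s|) ^ (1 + α) := Real.mul_rpow (by norm_num) hm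
    _ ≤ 2 ^ (2 : ℝ) * (max 1 |s|) ^ (1 + α) := by
        gcongr
        · norm_num
        · linarith
    _ = 4 * (max 1 |s|) ^ (1 + α) := by norm_num
    _ ≤ 4 * (1 + |s| ^ (1 + α)) := by
        gcongr
        have : 0 ≤ |s| ^ (1 + α) := by positivity
        rcases max_choice 1 |s| with e | e <;> rw [e]
        · rw [Real.one_rpow]; linarith
        · linarith

/-- A bound in terms of the weight `1 + |s|^(1+α)`, turned into one in terms of `weight a` for any
smaller exponent `a`. -/
lemma abs_le_weight {α a K : ℝ} (hα : 0 < α) (hα1 : α < 1) (haα : a ≤ α) {r s : ℝ}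
    (h : (1 + |s| ^ (1 + α)) * |r| ≤ K) : |r| ≤ 4 * K * (1 + |s|) ^ (-(1 + a)) := by
  have h0 : 1 ≤ 1 + |s| := by linarith [abs_nonneg s]
  have h1 : 0 < (1 + |s|) ^ (1 + a) := Real.rpow_pos_of_pos (by linarith) _
  rw [Real.rpow_neg (by linarith), ← div_eq_mul_inv, le_div_iff₀ h1]
  have h2 : (1 + |s|) ^ (1 + a) ≤ (1 + |s|) ^ (1 + α) :=
    Real.rpow_le_rpow_of_exponent_le h0 (by linarith)
  have h3 := one_add_abs_rpow_le hα hα1 s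
  have := mul_le_mul_of_nonneg_left (h2.trans h3) (abs_nonneg r)
  linarith

end Muskat

/-! ### The family of interfaces -/

namespace Muskat

/-- The projection of the time axis to `[0,T]`. Composition with it extends functions of
`t ∈ [0,T]` continuously to all times. -/
noncomputable def clamp (T t : ℝ) : ℝ := max 0 (min t T)

lemma clamp_mem {T : ℝ} (hT : 0 < T) (t : ℝ) : clamp T t ∈ Icc 0 T :=
  ⟨le_max_left _ _, max_le hT.le (min_le_right _ _)⟩

lemma clamp_of_mem {T t : ℝ} (ht : t ∈ Icc 0 T) : clamp T t = t := by
  rw [clamp, min_eq_left ht.2, max_eq_right ht.1]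

lemma clamp_pos {T t : ℝ} (hT : 0 < T) (ht : 0 < t) : 0 < clamp T t :=
  lt_max_of_lt_right (lt_min ht hT)

lemma continuous_clamp (T : ℝ) : Continuous (clamp T) := by unfold clamp; fun_prop

/-- The ratio `c_i / c`. -/
noncomputable def coef (N : ℕ) (i : ℤ) : ℝ := (i.sign : ℝ) * ((2 * |(i : ℝ)| - 1) / (2 * N - 1))

lemma speed_eq (N : ℕ) (c : ℝ → ℝ) (i : ℤ) (s : ℝ) : speed N c i s = coef N i * c s := rfl

lemma two_mul_sub_one_pos {N : ℕ} (hN : 1 ≤ N) : (0 : ℝ) < 2 * N - 1 := by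
  have : (1 : ℝ) ≤ N := by exact_mod_cast hN
  linarith

lemma coef_natCast (N : ℕ) {i : ℕ} (hi : 1 ≤ i) : coef N i = (2 * i - 1) / (2 * N - 1) := by
  have : (0 : ℤ) < i := by exact_mod_cast hi
  simp [coef, Int.sign_eq_one_of_pos this]

lemma coef_neg (N : ℕ) (i : ℤ) : coef N (-i) = -coef N i := by
  simp [coef]

lemma mem_indices {N : ℕ} {i : ℤ} : i ∈ indices N ↔ i ≠ 0 ∧ |i| ≤ N := by
  simp [indices, abs_le]

lemma neg_mem_indices {N : ℕ} {i : ℤ} (hi : i ∈ indices N) : -i ∈ indices N := by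
  rw [mem_indices] at *
  simpa using hi

lemma natCast_mem_indices {N i : ℕ} (h1 : 1 ≤ i) (h2 : i ≤ N) : (i : ℤ) ∈ indices N := by
  rw [mem_indices]
  refine ⟨by omega, by simpa using h2⟩

lemma sum_indices {M : Type*} [AddCommMonoid M] (N : ℕ) (f : ℤ → M) :
    ∑ j ∈ indices N, f j = ∑ i ∈ Finset.Icc 1 N, (f i + f (-i)) := by
  have h : indices N = (Finset.Icc 1 N).image (fun i : ℕ => (i : ℤ)) ∪
      (Finset.Icc 1 N).image (fun i : ℕ => -(i : ℤ)) := by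
    ext j
    rw [mem_indices]
    simp only [Finset.mem_union, Finset.mem_image, Finset.mem_Icc]
    constructor
    · rintro ⟨h0, h1⟩
      have h2 := abs_le.1 h1
      rcases lt_or_gt_of_ne h0 with h | h
      · right; exact ⟨j.natAbs, by omega, by omega⟩
      · left; exact ⟨j.natAbs, by omega, by omega⟩
    · rintro (⟨i, hi, rfl⟩ | ⟨i, hi, rfl⟩)
      · exact ⟨by omega, by rw [abs_of_nonneg (by omega)]; omega⟩
      · exact ⟨by omega, by rw [abs_neg, abs_of_nonneg (by omega)]; omega⟩
  rw [h, Finset.sum_union, Finset.sum_image, Finset.sum_image, Finset.sum_add_distrib]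
  · intro a _ b _ hab; simpa using hab
  · intro a _ b _ hab; simpa using hab
  · rw [Finset.disjoint_left]
    simp only [Finset.mem_image, Finset.mem_Icc]
    rintro j ⟨i, hi, rfl⟩ ⟨k, hk, hik⟩
    omega

lemma card_indices (N : ℕ) : (indices N).card = 2 * N := by
  have := sum_indices N (fun _ => 1)
  rw [Finset.sum_const, Finset.sum_const, Nat.card_Icc] at this
  simp at this
  omega

lemma abs_coef_le {N : ℕ} (hN : 1 ≤ N) {i : ℤ} (hi : i ∈ indices N) : |coef N i| ≤ 1 := by
  rw [mem_indices] at hi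
  have hD := two_mul_sub_one_pos hN
  have h1 : (1 : ℝ) ≤ |(i : ℝ)| := by exact_mod_cast Int.one_le_abs hi.1
  have h2 : |(i : ℝ)| ≤ N := by exact_mod_cast hi.2
  have h3 : |((i.sign : ℤ) : ℝ)| = 1 := by
    rcases lt_or_gt_of_ne hi.1 with h | h
    · simp [Int.sign_eq_neg_one_of_neg h]
    · simp [Int.sign_eq_one_of_pos h]
  rw [coef, abs_mul, h3, one_mul, abs_of_nonneg (div_nonneg (by linarith) hD.le), div_le_one hD]
  linarith

lemma coef_pos {N : ℕ} (hN : 1 ≤ N) {i : ℕ} (hi : 1 ≤ i) : 0 < coef N i := by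
  rw [coef_natCast N hi]
  have hD := two_mul_sub_one_pos hN
  have : (1 : ℝ) ≤ i := by exact_mod_cast hi
  exact div_pos (by linarith) hD

lemma coef_lt_coef {N : ℕ} (hN : 1 ≤ N) {i j : ℕ} (hi : 1 ≤ i) (hij : i < j) :
    coef N i < coef N j := by
  rw [coef_natCast N hi, coef_natCast N (by omega)]
  have hD := two_mul_sub_one_pos hN
  have : (i : ℝ) < j := by exact_mod_cast hij
  gcongr

lemma coef_le_coef {N : ℕ} (hN : 1 ≤ N) {i j : ℕ} (hi : 1 ≤ i) (hij : i ≤ j) :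
    coef N i ≤ coef N j := by
  rcases hij.eq_or_lt with rfl | h
  · exact le_rfl
  · exact (coef_lt_coef hN hi h).le

lemma coef_self {N : ℕ} (hN : 1 ≤ N) : coef N N = 1 := by
  rw [coef_natCast N hN, div_self (two_mul_sub_one_pos hN).ne']

lemma coef_injOn {N : ℕ} (hN : 1 ≤ N) {i j : ℤ} (hi : i ∈ indices N) (hj : j ∈ indices N)
    (h : coef N i = coef N j) : i = j := by
  rw [mem_indices] at hi hj
  have key : ∀ m n : ℕ, 1 ≤ m → 1 ≤ n → coef N m = coef N n → m = n := by
    intro m n hm hn hmn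
    rcases lt_trichotomy m n with h | h | h
    · exact absurd hmn (coef_lt_coef hN hm h).ne
    · exact h
    · exact absurd hmn (coef_lt_coef hN hn h).ne'
  obtain ⟨m, rfl | rfl⟩ := Int.eq_nat_or_neg i <;> obtain ⟨n, rfl | rfl⟩ := Int.eq_nat_or_neg j
  · rw [key m n (by omega) (by omega) h]
  · have h1 := coef_pos hN (i := m) (by omega)
    have h2 := coef_pos hN (i := n) (by omega)
    rw [coef_neg] at h
    linarith
  · have h1 := coef_pos hN (i := m) (by omega)
    have h2 := coef_pos hN (i := n) (by omega)
    rw [coef_neg] at h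
    linarith
  · rw [coef_neg, coef_neg, neg_inj] at h
    rw [key m n (by omega) (by omega) h]

/-- The interfaces for `t ∈ [0,T]`, extended to all times by `clamp`, with their regularity. Here
`c'`, `zs`, `zt` are the derivatives of `c` and `z`. -/
structure Family (N : ℕ) (T β C a : ℝ) (c c' : ℝ → ℝ) (z zs zt : ℝ → ℝ → ℝ) : Prop where
  one_le : 1 ≤ N
  T_pos : 0 < T
  a_pos : 0 < a
  a_lt : a < 1
  cont_z : Continuous fun q : ℝ × ℝ => z q.1 (clamp T q.2)
  cont_zs : Continuous fun q : ℝ × ℝ => zs q.1 q.2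
  cont_zt : Continuous fun q : ℝ × ℝ => zt q.1 q.2
  deriv_s : ∀ s t, HasDerivAt (fun s => z s (clamp T t)) (zs s t) s
  deriv_t : ∀ s, ∀ t ∈ Ioo 0 T, HasDerivAt (fun τ => z s τ) (zt s t) t
  deriv_c : ∀ s, HasDerivAt c (c' s) s
  cont_c' : Continuous c'
  c_pos : ∀ s, 0 < c s
  sheet : ∀ j ∈ indices N, ∀ t,
    IsSheet β C a (fun s => iface N c z j s (clamp T t))
      (fun s => zs s t + coef N j * c' s * clamp T t)

/-- The hypotheses on `z` and `c` give a family of interfaces. -/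
lemma exists_family {N : ℕ} (hN : 1 ≤ N) {T : ℝ} (hT : 0 < T)
    {α α' β cmax : ℝ} (hα : 0 < α ∧ α < 1) (hα' : 0 < α' ∧ α' < 1)
    {z ztilde : ℝ → ℝ → ℝ} {c : ℝ → ℝ}
    (hz : ∀ s, ∀ t ∈ Icc 0 T, z s t = β * s + ztilde s t)
    (hztilde : C1InTime 1 α T ztilde)
    (hc : Differentiable ℝ c) (hc' : MemStar 0 α' (deriv c))
    (hcpos : ∀ s, 0 < c s) (hcle : ∀ s, c s ≤ cmax) :
    ∃ C a zs zt, Family N T β C a c (deriv c) z zs zt := by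
  obtain ⟨f', hs, ht, c0, c1, c2, K, hK⟩ := hztilde.exists_fields
  set K' := (starNorm 0 α' (deriv c)).toReal with hK'
  have hK'0 : 0 ≤ K' := ENNReal.toReal_nonneg
  have hK'n : starNorm 0 α' (deriv c) ≤ ENNReal.ofReal K' := (ENNReal.ofReal_toReal hc'.2.ne).ge
  have hv' : ∀ s, (1 + |s| ^ (1 + α')) * |deriv c s| ≤ K' := fun s => by
    simpa using mul_abs_iteratedDeriv_le hK'0 hK'n le_rfl s
  have hh' : ∀ s ξ : ℝ, |ξ| ≤ 1 → |deriv c (s - ξ) - deriv c s| ≤ K' * |ξ| ^ α' := fun s ξ hξ => by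
    simpa using abs_iteratedDeriv_sub_le hK'0 hK'n s ξ hξ
  have hK0 : 0 ≤ K := (hK 0 ⟨le_rfl, hT.le⟩).nonneg
  have hcm : 0 < cmax := (hcpos 0).trans_le (hcle 0)
  have hcc' : Continuous (deriv c) := hc'.1.continuous
  have comp : ∀ {F : ℝ × ℝ → ℝ}, ContinuousOn F (univ ×ˢ Icc 0 T) →
      Continuous fun q : ℝ × ℝ => F (q.1, clamp T q.2) := fun hF =>
    hF.comp_continuous (continuous_fst.prodMk ((continuous_clamp T).comp continuous_snd))
      fun q => ⟨mem_univ _, clamp_mem hT _⟩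
  have hzc : ∀ s t, z s (clamp T t) = β * s + ztilde s (clamp T t) := fun s t =>
    hz s _ (clamp_mem hT t)
  have hds : ∀ s t, HasDerivAt (fun s => z s (clamp T t))
      (β + deriv (fun s => ztilde s (clamp T t)) s) s := by
    intro s t
    simp_rw [hzc]
    exact (((hasDerivAt_id s).const_mul β).congr_deriv (mul_one β)).add (hs _ (clamp_mem hT t) s)
  refine ⟨4 * K + cmax * T + 4 * K' * T, min α α',
    fun s t => β + deriv (fun s => ztilde s (clamp T t)) s, fun s t => f' s (clamp T t), ?_⟩
  have cc1 := comp c1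
  simp only at cc1
  refine ⟨hN, hT, lt_min hα.1 hα'.1, min_lt_of_left_lt hα.2, ?_, continuous_const.add cc1,
    comp c2, hds, ?_, fun s => (hc s).hasDerivAt, hcc', hcpos, ?_⟩
  · simp_rw [hzc]
    exact (continuous_const.mul continuous_fst).add (comp c0)
  · intro s t htm
    have hmem : Icc 0 T ∈ 𝓝 t := Icc_mem_nhds htm.1 htm.2
    have h1 := ((ht t ⟨htm.1.le, htm.2.le⟩ s).hasDerivAt hmem).const_add (β * s)
    rw [clamp_of_mem ⟨htm.1.le, htm.2.le⟩]
    refine h1.congr_of_eventuallyEq ?_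
    filter_upwards [hmem] with τ hτ using hz s τ hτ
  · intro j hj t
    have hcoef := abs_coef_le hN hj
    have htm := clamp_mem hT t
    have hct : ∀ r : ℝ, |coef N j * r * clamp T t| ≤ |r| * T := by
      intro r
      rw [abs_mul, abs_mul, abs_of_nonneg htm.1]
      have h1 : |coef N j| * |r| ≤ 1 * |r| := by gcongr
      have := htm.2
      have := htm.1
      calc |coef N j| * |r| * clamp T t ≤ 1 * |r| * T := by gcongr
        _ = _ := by ring
    refine ⟨fun s => ?_, ?_, fun s => ?_, fun s => ?_, fun s r hsr => ?_⟩
    · exact (hds s t).add (((hc s).hasDerivAt.const_mul (coef N j)).mul_const (clamp T t))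
    · have : Continuous fun s => deriv (fun s => ztilde s (clamp T t)) s :=
        cc1.comp (Continuous.prodMk_left t)
      fun_prop
    · have h1 := (hK _ htm).abs_le s
      have h2 := hct (c s)
      rw [abs_of_pos (hcpos s)] at h2
      have h3 : c s * T ≤ cmax * T := by
        have := hcle s
        gcongr
      have e : iface N c z j s (clamp T t) - β * s =
          ztilde s (clamp T t) + coef N j * c s * clamp T t := by
        rw [iface, hzc, speed_eq]; ring
      rw [e]
      have : 0 ≤ 4 * K' * T := by positivity
      exact (abs_add_le _ _).trans (by linarith)
    · have h1 := abs_le_weight hα.1 hα.2 (min_le_left α α') ((hK _ htm).der s)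
      have h2 := abs_le_weight hα'.1 hα'.2 (min_le_right α α') (hv' s)
      have hw : 0 ≤ (1 + |s|) ^ (-(1 + min α α')) := by positivity
      have e : β + deriv (fun s => ztilde s (clamp T t)) s + coef N j * deriv c s * clamp T t - β =
        deriv (fun s => ztilde s (clamp T t)) s + coef N j * deriv c s * clamp T t := by ring
      rw [e]
      refine (abs_add_le _ _).trans ?_
      have h3 := (hct (deriv c s)).trans (mul_le_mul_of_nonneg_right h2 hT.le)
      have h4 : 0 ≤ cmax * T * (1 + |s|) ^ (-(1 + min α α')) := by positivity
      linarith
    · have hr : r = s - (s - r) := by ring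
      have h1 := (hK _ htm).holder s (s - r) hsr
      have h2 := hh' s (s - r) hsr
      rw [← hr, abs_sub_comm] at h1 h2
      have e : β + deriv (fun s => ztilde s (clamp T t)) s + coef N j * deriv c s * clamp T t -
          (β + deriv (fun s => ztilde s (clamp T t)) r + coef N j * deriv c r * clamp T t) =
        (deriv (fun s => ztilde s (clamp T t)) s - deriv (fun s => ztilde s (clamp T t)) r) +
          coef N j * (deriv c s - deriv c r) * clamp T t := by ring
      rw [e]
      refine (abs_add_le _ _).trans ?_
      have p : ∀ {b : ℝ}, min α α' ≤ b → 0 < b → |s - r| ^ b ≤ |s - r| ^ (min α α') := by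
        intro b hb hb0
        rcases (abs_nonneg (s - r)).eq_or_lt with h0 | h0
        · rw [← h0, Real.zero_rpow hb0.ne', Real.zero_rpow (lt_min hα.1 hα'.1).ne']
        · exact Real.rpow_le_rpow_of_exponent_ge h0 hsr hb
      have p1 := mul_le_mul_of_nonneg_left (p (min_le_left _ _) hα.1) hK0
      have p2 := mul_le_mul_of_nonneg_left (p (min_le_right _ _) hα'.1) hK'0
      have h3 := (hct (deriv c s - deriv c r)).trans
        (mul_le_mul_of_nonneg_right (h2.trans p2) hT.le)
      have hw : 0 ≤ |s - r| ^ (min α α') := by positivity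
      have q1 : 0 ≤ K * |s - r| ^ (min α α') := by positivity
      have q2 : 0 ≤ K' * |s - r| ^ (min α α') * T := by positivity
      have q3 : 0 ≤ cmax * T * |s - r| ^ (min α α') := by positivity
      linarith

end Muskat

/-! ### The velocity and its traces on the interfaces -/

namespace Muskat

/-- The flux of a sheet depends continuously on the point and the slope `k`, off the sheet, and also
at points of the sheet if `k` is the slope of the sheet there. -/
lemma continuousAt_fluxAt {P : Type*} [TopologicalSpace P] [FirstCountableTopology P]
    {β C a : ℝ} {ζ ζ' : P → ℝ → ℝ} {k x y : P → ℝ} {p₀ : P}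
    (ha : 0 < a) (ha1 : a < 1) (hs : ∀ p, IsSheet β C a (ζ p) (ζ' p))
    (hζ : Continuous fun q : P × ℝ => ζ q.1 q.2) (hζ' : Continuous fun q : P × ℝ => ζ' q.1 q.2)
    (hk : ContinuousAt k p₀) (hx : ContinuousAt x p₀) (hy : ContinuousAt y p₀)
    (hp : y p₀ ≠ ζ p₀ (x p₀) ∨ k p₀ = ζ' p₀ (x p₀)) :
    ContinuousAt (fun p => fluxAt (ζ p) (ζ' p) 0 (k p) (x p) (y p)) p₀ := by
  have h1 := continuousAt_norInt ha ha1 hs hζ hζ' (continuousAt_const (y := (0 : ℝ))) hx hy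
  have hζx : ContinuousAt (fun p => ζ' p (x p)) p₀ :=
    ContinuousAt.comp (g := fun q : P × ℝ => ζ' q.1 q.2) (f := fun p => (p, x p))
      hζ'.continuousAt (continuousAt_id.prodMk hx)
  have h2 : ContinuousAt (fun p => (ζ' p (x p) - k p) * tanInt (ζ p) 0 (x p) (y p)) p₀ := by
    by_cases hne : y p₀ = ζ p₀ (x p₀)
    · have h0 : k p₀ = ζ' p₀ (x p₀) := hp.resolve_left (not_not.2 hne)
      have hl : Tendsto (fun p => ζ' p (x p) - k p) (𝓝 p₀) (𝓝 0) := by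
        have := Tendsto.sub hζx hk
        rwa [h0, sub_self] at this
      have : Tendsto (fun p => (ζ' p (x p) - k p) * tanInt (ζ p) 0 (x p) (y p)) (𝓝 p₀) (𝓝 0) :=
        hl.zero_mul_isBoundedUnder_le (isBoundedUnder_of ⟨tanBound β C a, fun p => by
          simpa using (hs p).abs_tanInt_le ha 0 (x p) (y p)⟩)
      rw [ContinuousAt, h0, sub_self, zero_mul]
      exact this
    · refine (hζx.sub hk).mul (continuousAt_tanInt ha hs hζ continuousAt_const hx hy ?_)
      have := sub_ne_zero.2 hne
      positivity
  exact (h1.add h2).const_mul _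

/-- The `j`-th interface at time `t`. -/
noncomputable def graph (N : ℕ) (T : ℝ) (c : ℝ → ℝ) (z : ℝ → ℝ → ℝ) (j : ℤ) (t s : ℝ) : ℝ :=
  iface N c z j s (clamp T t)

/-- The slope of the `j`-th interface at time `t`. -/
noncomputable def slope (N : ℕ) (T : ℝ) (c' : ℝ → ℝ) (zs : ℝ → ℝ → ℝ) (j : ℤ) (t s : ℝ) : ℝ :=
  zs s t + coef N j * c' s * clamp T t

/-- First component of the velocity. -/
noncomputable def u1 (N : ℕ) (T : ℝ) (c : ℝ → ℝ) (z : ℝ → ℝ → ℝ) (t x y : ℝ) : ℝ :=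
  ∑ j ∈ indices N, (1 / (N : ℝ)) * velFst (graph N T c z j t) 0 x y

/-- Second component of the velocity. -/
noncomputable def u2 (N : ℕ) (T : ℝ) (c c' : ℝ → ℝ) (z zs : ℝ → ℝ → ℝ) (t x y : ℝ) : ℝ :=
  ∑ j ∈ indices N, (1 / (N : ℝ)) *
    velSnd (graph N T c z j t) (slope N T c' zs j t) 0 x y

/-- The normal component of the velocity on the `i`-th interface. -/
noncomputable def nu (N : ℕ) (T : ℝ) (c c' : ℝ → ℝ) (z zs : ℝ → ℝ → ℝ) (i : ℤ) (s t : ℝ) : ℝ :=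
  ∑ j ∈ indices N, (1 / (N : ℝ)) *
    fluxAt (graph N T c z j t) (slope N T c' zs j t) 0 (slope N T c' zs i t s) s
      (graph N T c z i t s)

namespace Family

variable {N : ℕ} {T β C a : ℝ} {c c' : ℝ → ℝ} {z zs zt : ℝ → ℝ → ℝ}

lemma N_pos (h : Family N T β C a c c' z zs zt) : (0 : ℝ) < N := by
  exact_mod_cast h.one_le

lemma cont_c (h : Family N T β C a c c' z zs zt) : Continuous c :=
  continuous_iff_continuousAt.2 fun s => (h.deriv_c s).continuousAt

lemma isSheet (h : Family N T β C a c c' z zs zt) {j : ℤ} (hj : j ∈ indices N) (t : ℝ) :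
    IsSheet β C a (graph N T c z j t) (slope N T c' zs j t) := h.sheet j hj t

lemma hasDerivAt_graph (h : Family N T β C a c c' z zs zt) (j : ℤ) (t s : ℝ) :
    HasDerivAt (graph N T c z j t) (slope N T c' zs j t s) s :=
  (h.deriv_s s t).add (((h.deriv_c s).const_mul (coef N j)).mul_const (clamp T t))

lemma continuous_graph (h : Family N T β C a c c' z zs zt) (j : ℤ) :
    Continuous fun q : ℝ × ℝ => graph N T c z j q.1 q.2 := by
  have h1 := h.cont_z.comp continuous_swap
  have h2 := h.cont_c
  have h3 := continuous_clamp T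
  exact h1.add (((h2.comp continuous_snd).const_mul (coef N j)).mul (h3.comp continuous_fst))

lemma continuous_slope (h : Family N T β C a c c' z zs zt) (j : ℤ) :
    Continuous fun q : ℝ × ℝ => slope N T c' zs j q.1 q.2 := by
  have h1 := h.cont_zs.comp continuous_swap
  have h2 := h.cont_c'
  have h3 := continuous_clamp T
  exact h1.add (((h2.comp continuous_snd).const_mul (coef N j)).mul (h3.comp continuous_fst))

lemma graph_of_mem {t : ℝ} (ht : t ∈ Icc 0 T) (j : ℤ) (s : ℝ) :
    graph N T c z j t s = iface N c z j s t := by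
  rw [graph, clamp_of_mem ht]

lemma graph_eq {t : ℝ} (ht : t ∈ Icc 0 T) (j : ℤ) (s : ℝ) :
    graph N T c z j t s = z s t + coef N j * c s * t := by
  rw [graph_of_mem ht, iface, speed_eq]

lemma slope_eq {t : ℝ} (ht : t ∈ Icc 0 T) (j : ℤ) (s : ℝ) :
    slope N T c' zs j t s = zs s t + coef N j * c' s * t := by
  rw [slope, clamp_of_mem ht]

lemma graph_ne (h : Family N T β C a c c' z zs zt) {i j : ℤ} (hi : i ∈ indices N)
    (hj : j ∈ indices N) (hij : i ≠ j) {t : ℝ} (ht : 0 < t) (s : ℝ) :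
    graph N T c z i t s ≠ graph N T c z j t s := by
  intro he
  simp only [graph, iface, speed_eq] at he
  have h1 := h.c_pos s
  have h2 := clamp_pos h.T_pos ht
  have h3 : (coef N i - coef N j) * (c s * clamp T t) = 0 := by linarith
  rcases mul_eq_zero.1 h3 with h4 | h4
  · exact hij (coef_injOn h.one_le hi hj (by linarith))
  · exact (mul_pos h1 h2).ne' h4

lemma velocity_eq (h : Family N T β C a c c' z zs zt) {t : ℝ} (ht : t ∈ Icc 0 T) {x : Plane}
    (hx : x ∈ offInterfaces N c z t) :
    velocity N c z (x, t) = !₂[u1 N T c z t (x 0) (x 1), u2 N T c c' z zs t (x 0) (x 1)] := by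
  refine Tendsto.limUnder_eq ?_
  have key := tendsto_finsetSum (indices N) fun j hj =>
    ((h.isSheet hj t).tendsto_sheetVelocity h.a_pos (x := x)
      (by rw [graph_of_mem ht]; exact hx j hj)).const_smul (1 / (N : ℝ))
  have e : (∑ j ∈ indices N, (1 / (N : ℝ)) •
      (!₂[velFst (graph N T c z j t) 0 (x 0) (x 1),
        velSnd (graph N T c z j t) (slope N T c' zs j t) 0 (x 0) (x 1)] : Plane)) =
      !₂[u1 N T c z t (x 0) (x 1), u2 N T c c' z zs t (x 0) (x 1)] := by
    ext i
    fin_cases i <;> simp [u1, u2]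
  rw [e] at key
  refine key.congr fun R => Finset.sum_congr rfl fun j _ => ?_
  have : graph N T c z j t = fun s => iface N c z j s t := funext (graph_of_mem ht j)
  rw [this]

lemma abs_u1_le (h : Family N T β C a c c' z zs zt) (t x y : ℝ) :
    |u1 N T c z t x y| ≤ 2 * IsSheet.velBound β C a := by
  have hN := h.N_pos
  refine (Finset.abs_sum_le_sum_abs _ _).trans ((Finset.sum_le_card_nsmul _ _
    (1 / N * IsSheet.velBound β C a) fun j hj => ?_).trans_eq ?_)
  · rw [abs_mul, abs_of_pos (by positivity : (0 : ℝ) < 1 / N)]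
    have := (h.isSheet hj t).abs_velFst_le h.a_pos 0 x y
    gcongr
  · rw [card_indices]
    push_cast [nsmul_eq_mul]
    field_simp

lemma abs_u2_le (h : Family N T β C a c c' z zs zt) (t x y : ℝ) :
    |u2 N T c c' z zs t x y| ≤ 2 * IsSheet.velBound β C a := by
  have hN := h.N_pos
  refine (Finset.abs_sum_le_sum_abs _ _).trans ((Finset.sum_le_card_nsmul _ _
    (1 / N * IsSheet.velBound β C a) fun j hj => ?_).trans_eq ?_)
  · rw [abs_mul, abs_of_pos (by positivity : (0 : ℝ) < 1 / N)]
    have := (h.isSheet hj t).abs_velSnd_le h.a_pos 0 x y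
    gcongr
  · rw [card_indices]
    push_cast [nsmul_eq_mul]
    field_simp

/-- The combination `u₂ - k u₁` is continuous off the interfaces, and on the interface `i` if `k` is
its slope. -/
lemma continuousAt_flux (h : Family N T β C a c c' z zs zt) {P : Type*} [TopologicalSpace P]
    [FirstCountableTopology P] {k t x y : P → ℝ} {p₀ : P} (hk : ContinuousAt k p₀)
    (ht : Continuous t) (hx : ContinuousAt x p₀) (hy : ContinuousAt y p₀)
    (hp : ∀ j ∈ indices N, y p₀ ≠ graph N T c z j (t p₀) (x p₀) ∨
      k p₀ = slope N T c' zs j (t p₀) (x p₀)) :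
    ContinuousAt (fun p => ∑ j ∈ indices N, (1 / (N : ℝ)) *
      fluxAt (graph N T c z j (t p)) (slope N T c' zs j (t p)) 0 (k p) (x p) (y p)) p₀ := by
  refine tendsto_finsetSum _ fun j hj => Tendsto.const_mul _ ?_
  have m : Continuous fun q : P × ℝ => (t q.1, q.2) :=
    (ht.comp continuous_fst).prodMk continuous_snd
  exact continuousAt_fluxAt (ζ := fun p => graph N T c z j (t p))
    (ζ' := fun p => slope N T c' zs j (t p)) h.a_pos h.a_lt (fun p => h.isSheet hj (t p))
    ((h.continuous_graph j).comp m) ((h.continuous_slope j).comp m) hk hx hy (hp j hj)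

lemma sum_fluxAt (k t x y : ℝ) :
    ∑ j ∈ indices N, (1 / (N : ℝ)) *
      fluxAt (graph N T c z j t) (slope N T c' zs j t) 0 k x y =
    -k * u1 N T c z t x y + u2 N T c c' z zs t x y := by
  rw [u1, u2, Finset.mul_sum, ← Finset.sum_add_distrib]
  refine Finset.sum_congr rfl fun j _ => ?_
  rw [fluxAt_eq]; ring

lemma continuousAt_u2 (h : Family N T β C a c c' z zs zt) {p₀ : Plane × ℝ}
    (hp : ∀ j ∈ indices N, p₀.1 1 ≠ graph N T c z j p₀.2 (p₀.1 0)) :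
    ContinuousAt (fun p : Plane × ℝ => u2 N T c c' z zs p.2 (p.1 0) (p.1 1)) p₀ := by
  have key := h.continuousAt_flux (P := Plane × ℝ) (k := fun _ => 0) (t := fun p => p.2)
    (x := fun p => p.1 0) (y := fun p => p.1 1) (p₀ := p₀) continuousAt_const continuous_snd
    (by fun_prop) (by fun_prop) fun j hj => Or.inl (hp j hj)
  simpa only [sum_fluxAt, neg_zero, zero_mul, zero_add] using key

lemma continuousAt_u1 (h : Family N T β C a c c' z zs zt) {p₀ : Plane × ℝ}
    (hp : ∀ j ∈ indices N, p₀.1 1 ≠ graph N T c z j p₀.2 (p₀.1 0)) :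
    ContinuousAt (fun p : Plane × ℝ => u1 N T c z p.2 (p.1 0) (p.1 1)) p₀ := by
  have key := h.continuousAt_flux (P := Plane × ℝ) (k := fun _ => 1) (t := fun p => p.2)
    (x := fun p => p.1 0) (y := fun p => p.1 1) (p₀ := p₀) continuousAt_const continuous_snd
    (by fun_prop) (by fun_prop) fun j hj => Or.inl (hp j hj)
  simp only [sum_fluxAt] at key
  have := (h.continuousAt_u2 hp).sub key
  refine this.congr (Eventually.of_forall fun p => ?_)
  simp only [Pi.sub_apply]
  ring

lemma continuousAt_nu (h : Family N T β C a c c' z zs zt) {i : ℤ} (hi : i ∈ indices N)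
    {s t : ℝ} (ht : 0 < t) :
    ContinuousAt (fun q : ℝ × ℝ => nu N T c c' z zs i q.1 q.2) (s, t) := by
  have hsw : Continuous fun q : ℝ × ℝ => (q.2, q.1) := continuous_swap
  refine h.continuousAt_flux (P := ℝ × ℝ) (t := fun q => q.2) (x := fun q => q.1)
    (k := fun q => slope N T c' zs i q.2 q.1) (y := fun q => graph N T c z i q.2 q.1)
    ((h.continuous_slope i).comp hsw).continuousAt continuous_snd continuousAt_fst
    ((h.continuous_graph i).comp hsw).continuousAt fun j hj => ?_
  by_cases hij : i = j
  · right; rw [hij]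
  · left; exact h.graph_ne hi hj hij ht s

lemma neBot_nhdsWithin_offInterfaces (s y t : ℝ) :
    (𝓝[offInterfaces N c z t] (!₂[s, y] : Plane)).NeBot := by
  have hfin : (((indices N).image fun j => iface N c z j s t : Finset ℝ) : Set ℝ).Finite :=
    Finset.finite_toSet _
  have hn : ∀ᶠ w in 𝓝[≠] y,
      w ∉ (((indices N).image fun j => iface N c z j s t : Finset ℝ) : Set ℝ) := by
    have h1 : ((((indices N).image fun j => iface N c z j s t : Finset ℝ) : Set ℝ) \ {y})ᶜ ∈ 𝓝 y :=
      (hfin.subset sdiff_subset).isClosed.isOpen_compl.mem_nhds fun hm => hm.2 rfl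
    filter_upwards [nhdsWithin_le_nhds h1, self_mem_nhdsWithin] with w hw hwy hm
    exact hw ⟨hm, hwy⟩
  have hc : Tendsto (fun w : ℝ => (!₂[s, w] : Plane)) (𝓝[≠] y)
      (𝓝[offInterfaces N c z t] (!₂[s, y] : Plane)) := by
    refine tendsto_nhdsWithin_iff.2 ⟨Plane.tendsto_mk tendsto_const_nhds
      (tendsto_id.mono_left nhdsWithin_le_nhds), ?_⟩
    filter_upwards [hn] with w hw j hj
    intro he
    refine hw ?_
    simp only [Finset.coe_image, mem_image, Finset.mem_coe]
    exact ⟨j, hj, by simpa using he.symm⟩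
  exact hc.neBot

/-- The trace of the normal component of the velocity on the interface exists and is `nu`. -/
lemma normalVelocity_eq (h : Family N T β C a c c' z zs zt) {i : ℤ} (hi : i ∈ indices N)
    {s t : ℝ} (ht0 : 0 < t) (htT : t ≤ T) :
    normalVelocity N c z i s t = nu N T c c' z zs i s t := by
  have ht : t ∈ Icc 0 T := ⟨ht0.le, htT⟩
  have hd : deriv (fun s' => iface N c z i s' t) s = slope N T c' zs i t s := by
    have := (h.hasDerivAt_graph i t s).deriv
    rwa [show graph N T c z i t = fun s' => iface N c z i s' t from funext (graph_of_mem ht i)]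
      at this
  have := neBot_nhdsWithin_offInterfaces (N := N) (c := c) (z := z) s (iface N c z i s t) t
  refine Tendsto.limUnder_eq ?_
  have key := h.continuousAt_flux (P := Plane) (t := fun _ => t) (x := fun x => x 0)
    (k := fun _ => slope N T c' zs i t s) (y := fun x => x 1) (p₀ := !₂[s, iface N c z i s t])
    continuousAt_const continuous_const (by fun_prop) (by fun_prop) fun j hj => by
      by_cases hij : i = j
      · right; simp [hij]
      · left
        rw [← graph_of_mem ht]
        simpa using h.graph_ne hi hj hij ht0 s
  have k2 := key.tendsto.mono_left
    (nhdsWithin_le_nhds (s := offInterfaces N c z t))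
  have e : nu N T c c' z zs i s t = ∑ j ∈ indices N, (1 / (N : ℝ)) *
      fluxAt (graph N T c z j t) (slope N T c' zs j t) 0 (slope N T c' zs i t s)
        ((!₂[s, iface N c z i s t] : Plane) 0) ((!₂[s, iface N c z i s t] : Plane) 1) := by
    simp [nu, graph_of_mem ht]
  rw [e]
  refine k2.congr' ?_
  filter_upwards [self_mem_nhdsWithin] with x hx
  rw [sum_fluxAt, h.velocity_eq ht hx, hd]
  simp

end Family

end Muskat

/-! ### Layers of the mixing zone and the density -/

namespace Muskat

/-- A decreasing property of `{1, …, N}` holds exactly up to some `k ≤ N`. -/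
lemma exists_count (p : ℕ → Prop) (hp : ∀ i j, 1 ≤ i → i ≤ j → p j → p i) (N : ℕ) :
    ∃ k ≤ N, ∀ i ∈ Finset.Icc 1 N, (p i ↔ i ≤ k) := by
  induction N with
  | zero => exact ⟨0, le_rfl, fun i hi => by simp at hi⟩
  | succ N ih =>
    obtain ⟨k, hk, h⟩ := ih
    by_cases hN : p (N + 1)
    · refine ⟨N + 1, le_rfl, fun i hi => ?_⟩
      rw [Finset.mem_Icc] at hi
      exact ⟨fun _ => hi.2, fun _ => hp i _ hi.1 hi.2 hN⟩
    · refine ⟨k, by omega, fun i hi => ?_⟩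
      rw [Finset.mem_Icc] at hi
      rcases hi.2.eq_or_lt with rfl | h'
      · exact ⟨fun h => absurd h hN, fun h => by omega⟩
      · exact h i (Finset.mem_Icc.2 ⟨hi.1, by omega⟩)

/-- The point `(x, y)` lies above exactly `k` of the upper interfaces and below exactly `l` of the
lower ones. -/
structure InLayer (N : ℕ) (T : ℝ) (c : ℝ → ℝ) (z : ℝ → ℝ → ℝ) (t x y : ℝ) (k l : ℕ) : Prop where
  k_le : k ≤ N
  l_le : l ≤ N
  eq_zero : k = 0 ∨ l = 0
  upper : ∀ i ∈ Finset.Icc 1 N, (graph N T c z i t x < y ↔ i ≤ k)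
  lower : ∀ i ∈ Finset.Icc 1 N, (graph N T c z (-i) t x < y ↔ l < i)

/-- The piecewise constant function that jumps by `1 / N` across every interface, starting from `-1`
at the bottom. -/
noncomputable def stepDensity (N : ℕ) (T : ℝ) (c : ℝ → ℝ) (z : ℝ → ℝ → ℝ) (t : ℝ) (q : ℝ × ℝ) : ℝ :=
  -1 + ∑ j ∈ indices N, (above (graph N T c z j t)).indicator (fun _ => 1 / (N : ℝ)) q

namespace Family

variable {N : ℕ} {T β C a : ℝ} {c c' : ℝ → ℝ} {z zs zt : ℝ → ℝ → ℝ}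

/-- Off the interfaces, every point lies in a layer, which is determined by counting interfaces. -/
lemma exists_inLayer (h : Family N T β C a c c' z zs zt) {t x y : ℝ} (ht0 : 0 < t) (ht : t ≤ T)
    (hoff : ∀ j ∈ indices N, y ≠ graph N T c z j t x) :
    ∃ k l, InLayer N T c z t x y k l := by
  have htm : t ∈ Icc 0 T := ⟨ht0.le, ht⟩
  have hct : 0 < c x * t := mul_pos (h.c_pos x) ht0
  have mono : ∀ i j : ℕ, 1 ≤ i → i ≤ j → coef N i * c x * t ≤ coef N j * c x * t := by
    intro i j hi hij
    rw [mul_assoc, mul_assoc]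
    exact mul_le_mul_of_nonneg_right (coef_le_coef h.one_le hi hij) hct.le
  obtain ⟨k, hk, hk'⟩ := exists_count (fun i => coef N i * c x * t < y - z x t)
    (fun i j hi hij hj => (mono i j hi hij).trans_lt hj) N
  obtain ⟨l, hl, hl'⟩ := exists_count (fun i => coef N i * c x * t < -(y - z x t))
    (fun i j hi hij hj => (mono i j hi hij).trans_lt hj) N
  refine ⟨k, l, hk, hl, ?_, fun i hi => ?_, fun i hi => ?_⟩
  · by_contra hne
    push Not at hne
    have h1 := (hk' 1 (Finset.mem_Icc.2 ⟨le_rfl, h.one_le⟩)).2 (by omega)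
    have h2 := (hl' 1 (Finset.mem_Icc.2 ⟨le_rfl, h.one_le⟩)).2 (by omega)
    have h3 := mul_pos (coef_pos h.one_le (le_refl 1)) hct
    rw [mul_assoc] at h1 h2
    linarith
  · rw [← hk' i hi, graph_eq htm]
    constructor <;> intro <;> linarith
  · have h1 := hl' i hi
    rw [Finset.mem_Icc] at hi
    have h2 := hoff (-i) (neg_mem_indices (natCast_mem_indices hi.1 hi.2))
    rw [graph_eq htm, coef_neg] at h2 ⊢
    rw [← not_le (a := i), ← h1]
    constructor
    · intro h3 h4; linarith
    · intro h3
      exact lt_of_le_of_ne (by linarith) (Ne.symm h2)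

variable {t x y : ℝ} {k l : ℕ}

lemma sum_upper (hL : InLayer N T c z t x y k l) (f : ℤ → ℝ × ℝ → ℝ) :
    ∑ i ∈ Finset.Icc 1 N, (above (graph N T c z i t)).indicator (f i) (x, y) =
      ∑ i ∈ Finset.Icc 1 k, f i (x, y) := by
  have : Finset.Icc 1 k = (Finset.Icc 1 N).filter (fun i => i ≤ k) := by
    ext i; have := hL.k_le; simp only [Finset.mem_Icc, Finset.mem_filter]; omega
  rw [this, Finset.sum_filter]
  refine Finset.sum_congr rfl fun i hi => ?_
  classical
  rw [indicator_apply]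
  exact if_congr (hL.upper i hi) rfl rfl

lemma sum_lower (hL : InLayer N T c z t x y k l) (f : ℤ → ℝ × ℝ → ℝ) :
    ∑ i ∈ Finset.Icc 1 N, (above (graph N T c z (-i) t)).indicator (f (-i)) (x, y) =
      ∑ i ∈ Finset.Icc (l + 1) N, f (-i) (x, y) := by
  have : Finset.Icc (l + 1) N = (Finset.Icc 1 N).filter (fun i => l < i) := by
    ext i; simp only [Finset.mem_Icc, Finset.mem_filter]; omega
  rw [this, Finset.sum_filter]
  refine Finset.sum_congr rfl fun i hi => ?_
  classical
  rw [indicator_apply]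
  exact if_congr (hL.lower i hi) rfl rfl

/-- In the layer `(k, l)`, the point lies above the upper interfaces `1, …, k` and the lower
interfaces `-(l + 1), …, -N`. -/
lemma sum_indicator (hL : InLayer N T c z t x y k l) (f : ℤ → ℝ × ℝ → ℝ) :
    ∑ j ∈ indices N, (above (graph N T c z j t)).indicator (f j) (x, y) =
      ∑ i ∈ Finset.Icc 1 k, f i (x, y) + ∑ i ∈ Finset.Icc (l + 1) N, f (-i) (x, y) := by
  rw [sum_indices, Finset.sum_add_distrib, sum_upper hL, sum_lower hL]

lemma density_mk (N : ℕ) (c : ℝ → ℝ) (z : ℝ → ℝ → ℝ) (x y t : ℝ) :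
    density N c z (!₂[x, y], t) =
      if z x t + c x * t < y then 1
      else if y < z x t - c x * t then -1
      else ∑ i ∈ Finset.Icc 1 (N - 1),
        ((if speed N c i x * t < y - z x t ∧ y - z x t < speed N c (i + 1) x * t
            then (i : ℝ) / N else 0) +
         (if speed N c i x * t < z x t - y ∧ z x t - y < speed N c (i + 1) x * t
            then -((i : ℝ) / N) else 0)) := rfl

/-- The density in the layer `(k, l)` is `(k - l) / N`. -/
lemma density_eq (h : Family N T β C a c c' z zs zt) (ht0 : 0 < t) (ht : t ≤ T)
    (hoff : ∀ j ∈ indices N, y ≠ graph N T c z j t x) (hL : InLayer N T c z t x y k l) :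
    density N c z (!₂[x, y], t) = ((k : ℝ) - l) / N := by
  have htm : t ∈ Icc 0 T := ⟨ht0.le, ht⟩
  have hN1 := h.one_le
  have hN := h.N_pos
  have hNm : N ∈ Finset.Icc 1 N := Finset.mem_Icc.2 ⟨hN1, le_rfl⟩
  have uN := hL.upper N hNm
  have lN := hL.lower N hNm
  have oN := hoff (-N) (neg_mem_indices (natCast_mem_indices hN1 le_rfl))
  rw [graph_eq htm, coef_self hN1, one_mul] at uN
  rw [graph_eq htm, coef_neg, coef_self hN1, neg_one_mul, neg_mul, ← sub_eq_add_neg] at lN oN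
  have hkl := hL.eq_zero
  have hk := hL.k_le
  have hl := hL.l_le
  rw [density_mk]
  by_cases c1 : z x t + c x * t < y
  · rw [if_pos c1]
    have e1 : k = N := le_antisymm hk (uN.1 c1)
    have e2 : l = 0 := by omega
    rw [e1, e2]
    field_simp
    simp
  rw [if_neg c1]
  by_cases c2 : y < z x t - c x * t
  · rw [if_pos c2]
    have e1 : l = N := by
      by_contra hne
      exact lt_asymm c2 (lN.2 (by omega))
    have e2 : k = 0 := by omega
    rw [e1, e2]
    field_simp
    simp
  rw [if_neg c2]
  have hkN : k < N := by
    by_contra hge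
    exact c1 (uN.2 (by omega))
  have hlN : l < N := lN.1 (lt_of_le_of_ne (not_lt.1 c2) (Ne.symm oN))
  have key : ∀ i ∈ Finset.Icc 1 (N - 1),
      ((if speed N c i x * t < y - z x t ∧ y - z x t < speed N c (i + 1) x * t
          then (i : ℝ) / N else 0) +
       (if speed N c i x * t < z x t - y ∧ z x t - y < speed N c (i + 1) x * t
          then -((i : ℝ) / N) else 0)) =
      (if i = k then (i : ℝ) / N else 0) + (if i = l then -((i : ℝ) / N) else 0) := by
    intro i hi
    rw [Finset.mem_Icc] at hi
    have m1 : i ∈ Finset.Icc 1 N := Finset.mem_Icc.2 (by omega)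
    have m2 : i + 1 ∈ Finset.Icc 1 N := Finset.mem_Icc.2 (by omega)
    have u1 := hL.upper i m1
    have u2 := hL.upper (i + 1) m2
    have l1 := hL.lower i m1
    have l2 := hL.lower (i + 1) m2
    have o1 := hoff (i + 1 : ℕ) (natCast_mem_indices (by omega) (by omega))
    have o2 := hoff (-i) (neg_mem_indices (natCast_mem_indices (by omega) (by omega)))
    rw [graph_eq htm] at u1 u2 l1 l2 o1 o2
    rw [coef_neg] at l1 l2 o2
    push_cast at u2 l2 o1
    rw [speed_eq, speed_eq]
    congr 1
    · refine if_congr ?_ rfl rfl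
      constructor
      · rintro ⟨p1, p2⟩
        have q1 := u1.1 (by linarith)
        have q2 : ¬ (i + 1 ≤ k) := fun hh => by
          have := u2.2 hh
          linarith
        omega
      · rintro rfl
        have q1 := u1.2 le_rfl
        have q2 : ¬ (z x t + coef N (i + 1) * c x * t < y) := fun hh => by
          have := u2.1 hh
          omega
        refine ⟨by linarith, ?_⟩
        have := lt_of_le_of_ne (not_lt.1 q2) o1
        linarith
    · refine if_congr ?_ rfl rfl
      constructor
      · rintro ⟨p1, p2⟩
        have q1 : ¬ (l < i) := fun hh => by
          have := l1.2 hh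
          linarith
        have q2 := l2.1 (by linarith)
        omega
      · rintro rfl
        have q1 : ¬ (z x t + -coef N i * c x * t < y) := fun hh => by
          have := l1.1 hh
          omega
        have q2 := l2.2 (by omega)
        have := lt_of_le_of_ne (not_lt.1 q1) o2
        constructor <;> linarith
  rw [Finset.sum_congr rfl key, Finset.sum_add_distrib, Finset.sum_ite_eq', Finset.sum_ite_eq']
  simp only [Finset.mem_Icc]
  rcases Nat.eq_zero_or_pos k with rfl | k0 <;> rcases Nat.eq_zero_or_pos l with rfl | l0
  · simp
  · have : 1 ≤ l ∧ l ≤ N - 1 := by omega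
    simp [this, neg_div]
  · have : 1 ≤ k ∧ k ≤ N - 1 := by omega
    simp [this]
  · omega

lemma density_eq_step (h : Family N T β C a c c' z zs zt) (ht0 : 0 < t) (ht : t ≤ T)
    (hoff : ∀ j ∈ indices N, y ≠ graph N T c z j t x) :
    density N c z (!₂[x, y], t) = stepDensity N T c z t (x, y) := by
  obtain ⟨k, l, hL⟩ := h.exists_inLayer ht0 ht hoff
  rw [h.density_eq ht0 ht hoff hL, stepDensity, sum_indicator hL fun _ _ => 1 / (N : ℝ)]
  have hN := h.N_pos
  have hl : (l : ℝ) ≤ N := by exact_mod_cast hL.l_le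
  simp only [Finset.sum_const, Nat.card_Icc, nsmul_eq_mul]
  have e : N + 1 - (l + 1) = N - l := by omega
  rw [e, Nat.cast_sub hL.l_le]
  field_simp
  simp
  ring

end Family

/-! ### Measure and topology of the domains -/

lemma measurePreserving_mk :
    MeasurePreserving (fun q : ℝ × ℝ => (!₂[q.1, q.2] : Plane)) :=
  ((volume_preserving_finTwoArrow ℝ).symm _).trans
    (EuclideanSpace.volume_preserving_symm_measurableEquiv_toLp (Fin 2)).symm

end Muskat

namespace Muskat

lemma Plane.eta (x : Plane) : (!₂[x 0, x 1] : Plane) = x := by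
  ext i
  fin_cases i <;> rfl

/-- The complement of the interfaces in space-time. -/
def offAll (N : ℕ) (T : ℝ) (c : ℝ → ℝ) (z : ℝ → ℝ → ℝ) : Set (Plane × ℝ) :=
  {p | ∀ j ∈ indices N, p.1 1 ≠ graph N T c z j p.2 (p.1 0)}

lemma integral_plane (f : Plane → ℝ) : ∫ x, f x = ∫ q : ℝ × ℝ, f !₂[q.1, q.2] :=
  (measurePreserving_mk.integral_comp' (f := (MeasurableEquiv.finTwoArrow.symm.trans
    (MeasurableEquiv.toLp 2 (Fin 2 → ℝ)))) f).symm

lemma slab_eq (T : ℝ) : slab T = univ ×ˢ Ico 0 T := by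
  ext p; simp [slab]

/-- The integral over the slab as an iterated integral. -/
lemma integral_slab {T : ℝ} {f : Plane × ℝ → ℝ} (hf : IntegrableOn f (slab T)) :
    ∫ p in slab T, f p = ∫ t in Ioo 0 T, ∫ q : ℝ × ℝ, f (!₂[q.1, q.2], t) := by
  rw [slab_eq, IntegrableOn, Measure.volume_eq_prod, ← Measure.prod_restrict,
    Measure.restrict_univ] at hf
  rw [slab_eq, Measure.volume_eq_prod, ← Measure.prod_restrict, Measure.restrict_univ,
    integral_prod_symm _ hf, setIntegral_congr_set Ioo_ae_eq_Ico.symm]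
  exact integral_congr_ae (Eventually.of_forall fun t => integral_plane fun x => f (x, t))

lemma measurableSet_slab (T : ℝ) : MeasurableSet (slab T) := by
  rw [slab_eq]; exact MeasurableSet.univ.prod measurableSet_Ico

/-- The initial time slice is a null set. -/
lemma ae_slab_pos (T : ℝ) : ∀ᵐ p : Plane × ℝ ∂(volume.restrict (slab T)), 0 < p.2 ∧ p.2 < T := by
  have h0 : ∀ᵐ p : Plane × ℝ, p.2 ≠ 0 := by
    have : {p : Plane × ℝ | ¬ p.2 ≠ 0} = univ ×ˢ {0} := by ext p; simp
    rw [ae_iff, this, Measure.volume_eq_prod, Measure.prod_prod]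
    simp
  rw [ae_restrict_iff' (measurableSet_slab T)]
  filter_upwards [h0] with p hp hps
  exact ⟨lt_of_le_of_ne hps.1 hp.symm, hps.2⟩

namespace Family

variable {N : ℕ} {T β C a : ℝ} {c c' : ℝ → ℝ} {z zs zt : ℝ → ℝ → ℝ}

lemma continuous_graph_plane (h : Family N T β C a c c' z zs zt) (j : ℤ) :
    Continuous fun p : Plane × ℝ => graph N T c z j p.2 (p.1 0) :=
  (h.continuous_graph j).comp (f := fun p : Plane × ℝ => (p.2, p.1 0)) (by fun_prop)

lemma isOpen_offAll (h : Family N T β C a c c' z zs zt) : IsOpen (offAll N T c z) := by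
  have : offAll N T c z =
      ⋂ j ∈ indices N, {p : Plane × ℝ | p.1 1 ≠ graph N T c z j p.2 (p.1 0)} := by
    ext p; simp [offAll]
  rw [this]
  refine isOpen_biInter_finset fun j _ => ?_
  exact isOpen_ne_fun (by fun_prop) (h.continuous_graph_plane j)

lemma ae_offAll (h : Family N T β C a c c' z zs zt) : ∀ᵐ p : Plane × ℝ, p ∈ offAll N T c z := by
  have : ∀ j ∈ indices N, ∀ᵐ p : Plane × ℝ, p.1 1 ≠ graph N T c z j p.2 (p.1 0) := by
    intro j _
    have hm : MeasurableSet {p : Plane × ℝ | ¬ p.1 1 ≠ graph N T c z j p.2 (p.1 0)} := by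
      simp only [ne_eq, not_not]
      exact (isClosed_eq (by fun_prop) (h.continuous_graph_plane j)).measurableSet
    rw [ae_iff, Measure.volume_eq_prod, Measure.prod_apply_symm hm, lintegral_eq_zero_iff'
      (measurable_measure_prodMk_right hm).aemeasurable]
    refine Eventually.of_forall fun t => ?_
    have hc : Continuous (graph N T c z j t) :=
      (h.continuous_graph j).comp (Continuous.prodMk_right t)
    have hm2 : MeasurableSet {x : Plane | x 1 = graph N T c z j t (x 0)} :=
      (isClosed_eq (by fun_prop) (hc.comp (by fun_prop))).measurableSet
    have := measurePreserving_mk.measure_preimage hm2.nullMeasurableSet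
    simp only [ne_eq, not_not, Pi.zero_apply]
    refine Eq.trans this.symm ?_
    simpa using volume_graph_eq_zero hc
  filter_upwards [(Finset.eventually_all (indices N)).2 this] with p hp using hp

/-- At every time, almost every point is off the interfaces. -/
lemma ae_off (h : Family N T β C a c c' z zs zt) (t : ℝ) :
    ∀ᵐ q : ℝ × ℝ, ∀ j ∈ indices N, q.2 ≠ graph N T c z j t q.1 :=
  (Finset.eventually_all (indices N)).2 fun j _ =>
    ae_off_graph ((h.continuous_graph j).comp (Continuous.prodMk_right t))

variable {T' : ℝ}

lemma graph_self (h : Family N T β C a c c' z zs zt) {t : ℝ} (ht : t ∈ Icc 0 T) (s : ℝ) :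
    graph N T c z N t s = z s t + c s * t := by
  rw [graph_eq ht, coef_self h.one_le, one_mul]

lemma graph_neg_self (h : Family N T β C a c c' z zs zt) {t : ℝ} (ht : t ∈ Icc 0 T) (s : ℝ) :
    graph N T c z (-N) t s = z s t - c s * t := by
  rw [graph_eq ht, coef_neg, coef_self h.one_le, neg_one_mul, neg_mul, ← sub_eq_add_neg]

lemma omegaPlus_eq (h : Family N T β C a c c' z zs zt) (hT' : T' ≤ T) :
    omegaPlus c z T' = {p | 0 < p.2 ∧ p.2 < T' ∧ graph N T c z N p.2 (p.1 0) < p.1 1} := by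
  ext p
  refine and_congr_right fun h1 => and_congr_right fun h2 => ?_
  rw [h.graph_self ⟨h1.le, (h2.trans_le hT').le⟩]

lemma omegaMinus_eq (h : Family N T β C a c c' z zs zt) (hT' : T' ≤ T) :
    omegaMinus c z T' = {p | 0 < p.2 ∧ p.2 < T' ∧ p.1 1 < graph N T c z (-N) p.2 (p.1 0)} := by
  ext p
  refine and_congr_right fun h1 => and_congr_right fun h2 => ?_
  rw [h.graph_neg_self ⟨h1.le, (h2.trans_le hT').le⟩]

lemma omegaMix_eq (h : Family N T β C a c c' z zs zt) (hT' : T' ≤ T) :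
    omegaMix c z T' = {p | 0 < p.2 ∧ p.2 < T' ∧ graph N T c z (-N) p.2 (p.1 0) < p.1 1 ∧
      p.1 1 < graph N T c z N p.2 (p.1 0)} := by
  ext p
  refine and_congr_right fun h1 => and_congr_right fun h2 => ?_
  rw [h.graph_neg_self ⟨h1.le, (h2.trans_le hT').le⟩, h.graph_self ⟨h1.le, (h2.trans_le hT').le⟩]

lemma interfaces_eq (hT' : T' ≤ T) :
    interfaces N c z T' = slab T' ∩ (offAll N T c z)ᶜ := by
  ext p
  simp only [interfaces, slab, offAll, mem_ofPred_eq, mem_inter_iff, mem_compl_iff, not_forall,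
    not_not, exists_prop, and_assoc]
  refine and_congr_right fun h1 => and_congr_right fun h2 => ?_
  simp only [graph_of_mem (N := N) (c := c) (z := z) ⟨h1, (h2.trans_le hT').le⟩]

lemma volume_interfaces (h : Family N T β C a c c' z zs zt) (hT' : T' ≤ T) :
    volume (interfaces N c z T') = 0 := by
  rw [interfaces_eq hT']
  exact measure_mono_null inter_subset_right (ae_iff.1 h.ae_offAll)

lemma isOpen_omegaPlus (h : Family N T β C a c c' z zs zt) (hT' : T' ≤ T) :
    IsOpen (omegaPlus c z T') := by
  rw [h.omegaPlus_eq hT']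
  exact (isOpen_lt continuous_const continuous_snd).inter ((isOpen_lt continuous_snd
    continuous_const).inter (isOpen_lt (h.continuous_graph_plane _) (by fun_prop)))

lemma isOpen_omegaMinus (h : Family N T β C a c c' z zs zt) (hT' : T' ≤ T) :
    IsOpen (omegaMinus c z T') := by
  rw [h.omegaMinus_eq hT']
  exact (isOpen_lt continuous_const continuous_snd).inter ((isOpen_lt continuous_snd
    continuous_const).inter (isOpen_lt (by fun_prop) (h.continuous_graph_plane _)))

lemma isOpen_omegaMix (h : Family N T β C a c c' z zs zt) (hT' : T' ≤ T) :
    IsOpen (omegaMix c z T') := by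
  rw [h.omegaMix_eq hT']
  exact (isOpen_lt continuous_const continuous_snd).inter ((isOpen_lt continuous_snd
    continuous_const).inter ((isOpen_lt (h.continuous_graph_plane _) (by fun_prop)).inter
      (isOpen_lt (by fun_prop) (h.continuous_graph_plane _))))

lemma omegaMix_diff (hT' : T' ≤ T) :
    omegaMix c z T' \ interfaces N c z T' = omegaMix c z T' ∩ offAll N T c z := by
  ext p
  rw [interfaces_eq hT']
  simp only [Set.mem_sdiff, mem_inter_iff, mem_compl_iff, not_and, not_not]
  exact and_congr_right fun hp => ⟨fun hh => hh ⟨hp.1.le, hp.2.1⟩, fun hh _ => hh⟩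

/-- The domains are images of convex sets under maps that straighten the interfaces. -/
lemma isConnected_image {F : ℝ × ℝ × ℝ → Plane × ℝ} (hF : Continuous F) (hT' : 0 < T')
    {S : Set ℝ} (hS : Convex ℝ S) (hne : S.Nonempty) {Ω : Set (Plane × ℝ)}
    (hΩ : Ω = F '' (univ ×ˢ Ioo 0 T' ×ˢ S)) : IsConnected Ω := by
  rw [hΩ]
  refine IsConnected.image ?_ _ hF.continuousOn
  exact ((convex_univ.prod ((convex_Ioo 0 T').prod hS))).isConnected
    (univ_nonempty.prod ((nonempty_Ioo.2 hT').prod hne))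

lemma isConnected_omegaPlus (h : Family N T β C a c c' z zs zt) (hT'0 : 0 < T') (hT' : T' ≤ T) :
    IsConnected (omegaPlus c z T') := by
  rw [h.omegaPlus_eq hT']
  have hg : Continuous fun q : ℝ × ℝ × ℝ => graph N T c z N q.2.1 q.1 :=
    (h.continuous_graph N).comp (f := fun q : ℝ × ℝ × ℝ => (q.2.1, q.1)) (by fun_prop)
  refine isConnected_image (F := fun q => (!₂[q.1, graph N T c z N q.2.1 q.1 + q.2.2], q.2.1))
    ?_ hT'0 (convex_Ioi 0) nonempty_Ioi ?_
  · exact (Plane.continuous_mk.comp (f := fun q : ℝ × ℝ × ℝ =>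
      (q.1, graph N T c z N q.2.1 q.1 + q.2.2)) (by fun_prop)).prodMk (by fun_prop)
  · ext ⟨x, t⟩
    simp only [mem_ofPred_eq, mem_image, mem_prod, mem_univ, true_and, mem_Ioo, mem_Ioi,
      Prod.mk.injEq, Prod.exists]
    constructor
    · rintro ⟨h1, h2, h3⟩
      refine ⟨x 0, t, x 1 - graph N T c z N t (x 0), ⟨⟨h1, h2⟩, by linarith⟩, ?_, rfl⟩
      rw [add_sub_cancel]
      exact Plane.eta x
    · rintro ⟨s, τ, r, ⟨⟨h1, h2⟩, h3⟩, rfl, rfl⟩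
      refine ⟨h1, h2, ?_⟩
      simpa using h3

lemma isConnected_omegaMinus (h : Family N T β C a c c' z zs zt) (hT'0 : 0 < T') (hT' : T' ≤ T) :
    IsConnected (omegaMinus c z T') := by
  rw [h.omegaMinus_eq hT']
  have hg : Continuous fun q : ℝ × ℝ × ℝ => graph N T c z (-N) q.2.1 q.1 :=
    (h.continuous_graph (-N)).comp (f := fun q : ℝ × ℝ × ℝ => (q.2.1, q.1)) (by fun_prop)
  refine isConnected_image (F := fun q => (!₂[q.1, graph N T c z (-N) q.2.1 q.1 - q.2.2], q.2.1))
    ?_ hT'0 (convex_Ioi 0) nonempty_Ioi ?_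
  · exact (Plane.continuous_mk.comp (f := fun q : ℝ × ℝ × ℝ =>
      (q.1, graph N T c z (-N) q.2.1 q.1 - q.2.2)) (by fun_prop)).prodMk (by fun_prop)
  · ext ⟨x, t⟩
    simp only [mem_ofPred_eq, mem_image, mem_prod, mem_univ, true_and, mem_Ioo, mem_Ioi,
      Prod.mk.injEq, Prod.exists]
    constructor
    · rintro ⟨h1, h2, h3⟩
      refine ⟨x 0, t, graph N T c z (-N) t (x 0) - x 1, ⟨⟨h1, h2⟩, by linarith⟩, ?_, rfl⟩
      rw [sub_sub_cancel]
      exact Plane.eta x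
    · rintro ⟨s, τ, r, ⟨⟨h1, h2⟩, h3⟩, rfl, rfl⟩
      refine ⟨h1, h2, ?_⟩
      simpa using h3

lemma isConnected_omegaMix (h : Family N T β C a c c' z zs zt) (hT'0 : 0 < T') (hT' : T' ≤ T) :
    IsConnected (omegaMix c z T') := by
  have hz : Continuous fun q : ℝ × ℝ × ℝ => z q.1 (clamp T q.2.1) :=
    h.cont_z.comp (f := fun q : ℝ × ℝ × ℝ => (q.1, q.2.1)) (by fun_prop)
  have hc := h.cont_c
  refine isConnected_image (F := fun q =>
    (!₂[q.1, z q.1 (clamp T q.2.1) + q.2.2 * (c q.1 * q.2.1)], q.2.1))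
    ?_ hT'0 (convex_Ioo (-1) 1) (nonempty_Ioo.2 (by norm_num)) ?_
  · exact (Plane.continuous_mk.comp (f := fun q : ℝ × ℝ × ℝ =>
      (q.1, z q.1 (clamp T q.2.1) + q.2.2 * (c q.1 * q.2.1))) (continuous_fst.prodMk
        (hz.add (by fun_prop)))).prodMk (by fun_prop)
  · ext ⟨x, t⟩
    simp only [omegaMix, mem_ofPred_eq, mem_image, mem_prod, mem_univ, true_and, mem_Ioo,
      Prod.mk.injEq, Prod.exists]
    constructor
    · rintro ⟨h1, h2, h3, h4⟩
      have hct := mul_pos (h.c_pos (x 0)) h1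
      refine ⟨x 0, t, (x 1 - z (x 0) t) / (c (x 0) * t), ⟨⟨h1, h2⟩, ?_, ?_⟩, ?_, rfl⟩
      · rw [lt_div_iff₀ hct]; linarith
      · rw [div_lt_iff₀ hct]; linarith
      · rw [clamp_of_mem ⟨h1.le, (h2.trans_le hT').le⟩, div_mul_cancel₀ _ hct.ne', add_sub_cancel]
        exact Plane.eta x
    · rintro ⟨s, τ, r, ⟨⟨h1, h2⟩, h3, h4⟩, rfl, rfl⟩
      have hct := mul_pos (h.c_pos s) h1
      rw [clamp_of_mem ⟨h1.le, (h2.trans_le hT').le⟩]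
      refine ⟨h1, h2, ?_, ?_⟩
      · have := mul_lt_mul_of_pos_right h3 hct
        simp; linarith
      · have := mul_lt_mul_of_pos_right h4 hct
        simp; linarith

lemma mem_closure_omegaPlus (h : Family N T β C a c c' z zs zt) (hT' : T' ≤ T)
    {p : Plane × ℝ} (hp : p ∈ slab T') (hy : graph N T c z N p.2 (p.1 0) ≤ p.1 1) :
    p ∈ closure (omegaPlus c z T') := by
  have hg : Continuous fun τ : ℝ => graph N T c z N (p.2 + τ) (p.1 0) :=
    (h.continuous_graph N).comp (f := fun τ : ℝ => (p.2 + τ, p.1 0)) (by fun_prop)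
  rw [h.omegaPlus_eq hT']
  refine mem_closure_of_tendsto (b := 𝓝[>] (0 : ℝ)) (f := fun τ =>
    (!₂[p.1 0, p.1 1 + (graph N T c z N (p.2 + τ) (p.1 0) - graph N T c z N p.2 (p.1 0)) + τ],
      p.2 + τ)) ?_ ?_
  · have hc : Continuous fun τ : ℝ =>
        ((!₂[p.1 0, p.1 1 + (graph N T c z N (p.2 + τ) (p.1 0) - graph N T c z N p.2 (p.1 0)) + τ],
          p.2 + τ) : Plane × ℝ) :=
      (Plane.continuous_mk.comp (f := fun τ : ℝ =>
        (p.1 0, p.1 1 + (graph N T c z N (p.2 + τ) (p.1 0)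
        - graph N T c z N p.2 (p.1 0)) + τ)) (by fun_prop)).prodMk (by fun_prop)
    have := (hc.tendsto 0).mono_left (nhdsWithin_le_nhds (s := Ioi 0))
    simpa [Plane.eta] using this
  · have h1 : ∀ᶠ τ : ℝ in 𝓝[>] 0, τ < T' - p.2 :=
      nhdsWithin_le_nhds (gt_mem_nhds (by linarith [hp.2]))
    filter_upwards [h1, self_mem_nhdsWithin] with τ h1 (h2 : 0 < τ)
    refine ⟨?_, ?_, ?_⟩
    · have := hp.1; linarith
    · linarith
    · simp; linarith

lemma mem_closure_omegaMinus (h : Family N T β C a c c' z zs zt) (hT' : T' ≤ T)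
    {p : Plane × ℝ} (hp : p ∈ slab T') (hy : p.1 1 ≤ graph N T c z (-N) p.2 (p.1 0)) :
    p ∈ closure (omegaMinus c z T') := by
  have hg : Continuous fun τ : ℝ => graph N T c z (-N) (p.2 + τ) (p.1 0) :=
    (h.continuous_graph (-N)).comp (f := fun τ : ℝ => (p.2 + τ, p.1 0)) (by fun_prop)
  rw [h.omegaMinus_eq hT']
  refine mem_closure_of_tendsto (b := 𝓝[>] (0 : ℝ)) (f := fun τ =>
    (!₂[p.1 0, p.1 1 + (graph N T c z (-N) (p.2 + τ) (p.1 0) -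
      graph N T c z (-N) p.2 (p.1 0)) - τ], p.2 + τ)) ?_ ?_
  · have hc : Continuous fun τ : ℝ =>
        ((!₂[p.1 0, p.1 1 + (graph N T c z (-N) (p.2 + τ) (p.1 0) -
          graph N T c z (-N) p.2 (p.1 0)) - τ], p.2 + τ) : Plane × ℝ) :=
      (Plane.continuous_mk.comp (f := fun τ : ℝ => (p.1 0, p.1 1 + (graph N T c z (-N) (p.2 + τ)
        (p.1 0) - graph N T c z (-N) p.2 (p.1 0)) - τ)) (by fun_prop)).prodMk (by fun_prop)
    have := (hc.tendsto 0).mono_left (nhdsWithin_le_nhds (s := Ioi 0))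
    simpa [Plane.eta] using this
  · have h1 : ∀ᶠ τ : ℝ in 𝓝[>] 0, τ < T' - p.2 :=
      nhdsWithin_le_nhds (gt_mem_nhds (by linarith [hp.2]))
    filter_upwards [h1, self_mem_nhdsWithin] with τ h1 (h2 : 0 < τ)
    refine ⟨?_, ?_, ?_⟩
    · have := hp.1; linarith
    · linarith
    · simp; linarith

lemma cover (h : Family N T β C a c c' z zs zt) (hT' : T' ≤ T) :
    (closure (omegaPlus c z T') ∩ slab T') ∪ (closure (omegaMinus c z T') ∩ slab T') ∪
      omegaMix c z T' = slab T' := by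
  ext p
  constructor
  · rintro ((hp | hp) | hp)
    · exact hp.2
    · exact hp.2
    · exact ⟨hp.1.le, hp.2.1⟩
  · intro hp
    have htm : p.2 ∈ Icc 0 T := ⟨hp.1, (hp.2.trans_le hT').le⟩
    by_cases h1 : graph N T c z N p.2 (p.1 0) ≤ p.1 1
    · exact Or.inl (Or.inl ⟨h.mem_closure_omegaPlus hT' hp h1, hp⟩)
    by_cases h2 : p.1 1 ≤ graph N T c z (-N) p.2 (p.1 0)
    · exact Or.inl (Or.inr ⟨h.mem_closure_omegaMinus hT' hp h2, hp⟩)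
    right
    rw [h.omegaMix_eq hT']
    refine ⟨lt_of_le_of_ne hp.1 fun h0 => ?_, hp.2, not_le.1 h2, not_le.1 h1⟩
    -- all interfaces coincide at time zero
    rw [h.graph_self htm, ← h0] at h1
    rw [h.graph_neg_self htm, ← h0] at h2
    push Not at h1 h2
    linarith

lemma abs_density_pure (h : Family N T β C a c c' z zs zt) {p : Plane × ℝ}
    (hp : p ∈ omegaPlus c z T' ∪ omegaMinus c z T') : |density N c z p| = 1 := by
  unfold density
  rcases hp with hp | hp
  · simp only [if_pos hp.2.2, abs_one]
  · have h1 : ¬ (z (p.1 0) p.2 + c (p.1 0) * p.2 < p.1 1) := by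
      have := hp.2.2
      have := mul_pos (h.c_pos (p.1 0)) hp.1
      linarith
    simp only [if_neg h1, if_pos hp.2.2, abs_neg, abs_one]

end Family

end Muskat

/-! ### The correction of the momentum -/

namespace Muskat

/-- The difference of the normal speeds of the `j`-th interface and of the fluid, weighted by the
jump `1 / N` of the density. -/
noncomputable def slip (N : ℕ) (T : ℝ) (c c' : ℝ → ℝ) (z zs zt : ℝ → ℝ → ℝ) (j : ℤ) (t s : ℝ) : ℝ :=
  1 / N * (zt s t + coef N j * c s - nu N T c c' z zs j s t)

/-- The sum of the slips over all interfaces. -/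
noncomputable def slipSum (N : ℕ) (T : ℝ) (c c' : ℝ → ℝ) (z zs zt : ℝ → ℝ → ℝ) (t s : ℝ) : ℝ :=
  ∑ j ∈ indices N, slip N T c c' z zs zt j t s

/-- The primitive of `slipSum`. -/
noncomputable def slipInt (N : ℕ) (T : ℝ) (c c' : ℝ → ℝ) (z zs zt : ℝ → ℝ → ℝ) (t s : ℝ) : ℝ :=
  ∫ r in (0 : ℝ)..s, slipSum N T c c' z zs zt t r

/-- The horizontal flux in the middle layer: `slipInt` spread evenly over the width of the layer. -/
noncomputable def corr (N : ℕ) (T : ℝ) (c c' : ℝ → ℝ) (z zs zt : ℝ → ℝ → ℝ) (t s : ℝ) : ℝ :=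
  slipInt N T c c' z zs zt t s / (2 * coef N 1 * c s * t)

/-- The derivative of `corr` in `s`. -/
noncomputable def corrDeriv (N : ℕ) (T : ℝ) (c c' : ℝ → ℝ) (z zs zt : ℝ → ℝ → ℝ) (t s : ℝ) : ℝ :=
  (slipSum N T c c' z zs zt t s - corr N T c c' z zs zt t s * (2 * coef N 1 * c' s * t)) /
    (2 * coef N 1 * c s * t)

/-- The second component of the divergence free field with first component `-corr` that is tangent
to the `j`-th interface. -/
noncomputable def streamSnd (N : ℕ) (T : ℝ) (c c' : ℝ → ℝ) (z zs zt : ℝ → ℝ → ℝ) (j : ℤ) (t : ℝ)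
    (q : ℝ × ℝ) : ℝ :=
  corrDeriv N T c c' z zs zt t q.1 * (q.2 - graph N T c z j t q.1) -
    corr N T c c' z zs zt t q.1 * slope N T c' zs j t q.1

/-- First component of the correction `ρ u - m`. -/
noncomputable def corrFst (N : ℕ) (T : ℝ) (c c' : ℝ → ℝ) (z zs zt : ℝ → ℝ → ℝ) (t : ℝ)
    (q : ℝ × ℝ) : ℝ :=
  (above (graph N T c z (-1) t)).indicator (fun q => -corr N T c c' z zs zt t q.1) q -
    (above (graph N T c z 1 t)).indicator (fun q => -corr N T c c' z zs zt t q.1) q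

/-- Second component of the correction `ρ u - m`. -/
noncomputable def corrSnd (N : ℕ) (T : ℝ) (c c' : ℝ → ℝ) (z zs zt : ℝ → ℝ → ℝ) (t : ℝ)
    (q : ℝ × ℝ) : ℝ :=
  -(∑ j ∈ indices N, (above (graph N T c z j t)).indicator
      (fun q => slip N T c c' z zs zt j t q.1) q) +
    ((above (graph N T c z (-1) t)).indicator (streamSnd N T c c' z zs zt (-1) t) q -
      (above (graph N T c z 1 t)).indicator (streamSnd N T c c' z zs zt 1 t) q)

/-- The momentum of the subsolution. -/
noncomputable def momentum (N : ℕ) (T : ℝ) (c c' : ℝ → ℝ) (z zs zt : ℝ → ℝ → ℝ) (p : Plane × ℝ) :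
    Plane :=
  density N c z p • velocity N c z p -
    !₂[corrFst N T c c' z zs zt p.2 (p.1 0, p.1 1), corrSnd N T c c' z zs zt p.2 (p.1 0, p.1 1)]

lemma sum_odd (k n : ℕ) (hk : k ≤ n) :
    ∑ i ∈ Finset.Icc (k + 1) n, (2 * (i : ℝ) - 1) = (n : ℝ) ^ 2 - (k : ℝ) ^ 2 := by
  induction n, hk using Nat.le_induction with
  | base => simp
  | succ n hn ih =>
    rw [Finset.sum_Icc_succ_top (by omega), ih]
    push_cast
    ring

lemma sum_Icc_split (f : ℕ → ℝ) {k N : ℕ} (hk : k ≤ N) :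
    ∑ i ∈ Finset.Icc 1 N, f i = ∑ i ∈ Finset.Icc 1 k, f i + ∑ i ∈ Finset.Icc (k + 1) N, f i := by
  have : Finset.Icc 1 N = Finset.Icc 1 k ∪ Finset.Icc (k + 1) N := by
    ext i; simp only [Finset.mem_union, Finset.mem_Icc]; omega
  rw [this, Finset.sum_union]
  rw [Finset.disjoint_left]
  simp only [Finset.mem_Icc]
  omega

/-- The total slip of the outermost `N - k` interfaces is the fraction `1 - (k/N)²` of a number
close to `N c / (2 N - 1)`. -/
lemma outer_sum {N k : ℕ} (hN : 1 ≤ N) (hk : k < N) {c ε : ℝ} (δ : ℕ → ℝ)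
    (hδ : ∀ i ∈ Finset.Icc 1 N, |δ i| ≤ ε * c) :
    ∃ r, ∑ i ∈ Finset.Icc (k + 1) N, 1 / (N : ℝ) * (coef N i * c + δ i) =
        (1 - ((k : ℝ) / N) ^ 2) * r ∧ |r - N * c / (2 * N - 1)| ≤ ε * c := by
  have hN0 : (0 : ℝ) < N := by exact_mod_cast hN
  have hD := two_mul_sub_one_pos hN
  have hkN : (k : ℝ) + 1 ≤ N := by exact_mod_cast hk
  have hk0 : (0 : ℝ) ≤ k := Nat.cast_nonneg k
  have hg : (0 : ℝ) < (N : ℝ) ^ 2 - (k : ℝ) ^ 2 := by nlinarith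
  have e1 : ∑ i ∈ Finset.Icc (k + 1) N, 1 / (N : ℝ) * (coef N i * c + δ i) =
      1 / N * (((N : ℝ) ^ 2 - (k : ℝ) ^ 2) * c / (2 * N - 1) +
        ∑ i ∈ Finset.Icc (k + 1) N, δ i) := by
    rw [← Finset.mul_sum, Finset.sum_add_distrib, ← sum_odd k N hk.le, Finset.sum_mul,
      Finset.sum_div]
    congr 2
    refine Finset.sum_congr rfl fun i hi => ?_
    rw [Finset.mem_Icc] at hi
    rw [coef_natCast N (by omega)]
    ring
  have e2 : |∑ i ∈ Finset.Icc (k + 1) N, δ i| ≤ ((N : ℝ) - k) * (ε * c) := by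
    refine (Finset.abs_sum_le_sum_abs _ _).trans ((Finset.sum_le_card_nsmul _ _ (ε * c)
      fun i hi => hδ i ?_).trans_eq ?_)
    · rw [Finset.mem_Icc] at *; omega
    · rw [Nat.card_Icc, nsmul_eq_mul, Nat.add_sub_add_right, Nat.cast_sub hk.le]
  have hεc : 0 ≤ ε * c := (abs_nonneg _).trans (hδ 1 (Finset.mem_Icc.2 ⟨le_rfl, hN⟩))
  refine ⟨N * c / (2 * N - 1) + N / ((N : ℝ) ^ 2 - (k : ℝ) ^ 2) *
    ∑ i ∈ Finset.Icc (k + 1) N, δ i, ?_, ?_⟩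
  · rw [e1]
    field_simp
  · rw [add_sub_cancel_left, abs_mul, abs_of_pos (div_pos hN0 hg)]
    calc _ ≤ N / ((N : ℝ) ^ 2 - (k : ℝ) ^ 2) * (((N : ℝ) - k) * (ε * c)) := by gcongr
      _ = N / ((N : ℝ) + k) * (ε * c) := by
        have : (N : ℝ) - k ≠ 0 := by
          have : (0 : ℝ) < N - k := by linarith
          exact this.ne'
        rw [show (N : ℝ) ^ 2 - (k : ℝ) ^ 2 = (N + k) * (N - k) by ring]
        field_simp
      _ ≤ 1 * (ε * c) := by
        gcongr
        rw [div_le_one (by positivity)]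
        linarith
      _ = _ := one_mul _

/-- The conditions under which the slips, of relative size `ε`, are small enough. The distance of
the speeds to the critical one is `θ`. -/
structure IsSmall (N : ℕ) (T M cmax θ ε : ℝ) : Prop where
  gap : N * cmax / (2 * N - 1) = 1 - θ
  small : ε * (1 + (2 * N - 1) * (M * (1 + T))) ≤ 1 / 4
  small' : ε * (1 + (2 * N - 1) * (M * (1 + T))) * cmax ≤ θ / 2
  sq_lt : ((2 * N - 1) * ε) ^ 2 < θ / 8
  ε_pos : 0 < ε
  θ_pos : 0 < θ
  T_pos : 0 < T
  M_pos : 0 < M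
  one_le : 1 ≤ N

lemma exists_isSmall {N : ℕ} (hN : 1 ≤ N) {T M cmax : ℝ} (hT : 0 < T) (hM : 0 < M)
    (hcmax : cmax < (2 * (N : ℝ) - 1) / N) : ∃ θ ε, IsSmall N T M cmax θ ε := by
  have hN0 : (0 : ℝ) < N := by exact_mod_cast hN
  have hD := two_mul_sub_one_pos hN
  have hθ : 0 < 1 - N * cmax / (2 * N - 1) := by
    rw [sub_pos, div_lt_one hD]
    rw [lt_div_iff₀ hN0] at hcmax
    linarith
  set θ := 1 - N * cmax / (2 * N - 1) with hθd
  have l : ∀ {f : ℝ → ℝ} {b : ℝ}, Continuous f → f 0 < b → ∀ᶠ ε in 𝓝[>] (0 : ℝ), f ε < b :=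
    fun hf hb => nhdsWithin_le_nhds ((hf.tendsto 0).eventually_lt_const hb)
  have l1 := l (f := fun ε => ε * (1 + (2 * N - 1) * (M * (1 + T)))) (b := 1 / 4) (by fun_prop)
    (by norm_num)
  have l2 := l (f := fun ε => ε * (1 + (2 * N - 1) * (M * (1 + T))) * cmax) (b := θ / 2)
    (by fun_prop) (by simpa using hθ)
  have l3 := l (f := fun ε => ((2 * N - 1) * ε) ^ 2) (b := θ / 8) (by fun_prop)
    (by simpa using hθ)
  obtain ⟨ε, h1, h2, h3, h4⟩ := (l1.and (l2.and (l3.and self_mem_nhdsWithin))).exists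
  exact ⟨θ, ε, ⟨by rw [hθd]; ring, h1.le, h2.le, h3, h4, hθ, hT, hM, hN⟩⟩

namespace IsSmall

variable {N : ℕ} {T M cmax θ ε c : ℝ}

/-- For `r` close to `N c / (2 N - 1)`, both `r` and `1 - r` stay away from `0`, the former relative
to `c`. -/
lemma bounds (h : IsSmall N T M cmax θ ε) (hc : 0 < c) (hcm : c ≤ cmax) {r : ℝ}
    (hr : |r - N * c / (2 * N - 1)| ≤ ε * (1 + (2 * N - 1) * (M * (1 + T))) * c) :
    c / 4 ≤ r ∧ r ≤ 1 - θ / 2 := by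
  have hD := two_mul_sub_one_pos h.one_le
  have hN0 : (0 : ℝ) < N := by exact_mod_cast h.one_le
  have := h.ε_pos
  have := h.T_pos
  have := h.M_pos
  have hK : 0 ≤ ε * (1 + (2 * N - 1) * (M * (1 + T))) := by positivity
  have h1 : ε * (1 + (2 * N - 1) * (M * (1 + T))) * c ≤ 1 / 4 * c :=
    mul_le_mul_of_nonneg_right h.small hc.le
  have h2 : ε * (1 + (2 * N - 1) * (M * (1 + T))) * c ≤ θ / 2 :=
    (mul_le_mul_of_nonneg_left hcm hK).trans h.small'
  have h3 : c / 2 ≤ N * c / (2 * N - 1) := by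
    rw [div_le_div_iff₀ two_pos hD]
    nlinarith
  have h4 : N * c / (2 * N - 1) ≤ 1 - θ := by
    rw [← h.gap]
    gcongr
  rw [abs_le] at hr
  constructor <;> linarith

/-- The strict inequality in the middle layer. -/
lemma middle (h : IsSmall N T M cmax θ ε) (hc : 0 < c) (hcm : c ≤ cmax) {A B μ κ d : ℝ}
    (hA : |A - N * c / (2 * N - 1)| ≤ ε * c) (hB : |B - N * c / (2 * N - 1)| ≤ ε * c)
    (hμ : 0 ≤ μ) (hμ1 : μ ≤ 1) (hκ : |κ| ≤ (2 * N - 1) * ε * √c)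
    (hd : |d| ≤ M * (1 + T) * √c) :
    κ ^ 2 + ((1 - μ) * A + μ * B - κ * d) ^ 2 < (1 - μ) * A + μ * B - κ * d := by
  have hD := two_mul_sub_one_pos h.one_le
  have hs : √c * √c = c := Real.mul_self_sqrt hc.le
  have hε := h.ε_pos
  have hκd : |κ * d| ≤ ε * ((2 * N - 1) * (M * (1 + T))) * c := by
    rw [abs_mul]
    calc |κ| * |d| ≤ ((2 * N - 1) * ε * √c) * (M * (1 + T) * √c) := by
          gcongr
      _ = ε * ((2 * N - 1) * (M * (1 + T))) * (√c * √c) := by ring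
      _ = _ := by rw [hs]
  have hκ2 : κ ^ 2 < θ / 8 * c := by
    calc κ ^ 2 = |κ| ^ 2 := (sq_abs κ).symm
      _ ≤ ((2 * N - 1) * ε * √c) ^ 2 := by gcongr
      _ = ((2 * N - 1) * ε) ^ 2 * (√c * √c) := by ring
      _ = ((2 * N - 1) * ε) ^ 2 * c := by rw [hs]
      _ < θ / 8 * c := mul_lt_mul_of_pos_right h.sq_lt hc
  have hAB : |(1 - μ) * A + μ * B - N * c / (2 * N - 1)| ≤ ε * c := by
    have e : (1 - μ) * A + μ * B - N * c / (2 * N - 1) =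
      (1 - μ) * (A - N * c / (2 * N - 1)) + μ * (B - N * c / (2 * N - 1)) := by ring
    rw [e]
    refine (abs_add_le _ _).trans ?_
    rw [abs_mul, abs_mul, abs_of_nonneg hμ, abs_of_nonneg (by linarith : 0 ≤ 1 - μ)]
    calc _ ≤ (1 - μ) * (ε * c) + μ * (ε * c) := by gcongr
      _ = _ := by ring
  have hQ : |(1 - μ) * A + μ * B - κ * d - N * c / (2 * N - 1)| ≤
      ε * (1 + (2 * N - 1) * (M * (1 + T))) * c := by
    rw [abs_le] at *
    constructor <;> linarith
  obtain ⟨b1, b2⟩ := h.bounds hc hcm hQ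
  generalize (1 - μ) * A + μ * B - κ * d = Q at *
  have hθ := h.θ_pos
  have : c / 4 * (θ / 2) ≤ Q * (1 - Q) :=
    mul_le_mul b1 (by linarith) (by positivity) (by linarith)
  nlinarith

end IsSmall

/-- The smallness of the slips at time `t`, as assumed in the limit `t ↓ 0`. -/
structure SlipBound (N : ℕ) (T : ℝ) (c c' : ℝ → ℝ) (z zs zt : ℝ → ℝ → ℝ) (ε t : ℝ) : Prop where
  slip_le : ∀ i ∈ indices N, ∀ s, |zt s t - nu N T c c' z zs i s t| ≤ ε * c s
  int_le : ∀ s, |slipInt N T c c' z zs zt t s| ≤ 2 * ε * t * (c s * √(c s))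

namespace Family

variable {N : ℕ} {T β C a : ℝ} {c c' : ℝ → ℝ} {z zs zt : ℝ → ℝ → ℝ}
variable {t x y : ℝ} {k l : ℕ}

lemma width_pos (h : Family N T β C a c c' z zs zt) (ht0 : 0 < t) :
    0 < 2 * coef N 1 * c x * t := by
  have h1 := coef_pos h.one_le (le_refl 1)
  have h2 := h.c_pos x
  rw [Nat.cast_one] at h1
  positivity

lemma width_mul_corr (h : Family N T β C a c c' z zs zt) (ht0 : 0 < t) :
    2 * coef N 1 * c x * t * corr N T c c' z zs zt t x = slipInt N T c c' z zs zt t x :=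
  mul_div_cancel₀ _ (h.width_pos ht0).ne'

lemma width_mul_corrDeriv (h : Family N T β C a c c' z zs zt) (ht0 : 0 < t) :
    2 * coef N 1 * c x * t * corrDeriv N T c c' z zs zt t x =
      slipSum N T c c' z zs zt t x - corr N T c c' z zs zt t x * (2 * coef N 1 * c' x * t) :=
  mul_div_cancel₀ _ (h.width_pos ht0).ne'

lemma slipSum_eq :
    slipSum N T c c' z zs zt t x = ∑ i ∈ Finset.Icc 1 N, slip N T c c' z zs zt i t x +
      ∑ i ∈ Finset.Icc 1 N, slip N T c c' z zs zt (-i) t x := by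
  rw [slipSum, sum_indices, Finset.sum_add_distrib]

lemma one_mem (h : Family N T β C a c c' z zs zt) : 1 ∈ Finset.Icc 1 N :=
  Finset.mem_Icc.2 ⟨le_rfl, h.one_le⟩

/-- Above the middle layer the stream field absorbs the sum of all slips, so that only the slips of
the interfaces above the point remain. -/
lemma corr_upper (h : Family N T β C a c c' z zs zt) (ht0 : 0 < t) (ht : t ≤ T)
    (hL : InLayer N T c z t x y k l) (hk : 1 ≤ k) :
    corrFst N T c c' z zs zt t (x, y) = 0 ∧ corrSnd N T c c' z zs zt t (x, y) =
      ∑ i ∈ Finset.Icc (k + 1) N, slip N T c c' z zs zt i t x := by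
  have hl : l = 0 := by have := hL.eq_zero; omega
  subst hl
  have m1 : (x, y) ∈ above (graph N T c z 1 t) := (hL.upper 1 h.one_mem).2 hk
  have m2 : (x, y) ∈ above (graph N T c z (-1) t) := (hL.lower 1 h.one_mem).2 one_pos
  have htm : t ∈ Icc 0 T := ⟨ht0.le, ht⟩
  constructor
  · rw [corrFst, indicator_of_mem m1, indicator_of_mem m2, sub_self]
  · rw [corrSnd, indicator_of_mem m1, indicator_of_mem m2,
      sum_indicator hL fun j q => slip N T c c' z zs zt j t q.1]
    have e1 := h.width_mul_corrDeriv (x := x) ht0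
    rw [slipSum_eq, sum_Icc_split _ hL.k_le] at e1
    have e2 : streamSnd N T c c' z zs zt (-1) t (x, y) - streamSnd N T c c' z zs zt 1 t (x, y) =
        2 * coef N 1 * c x * t * corrDeriv N T c c' z zs zt t x +
          corr N T c c' z zs zt t x * (2 * coef N 1 * c' x * t) := by
      simp only [streamSnd, graph_eq htm, slope_eq htm, coef_neg]
      ring
    rw [e2, e1]
    simp only
    ring

/-- Below the middle layer only the slips of the interfaces below the point contribute. -/
lemma corr_lower (h : Family N T β C a c c' z zs zt)
    (hL : InLayer N T c z t x y k l) (hl : 1 ≤ l) :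
    corrFst N T c c' z zs zt t (x, y) = 0 ∧ corrSnd N T c c' z zs zt t (x, y) =
      -∑ i ∈ Finset.Icc (l + 1) N, slip N T c c' z zs zt (-i) t x := by
  have hk : k = 0 := by have := hL.eq_zero; omega
  subst hk
  have m1 : (x, y) ∉ above (graph N T c z 1 t) := fun hm => by
    have := (hL.upper 1 h.one_mem).1 hm
    omega
  have m2 : (x, y) ∉ above (graph N T c z (-1) t) := fun hm => by
    have := (hL.lower 1 h.one_mem).1 hm
    omega
  constructor
  · rw [corrFst, indicator_of_notMem m1, indicator_of_notMem m2, sub_self]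
  · rw [corrSnd, indicator_of_notMem m1, indicator_of_notMem m2,
      sum_indicator hL fun j q => slip N T c c' z zs zt j t q.1]
    simp

/-- In the middle layer the stream field is the one of the interface `-1`. -/
lemma corr_middle (h : Family N T β C a c c' z zs zt) (hL : InLayer N T c z t x y 0 0) :
    corrFst N T c c' z zs zt t (x, y) = -corr N T c c' z zs zt t x ∧
    corrSnd N T c c' z zs zt t (x, y) =
      -∑ i ∈ Finset.Icc 1 N, slip N T c c' z zs zt (-i) t x +
        streamSnd N T c c' z zs zt (-1) t (x, y) := by
  have m1 : (x, y) ∉ above (graph N T c z 1 t) := fun hm => by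
    have := (hL.upper 1 h.one_mem).1 hm
    omega
  have m2 : (x, y) ∈ above (graph N T c z (-1) t) := (hL.lower 1 h.one_mem).2 one_pos
  constructor
  · rw [corrFst, indicator_of_notMem m1, indicator_of_mem m2, sub_zero]
  · rw [corrSnd, indicator_of_notMem m1, indicator_of_mem m2,
      sum_indicator hL fun j q => slip N T c c' z zs zt j t q.1]
    simp

variable {M cmax θ ε : ℝ}

lemma exists_upper (h : Family N T β C a c c' z zs zt)
    (hb : SlipBound N T c c' z zs zt ε t) (hk : k < N) :
    ∃ r, ∑ i ∈ Finset.Icc (k + 1) N, slip N T c c' z zs zt i t x = (1 - ((k : ℝ) / N) ^ 2) * r ∧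
      |r - N * c x / (2 * N - 1)| ≤ ε * c x := by
  obtain ⟨r, h1, h2⟩ := outer_sum h.one_le hk (c := c x) (ε := ε)
    (fun i => zt x t - nu N T c c' z zs i x t) fun i hi => by
      rw [Finset.mem_Icc] at hi
      exact hb.slip_le _ (natCast_mem_indices hi.1 hi.2) x
  refine ⟨r, ?_, h2⟩
  rw [← h1]
  refine Finset.sum_congr rfl fun i _ => ?_
  rw [slip]; ring

lemma exists_lower (h : Family N T β C a c c' z zs zt)
    (hb : SlipBound N T c c' z zs zt ε t) (hl : l < N) :
    ∃ r, -∑ i ∈ Finset.Icc (l + 1) N, slip N T c c' z zs zt (-i) t x =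
        (1 - ((l : ℝ) / N) ^ 2) * r ∧
      |r - N * c x / (2 * N - 1)| ≤ ε * c x := by
  obtain ⟨r, h1, h2⟩ := outer_sum h.one_le hl (c := c x) (ε := ε)
    (fun i => -(zt x t - nu N T c c' z zs (-i) x t)) fun i hi => by
      rw [Finset.mem_Icc] at hi
      rw [abs_neg]
      exact hb.slip_le _ (neg_mem_indices (natCast_mem_indices hi.1 hi.2)) x
  refine ⟨r, ?_, h2⟩
  rw [← h1, ← Finset.sum_neg_distrib]
  refine Finset.sum_congr rfl fun i _ => ?_
  rw [slip, coef_neg]; ring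

/-- The strict inequality in the outer layers, where the correction is vertical. -/
lemma outer_strict (hs : IsSmall N T M cmax θ ε) (hc : 0 < c x) (hcm : c x ≤ cmax) {k : ℕ}
    (hk : k < N) {r : ℝ} (hr : |r - N * c x / (2 * N - 1)| ≤ ε * c x) :
    ((1 - ((k : ℝ) / N) ^ 2) * r) ^ 2 <
      (1 - ((k : ℝ) / N) ^ 2) * ((1 - ((k : ℝ) / N) ^ 2) * r) := by
  have hN0 : (0 : ℝ) < N := by exact_mod_cast hs.one_le
  have hD := two_mul_sub_one_pos hs.one_le
  have hM := hs.M_pos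
  have hT := hs.T_pos
  have hε := hs.ε_pos
  have hθ := hs.θ_pos
  have hk1 : (k : ℝ) / N < 1 := by
    rw [div_lt_one hN0]
    exact_mod_cast hk
  have hk0 : 0 ≤ (k : ℝ) / N := by positivity
  have hg : 0 < 1 - ((k : ℝ) / N) ^ 2 := by nlinarith
  obtain ⟨b1, b2⟩ := hs.bounds hc hcm (r := r) (hr.trans (by
    have : 0 ≤ ε * ((2 * N - 1) * (M * (1 + T))) * c x := by positivity
    linarith))
  have hr0 : 0 < r := by linarith
  have : 0 < (1 - ((k : ℝ) / N) ^ 2) ^ 2 * (r * (1 - r)) := by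
    have : 0 < 1 - r := by linarith
    positivity
  nlinarith

/-- The strict inequality inside the mixing zone, in terms of the correction. -/
lemma corr_strict (h : Family N T β C a c c' z zs zt) (ht0 : 0 < t) (ht : t ≤ T)
    (hs : IsSmall N T M cmax θ ε) (hb : SlipBound N T c c' z zs zt ε t) (hcm : c x ≤ cmax)
    (hzs : |zs x t| ≤ M * √(c x)) (hcs : |c' x| ≤ M * √(c x))
    (hoff : ∀ j ∈ indices N, y ≠ graph N T c z j t x)
    (hL : InLayer N T c z t x y k l) (hk : k < N) (hl : l < N) :
    corrFst N T c c' z zs zt t (x, y) ^ 2 + corrSnd N T c c' z zs zt t (x, y) ^ 2 <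
      (1 - density N c z (!₂[x, y], t) ^ 2) * corrSnd N T c c' z zs zt t (x, y) := by
  have hc := h.c_pos x
  have htm : t ∈ Icc 0 T := ⟨ht0.le, ht⟩
  rw [h.density_eq ht0 ht hoff hL]
  rcases Nat.eq_zero_or_pos k with rfl | k0
  · rcases Nat.eq_zero_or_pos l with rfl | l0
    · obtain ⟨e1, e2⟩ := h.corr_middle (zs := zs) (zt := zt) (c' := c') hL
      obtain ⟨B, hB, hB'⟩ := h.exists_upper (x := x) hb hk
      obtain ⟨A, hA, hA'⟩ := h.exists_lower (x := x) hb hl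
      simp only [Nat.cast_zero, zero_div, ne_eq, OfNat.ofNat_ne_zero, not_false_eq_true, zero_pow,
        sub_zero, one_mul, zero_add] at hA hB
      have hW := h.width_pos (x := x) ht0
      have c1 := coef_pos h.one_le (le_refl 1)
      have c2 := abs_coef_le h.one_le (natCast_mem_indices le_rfl h.one_le)
      rw [Nat.cast_one] at c1 c2
      rw [abs_of_pos c1] at c2
      set W := 2 * coef N 1 * c x * t with hWd
      -- `μ` is the relative height in the middle layer: there `corrSnd` is the linear interpolation
      -- of the values `A` and `B` at its bottom and top, up to the contribution of the slopes
      set μ := (y - graph N T c z (-1) t x) / W with hμd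
      have hy1 : graph N T c z (-1) t x < y := (hL.lower 1 h.one_mem).2 one_pos
      have hy2 : y ≤ graph N T c z 1 t x := by
        by_contra hlt
        have := (hL.upper 1 h.one_mem).1 (not_le.1 hlt)
        omega
      have hgr : graph N T c z 1 t x - graph N T c z (-1) t x = W := by
        rw [graph_eq htm, graph_eq htm, coef_neg, hWd]; ring
      have hμ : 0 ≤ μ := div_nonneg (by linarith) hW.le
      have hμ1 : μ ≤ 1 := by rw [hμd, div_le_one hW]; linarith
      have hyW : y - graph N T c z (-1) t x = μ * W := (div_mul_cancel₀ _ hW.ne').symm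
      have hcd := h.width_mul_corrDeriv (x := x) (t := t) (zs := zs) (zt := zt) (c' := c') ht0
      rw [← hWd] at hcd
      have hQ : corrSnd N T c c' z zs zt t (x, y) = (1 - μ) * A + μ * B -
          corr N T c c' z zs zt t x * (zs x t + (2 * μ - 1) * (coef N 1 * c' x * t)) := by
        rw [e2, hA, streamSnd]
        simp only
        rw [hyW, slope_eq htm, coef_neg]
        have e3 : corrDeriv N T c c' z zs zt t x * (μ * W) =
            μ * (W * corrDeriv N T c c' z zs zt t x) := by ring
        rw [e3, hcd, slipSum_eq, hB]
        have : ∑ i ∈ Finset.Icc 1 N, slip N T c c' z zs zt (-i) t x = -A := by rw [← hA, neg_neg]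
        rw [this]
        ring
      have hκ : |corr N T c c' z zs zt t x| ≤ (2 * N - 1) * ε * √(c x) := by
        rw [corr, abs_div, abs_of_pos hW, div_le_iff₀ hW]
        refine (hb.int_le x).trans_eq ?_
        have hc1 := coef_natCast N (le_refl 1)
        have hD := two_mul_sub_one_pos h.one_le
        rw [hWd]
        rw [Nat.cast_one] at hc1
        rw [hc1]
        field_simp
        push_cast
        ring
      have hd : |zs x t + (2 * μ - 1) * (coef N 1 * c' x * t)| ≤ M * (1 + T) * √(c x) := by
        refine (abs_add_le _ _).trans ?_
        have b1 : |2 * μ - 1| ≤ 1 := by rw [abs_le]; constructor <;> linarith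
        have b2 : |coef N 1 * c' x * t| ≤ 1 * (M * √(c x)) * T := by
          rw [abs_mul, abs_mul, abs_of_pos c1, abs_of_pos ht0]
          have := hs.M_pos
          gcongr
        rw [abs_mul]
        have := mul_le_mul b1 b2 (abs_nonneg _) zero_le_one
        linarith
      have key := hs.middle hc hcm hA' hB' hμ hμ1 hκ hd
      rw [hQ, e1]
      simpa using key
    · obtain ⟨e1, e2⟩ := h.corr_lower (zs := zs) (zt := zt) (c' := c') hL l0
      obtain ⟨r, hr, hr'⟩ := h.exists_lower (x := x) hb hl
      have := outer_strict hs hc hcm hl hr'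
      rw [e1, e2, hr]
      simpa [neg_div] using this
  · obtain ⟨e1, e2⟩ := h.corr_upper (zs := zs) (zt := zt) (c' := c') ht0 ht hL k0
    obtain ⟨r, hr, hr'⟩ := h.exists_upper (x := x) hb hk
    have := outer_strict hs hc hcm hk hr'
    have l0 : l = 0 := by have := hL.eq_zero; omega
    rw [e1, e2, hr, l0]
    simpa using this

/-- Outside of the mixing zone there is no correction. -/
lemma corr_pure (h : Family N T β C a c c' z zs zt) (ht0 : 0 < t) (ht : t ≤ T)
    (hoff : ∀ j ∈ indices N, y ≠ graph N T c z j t x)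
    (hL : InLayer N T c z t x y k l) (hkl : k = N ∨ l = N) :
    corrFst N T c c' z zs zt t (x, y) = 0 ∧ corrSnd N T c c' z zs zt t (x, y) = 0 ∧
      density N c z (!₂[x, y], t) ^ 2 = 1 := by
  have hN0 := h.N_pos
  have hN1 := h.one_le
  rw [h.density_eq ht0 ht hoff hL]
  rcases hkl with rfl | rfl
  · obtain ⟨e1, e2⟩ := h.corr_upper (zs := zs) (zt := zt) (c' := c') ht0 ht hL hN1
    have l0 : l = 0 := by have := hL.eq_zero; omega
    rw [Finset.Icc_eq_empty (by omega), Finset.sum_empty] at e2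
    refine ⟨e1, e2, ?_⟩
    rw [l0]
    field_simp
    simp
  · obtain ⟨e1, e2⟩ := h.corr_lower (zs := zs) (zt := zt) (c' := c') hL hN1
    have k0 : k = 0 := by have := hL.eq_zero; omega
    rw [Finset.Icc_eq_empty (by omega), Finset.sum_empty, neg_zero] at e2
    refine ⟨e1, e2, ?_⟩
    rw [k0]
    field_simp
    simp

end Family

lemma defect_eq (ρ q₁ q₂ : ℝ) (u : Plane) :
    defect ρ u (ρ • u - !₂[q₁, q₂]) = !₂[-q₁, (1 - ρ ^ 2) / 2 - q₂] := by
  ext i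
  fin_cases i <;> simp [defect]
  ring

lemma norm_sq_mk (p q : ℝ) : ‖(!₂[p, q] : Plane)‖ ^ 2 = p ^ 2 + q ^ 2 := by
  rw [EuclideanSpace.norm_sq_eq]
  simp

/-- The inequality defining subsolutions, in terms of the correction `(q₁, q₂) = ρ u - m`. -/
lemma norm_defect_lt {ρ q₁ q₂ : ℝ} (u : Plane) (hρ : 0 ≤ 1 - ρ ^ 2)
    (h : q₁ ^ 2 + q₂ ^ 2 < (1 - ρ ^ 2) * q₂) :
    ‖defect ρ u (ρ • u - !₂[q₁, q₂])‖ < 1 / 2 * (1 - ρ ^ 2) := by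
  rw [defect_eq]
  refine lt_of_pow_lt_pow_left₀ 2 (by linarith) ?_
  rw [norm_sq_mk]
  nlinarith

end Muskat

/-! ### Smallness of the slips at small times -/

namespace Muskat

lemma eventually_abs_le {g : ℝ → ℝ → ℝ}
    (h : Tendsto (fun t => ⨆ s : ℝ, ENNReal.ofReal (g s t)) (𝓝[>] 0) (𝓝 0)) {ε : ℝ} (hε : 0 < ε) :
    ∀ᶠ t in 𝓝[>] (0 : ℝ), ∀ s, g s t ≤ ε := by
  filter_upwards [h.eventually_le_const (ENNReal.ofReal_pos.2 hε)] with t ht s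
  exact (ENNReal.ofReal_le_ofReal_iff hε.le).1
    ((le_iSup (fun s => ENNReal.ofReal (g s t)) s).trans ht)

lemma rpow_three_halves {r : ℝ} (hr : 0 < r) : r ^ (3 / 2 : ℝ) = r * √r := by
  rw [Real.sqrt_eq_rpow, ← Real.rpow_one_add' hr.le (by norm_num)]
  norm_num

namespace Family

variable {N : ℕ} {T β C a : ℝ} {c c' : ℝ → ℝ} {z zs zt : ℝ → ℝ → ℝ}

/-- The speeds `c_j` cancel in the sum, as `c_{-j} = -c_j`. -/
lemma slipSum_eq_two_mul (h : Family N T β C a c c' z zs zt) (t s : ℝ) :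
    slipSum N T c c' z zs zt t s = 2 * (zt s t - ∑ i ∈ Finset.Icc 1 N,
      (nu N T c c' z zs i s t + nu N T c c' z zs (-i) s t) / (2 * N)) := by
  have hN := h.N_pos
  rw [slipSum, sum_indices]
  have : ∀ i ∈ Finset.Icc 1 N, slip N T c c' z zs zt (i : ℤ) t s + slip N T c c' z zs zt (-i) t s =
      2 / N * zt s t - 2 * ((nu N T c c' z zs i s t + nu N T c c' z zs (-i) s t) / (2 * N)) := by
    intro i _
    rw [slip, slip, coef_neg]
    field_simp
    ring
  rw [Finset.sum_congr rfl this, Finset.sum_sub_distrib, ← Finset.mul_sum, Finset.sum_const,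
    Nat.card_Icc, nsmul_eq_mul]
  simp only [Nat.add_sub_cancel]
  have e : 2 / (N : ℝ) * (N * zt s t) = 2 * zt s t := by field_simp
  rw [mul_sub, Finset.mul_sum, ← e]

/-- The two limits in the hypotheses, in terms of the slips. -/
lemma eventually_slipBound (h : Family N T β C a c c' z zs zt)
    (h1 : ∀ i ∈ indices N,
      Tendsto (fun t => ⨆ s : ℝ, ENNReal.ofReal
          (1 / c s * |deriv (fun τ => z s τ) t - normalVelocity N c z i s t|)) (𝓝[>] 0) (𝓝 0))
    (h2 : Tendsto (fun t => ⨆ s : ℝ, ENNReal.ofReal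
          (1 / (t * c s ^ (3 / 2 : ℝ)) *
            |∫ s' in (0 : ℝ)..s, (deriv (fun τ => z s' τ) t -
              ∑ i ∈ Finset.Icc 1 N,
                (normalVelocity N c z (i : ℤ) s' t +
                  normalVelocity N c z (-(i : ℤ)) s' t) / (2 * N))|)) (𝓝[>] 0) (𝓝 0))
    {ε : ℝ} (hε : 0 < ε) :
    ∀ᶠ t in 𝓝[>] (0 : ℝ), SlipBound N T c c' z zs zt ε t := by
  have e1 : ∀ᶠ t in 𝓝[>] (0 : ℝ), ∀ i ∈ indices N, ∀ s,
      1 / c s * |deriv (fun τ => z s τ) t - normalVelocity N c z i s t| ≤ ε :=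
    (Finset.eventually_all (indices N)).2 fun i hi => eventually_abs_le (h1 i hi) hε
  have e3 : ∀ᶠ t in 𝓝[>] (0 : ℝ), t < T := nhdsWithin_le_nhds (gt_mem_nhds h.T_pos)
  filter_upwards [e1, eventually_abs_le h2 hε, e3, self_mem_nhdsWithin] with t e1 e2 e3
    (e4 : 0 < t)
  have hd : ∀ s, deriv (fun τ => z s τ) t = zt s t := fun s => (h.deriv_t s t ⟨e4, e3⟩).deriv
  refine ⟨fun i hi s => ?_, fun s => ?_⟩
  · have := e1 i hi s
    rw [hd, h.normalVelocity_eq hi e4 e3.le, one_div, inv_mul_le_iff₀ (h.c_pos s)] at this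
    linarith
  · have hc := h.c_pos s
    have hpos : 0 < t * (c s * √(c s)) := by positivity
    have := e2 s
    rw [one_div, rpow_three_halves hc, inv_mul_le_iff₀ hpos] at this
    have e5 : slipInt N T c c' z zs zt t s = 2 * ∫ s' in (0 : ℝ)..s,
        (deriv (fun τ => z s' τ) t - ∑ i ∈ Finset.Icc 1 N,
          (normalVelocity N c z (i : ℤ) s' t +
            normalVelocity N c z (-(i : ℤ)) s' t) / (2 * N)) := by
      rw [slipInt, ← intervalIntegral.integral_const_mul]
      refine intervalIntegral.integral_congr fun r _ => ?_
      simp only [h.slipSum_eq_two_mul, hd]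
      congr 2
      refine Finset.sum_congr rfl fun i hi => ?_
      rw [Finset.mem_Icc] at hi
      have hm := natCast_mem_indices hi.1 hi.2
      rw [h.normalVelocity_eq hm e4 e3.le, h.normalVelocity_eq (neg_mem_indices hm) e4 e3.le]
    rw [e5, abs_mul, abs_two]
    linarith

/-! ### Continuity off the interfaces -/

lemma continuousAt_slip (h : Family N T β C a c c' z zs zt) {j : ℤ} (hj : j ∈ indices N)
    {t s : ℝ} (ht : 0 < t) :
    ContinuousAt (fun q : ℝ × ℝ => slip N T c c' z zs zt j q.1 q.2) (t, s) := by
  have h1 : ContinuousAt (fun q : ℝ × ℝ => nu N T c c' z zs j q.2 q.1) (t, s) :=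
    ContinuousAt.comp (g := fun q : ℝ × ℝ => nu N T c c' z zs j q.1 q.2)
      (f := fun q : ℝ × ℝ => (q.2, q.1)) (h.continuousAt_nu hj ht) (by fun_prop)
  have h2 : Continuous fun q : ℝ × ℝ => zt q.2 q.1 := h.cont_zt.comp continuous_swap
  have h3 := h.cont_c
  have h4 : Continuous fun q : ℝ × ℝ => zt q.2 q.1 + coef N j * c q.2 :=
    h2.add ((h3.comp continuous_snd).const_mul _)
  exact (h4.continuousAt.sub h1).const_mul _

lemma continuousAt_slipSum (h : Family N T β C a c c' z zs zt) {t s : ℝ} (ht : 0 < t) :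
    ContinuousAt (fun q : ℝ × ℝ => slipSum N T c c' z zs zt q.1 q.2) (t, s) :=
  tendsto_finsetSum _ fun _ hj => h.continuousAt_slip hj ht

lemma continuous_slip (h : Family N T β C a c c' z zs zt) {j : ℤ} (hj : j ∈ indices N)
    {t : ℝ} (ht : 0 < t) : Continuous (slip N T c c' z zs zt j t) :=
  continuous_iff_continuousAt.2 fun s => (h.continuousAt_slip hj ht).comp
    (f := fun s : ℝ => (t, s)) (by fun_prop)

lemma continuous_slipSum (h : Family N T β C a c c' z zs zt) {t : ℝ} (ht : 0 < t) :
    Continuous (slipSum N T c c' z zs zt t) :=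
  continuous_finsetSum _ fun _ hj => h.continuous_slip hj ht

lemma continuousAt_slipInt (h : Family N T β C a c c' z zs zt) {t s : ℝ} (ht : 0 < t) :
    ContinuousAt (fun q : ℝ × ℝ => slipInt N T c c' z zs zt q.1 q.2) (t, s) := by
  have hm : ∀ τ : ℝ, 0 < max τ (t / 2) := fun τ => lt_max_of_lt_right (by linarith)
  have h1 : Continuous fun q : (ℝ × ℝ) × ℝ => slipSum N T c c' z zs zt (max q.1.1 (t / 2)) q.2 :=
    continuous_iff_continuousAt.2 fun q => ContinuousAt.comp
      (g := fun q : ℝ × ℝ => slipSum N T c c' z zs zt q.1 q.2)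
      (f := fun q : (ℝ × ℝ) × ℝ => (max q.1.1 (t / 2), q.2)) (h.continuousAt_slipSum (hm _))
      (by fun_prop)
  have h2 : Continuous fun q : ℝ × ℝ =>
      ∫ r in (0 : ℝ)..q.2, slipSum N T c c' z zs zt (max q.1 (t / 2)) r :=
    intervalIntegral.continuous_parametric_intervalIntegral_of_continuous
      (f := fun (q : ℝ × ℝ) r => slipSum N T c c' z zs zt (max q.1 (t / 2)) r) h1 continuous_snd
  refine h2.continuousAt.congr ?_
  have : ∀ᶠ q : ℝ × ℝ in 𝓝 (t, s), t / 2 < q.1 :=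
    continuousAt_fst.eventually_const_lt (by simpa using ht)
  filter_upwards [this] with q hq
  simp only [slipInt, max_eq_left hq.le]

lemma hasDerivAt_slipInt (h : Family N T β C a c c' z zs zt) {t : ℝ} (ht : 0 < t) (s : ℝ) :
    HasDerivAt (slipInt N T c c' z zs zt t) (slipSum N T c c' z zs zt t s) s :=
  (h.continuous_slipSum ht).integral_hasStrictDerivAt 0 s |>.hasDerivAt

lemma hasDerivAt_corr (h : Family N T β C a c c' z zs zt) {t : ℝ} (ht : 0 < t) (s : ℝ) :
    HasDerivAt (corr N T c c' z zs zt t) (corrDeriv N T c c' z zs zt t s) s := by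
  have hW := (h.width_pos (x := s) ht).ne'
  have h1 : HasDerivAt (fun s => 2 * coef N 1 * c s * t) (2 * coef N 1 * c' s * t) s :=
    ((h.deriv_c s).const_mul _).mul_const t
  refine ((h.hasDerivAt_slipInt ht s).div h1 hW).congr_deriv ?_
  rw [corrDeriv, ← h.width_mul_corr ht]
  have hc := (h.c_pos s).ne'
  have hc1 : coef N 1 ≠ 0 := by
    have := coef_pos h.one_le (le_refl 1)
    rw [Nat.cast_one] at this
    exact this.ne'
  have ht' := ht.ne'
  field_simp

lemma continuousAt_corr (h : Family N T β C a c c' z zs zt) {t s : ℝ} (ht : 0 < t) :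
    ContinuousAt (fun q : ℝ × ℝ => corr N T c c' z zs zt q.1 q.2) (t, s) := by
  have hc := h.cont_c
  have h1 : Continuous fun q : ℝ × ℝ => 2 * coef N 1 * c q.2 * q.1 := by fun_prop
  exact (h.continuousAt_slipInt ht).div h1.continuousAt (h.width_pos ht).ne'

lemma continuousAt_corrDeriv (h : Family N T β C a c c' z zs zt) {t s : ℝ} (ht : 0 < t) :
    ContinuousAt (fun q : ℝ × ℝ => corrDeriv N T c c' z zs zt q.1 q.2) (t, s) := by
  have hc := h.cont_c
  have hc' := h.cont_c'
  have h1 : Continuous fun q : ℝ × ℝ => 2 * coef N 1 * c q.2 * q.1 := by fun_prop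
  have h2 : Continuous fun q : ℝ × ℝ => 2 * coef N 1 * c' q.2 * q.1 := by fun_prop
  exact ((h.continuousAt_slipSum ht).sub ((h.continuousAt_corr ht).mul h2.continuousAt)).div
    h1.continuousAt (h.width_pos ht).ne'

variable {p₀ : Plane × ℝ}

/-- Restrictions to the domain above an interface are continuous off the interface. -/
lemma continuousAt_indicator (h : Family N T β C a c c' z zs zt) {j : ℤ}
    (hp : p₀.1 1 ≠ graph N T c z j p₀.2 (p₀.1 0)) {f : ℝ → ℝ × ℝ → ℝ}
    (hf : ContinuousAt (fun p : Plane × ℝ => f p.2 (p.1 0, p.1 1)) p₀) :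
    ContinuousAt (fun p : Plane × ℝ =>
      (above (graph N T c z j p.2)).indicator (f p.2) (p.1 0, p.1 1)) p₀ := by
  have hg := (h.continuous_graph_plane j).continuousAt (x := p₀)
  have hy : ContinuousAt (fun p : Plane × ℝ => p.1 1) p₀ := by fun_prop
  rcases lt_or_gt_of_ne hp with hlt | hgt
  · refine (continuousAt_const (y := (0 : ℝ))).congr ?_
    filter_upwards [hy.eventually_lt hg hlt] with p hp
    have hm : (p.1 0, p.1 1) ∉ above (graph N T c z j p.2) := fun hm => lt_asymm hp hm
    exact (indicator_of_notMem hm _).symm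
  · refine hf.congr ?_
    filter_upwards [hg.eventually_lt hy hgt] with p hp
    exact (indicator_of_mem (show (p.1 0, p.1 1) ∈ above _ from hp) _).symm

/-- Functions of `t` and `x₁` as functions on space-time. -/
lemma continuousAt_lift {f : ℝ → ℝ → ℝ}
    (hf : ContinuousAt (fun q : ℝ × ℝ => f q.1 q.2) (p₀.2, p₀.1 0)) :
    ContinuousAt (fun p : Plane × ℝ => f p.2 (p.1 0)) p₀ :=
  ContinuousAt.comp (g := fun q : ℝ × ℝ => f q.1 q.2) (f := fun p : Plane × ℝ => (p.2, p.1 0)) hf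
    (by fun_prop)

lemma continuousAt_streamSnd (h : Family N T β C a c c' z zs zt) (ht : 0 < p₀.2) (j : ℤ) :
    ContinuousAt (fun p : Plane × ℝ => streamSnd N T c c' z zs zt j p.2 (p.1 0, p.1 1)) p₀ := by
  have h1 := continuousAt_lift (h.continuousAt_corrDeriv (s := p₀.1 0) ht)
  have h2 := continuousAt_lift (h.continuousAt_corr (s := p₀.1 0) ht)
  have h3 := continuousAt_lift (p₀ := p₀) (h.continuous_slope j).continuousAt
  have h4 := (h.continuous_graph_plane j).continuousAt (x := p₀)
  have h5 : ContinuousAt (fun p : Plane × ℝ => p.1 1) p₀ := by fun_prop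
  exact (h1.mul (h5.sub h4)).sub (h2.mul h3)

lemma index_one_mem (h : Family N T β C a c c' z zs zt) : (1 : ℤ) ∈ indices N := by
  simpa using natCast_mem_indices (le_refl 1) h.one_le

lemma continuousAt_corrFst (h : Family N T β C a c c' z zs zt) (ht : 0 < p₀.2)
    (hp : p₀ ∈ offAll N T c z) :
    ContinuousAt (fun p : Plane × ℝ => corrFst N T c c' z zs zt p.2 (p.1 0, p.1 1)) p₀ := by
  have h2 := (continuousAt_lift (h.continuousAt_corr (s := p₀.1 0) ht)).neg
  exact (h.continuousAt_indicator (f := fun t q => -corr N T c c' z zs zt t q.1)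
    (hp _ (neg_mem_indices h.index_one_mem)) h2).sub
    (h.continuousAt_indicator (f := fun t q => -corr N T c c' z zs zt t q.1)
      (hp _ h.index_one_mem) h2)

lemma continuousAt_corrSnd (h : Family N T β C a c c' z zs zt) (ht : 0 < p₀.2)
    (hp : p₀ ∈ offAll N T c z) :
    ContinuousAt (fun p : Plane × ℝ => corrSnd N T c c' z zs zt p.2 (p.1 0, p.1 1)) p₀ := by
  have h1 : ContinuousAt (fun p : Plane × ℝ => ∑ j ∈ indices N,
      (above (graph N T c z j p.2)).indicator
        (fun q => slip N T c c' z zs zt j p.2 q.1) (p.1 0, p.1 1)) p₀ :=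
    tendsto_finsetSum _ fun j hj => h.continuousAt_indicator
      (f := fun t q => slip N T c c' z zs zt j t q.1) (hp j hj)
      (continuousAt_lift (h.continuousAt_slip hj ht))
  exact h1.neg.add ((h.continuousAt_indicator (hp _ (neg_mem_indices h.index_one_mem))
    (h.continuousAt_streamSnd ht (-1))).sub
      (h.continuousAt_indicator (hp _ h.index_one_mem) (h.continuousAt_streamSnd ht 1)))

/-- The part of space-time off the interfaces at times in `(0, T')`. -/
lemma isOpen_regular (h : Family N T β C a c c' z zs zt) (T' : ℝ) :
    IsOpen ({p : Plane × ℝ | 0 < p.2 ∧ p.2 < T'} ∩ offAll N T c z) :=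
  ((isOpen_lt continuous_const continuous_snd).inter
    (isOpen_lt continuous_snd continuous_const)).inter h.isOpen_offAll

lemma ae_regular (h : Family N T β C a c c' z zs zt) (T' : ℝ) :
    ∀ᵐ p : Plane × ℝ ∂(volume.restrict (slab T')),
      p ∈ {p : Plane × ℝ | 0 < p.2 ∧ p.2 < T'} ∩ offAll N T c z := by
  filter_upwards [ae_slab_pos T', ae_restrict_of_ae h.ae_offAll] with p h1 h2 using ⟨h1, h2⟩

variable {T' : ℝ}

lemma density_eq_step_plane (h : Family N T β C a c c' z zs zt) (hT' : T' ≤ T) {p : Plane × ℝ}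
    (hp : p ∈ {p : Plane × ℝ | 0 < p.2 ∧ p.2 < T'} ∩ offAll N T c z) :
    density N c z p = stepDensity N T c z p.2 (p.1 0, p.1 1) := by
  obtain ⟨⟨h1, h2⟩, h3⟩ := hp
  have := h.density_eq_step h1 (h2.trans_le hT').le h3
  rwa [Plane.eta] at this

lemma continuousOn_density (h : Family N T β C a c c' z zs zt) (hT' : T' ≤ T) :
    ContinuousOn (density N c z)
      ({p : Plane × ℝ | 0 < p.2 ∧ p.2 < T'} ∩ offAll N T c z) := by
  have key : ContinuousOn (fun p : Plane × ℝ => stepDensity N T c z p.2 (p.1 0, p.1 1))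
      ({p : Plane × ℝ | 0 < p.2 ∧ p.2 < T'} ∩ offAll N T c z) := fun p hp =>
    (continuousAt_const.add (tendsto_finsetSum _ fun j hj => h.continuousAt_indicator
      (f := fun _ _ => 1 / (N : ℝ)) (hp.2 j hj) continuousAt_const)).continuousWithinAt
  exact key.congr fun p hp => h.density_eq_step_plane hT' hp

lemma velocity_eq_plane (h : Family N T β C a c c' z zs zt) (hT' : T' ≤ T) {p : Plane × ℝ}
    (hp : p ∈ {p : Plane × ℝ | 0 < p.2 ∧ p.2 < T'} ∩ offAll N T c z) :
    velocity N c z p =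
      !₂[u1 N T c z p.2 (p.1 0) (p.1 1), u2 N T c c' z zs p.2 (p.1 0) (p.1 1)] := by
  have ht : p.2 ∈ Icc 0 T := ⟨hp.1.1.le, (hp.1.2.trans_le hT').le⟩
  refine h.velocity_eq ht fun j hj => ?_
  rw [← graph_of_mem ht]
  exact hp.2 j hj

lemma continuousOn_velocity (h : Family N T β C a c c' z zs zt) (hT' : T' ≤ T) :
    ContinuousOn (velocity N c z)
      ({p : Plane × ℝ | 0 < p.2 ∧ p.2 < T'} ∩ offAll N T c z) := by
  have key : ContinuousOn (fun p : Plane × ℝ =>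
      (!₂[u1 N T c z p.2 (p.1 0) (p.1 1), u2 N T c c' z zs p.2 (p.1 0) (p.1 1)] : Plane))
      ({p : Plane × ℝ | 0 < p.2 ∧ p.2 < T'} ∩ offAll N T c z) := fun p hp =>
    ContinuousAt.continuousWithinAt
      (Plane.tendsto_mk (h.continuousAt_u1 hp.2) (h.continuousAt_u2 (c' := c') hp.2))
  exact key.congr fun p hp => h.velocity_eq_plane hT' hp

lemma continuousOn_momentum (h : Family N T β C a c c' z zs zt) (hT' : T' ≤ T) :
    ContinuousOn (momentum N T c c' z zs zt)
      ({p : Plane × ℝ | 0 < p.2 ∧ p.2 < T'} ∩ offAll N T c z) := by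
  refine ((h.continuousOn_density hT').smul (h.continuousOn_velocity hT')).sub fun p hp => ?_
  exact ContinuousAt.continuousWithinAt
    (Plane.tendsto_mk (h.continuousAt_corrFst hp.1.1 hp.2) (h.continuousAt_corrSnd hp.1.1 hp.2))

lemma aestronglyMeasurable_of_continuousOn (h : Family N T β C a c c' z zs zt)
    {E : Type*} [TopologicalSpace E] [TopologicalSpace.PseudoMetrizableSpace E]
    [SecondCountableTopology E] {f : Plane × ℝ → E}
    (hf : ContinuousOn f ({p : Plane × ℝ | 0 < p.2 ∧ p.2 < T'} ∩ offAll N T c z)) :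
    AEStronglyMeasurable f (volume.restrict (slab T')) := by
  have h1 := hf.aestronglyMeasurable (μ := volume) (h.isOpen_regular T').measurableSet
  have h2 : volume.restrict (slab T') ≤
      volume.restrict ({p : Plane × ℝ | 0 < p.2 ∧ p.2 < T'} ∩ offAll N T c z) := by
    have e := Measure.restrict_eq_self_of_ae_mem (h.ae_regular T')
    rw [← e]
    rw [Measure.restrict_restrict (h.isOpen_regular T').measurableSet]
    exact Measure.restrict_mono inter_subset_left le_rfl
  exact h1.mono_measure h2

/-! ### The inequality -/

variable {M cmax θ ε : ℝ}

/-- The inequality off the interfaces, which is strict in the mixing zone. -/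
lemma strict_mix (h : Family N T β C a c c' z zs zt) (hT' : T' ≤ T)
    (hs : IsSmall N T M cmax θ ε) (hb : ∀ t ∈ Ioo 0 T', SlipBound N T c c' z zs zt ε t)
    (hcm : ∀ s, c s ≤ cmax) (hzs : ∀ s, ∀ t ∈ Icc 0 T, |zs s t| ≤ M * √(c s))
    (hcs : ∀ s, |c' s| ≤ M * √(c s)) {p : Plane × ℝ}
    (hp : p ∈ {p : Plane × ℝ | 0 < p.2 ∧ p.2 < T'} ∩ offAll N T c z) :
    (‖defect (density N c z p) (velocity N c z p) (momentum N T c c' z zs zt p)‖ ≤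
      1 / 2 * (1 - density N c z p ^ 2)) ∧ (p ∈ omegaMix c z T' →
    ‖defect (density N c z p) (velocity N c z p) (momentum N T c c' z zs zt p)‖ <
      1 / 2 * (1 - density N c z p ^ 2)) ∧ |density N c z p| ≤ 1 := by
  obtain ⟨⟨h1, h2⟩, h3⟩ := hp
  have ht : p.2 ≤ T := (h2.trans_le hT').le
  obtain ⟨k, l, hL⟩ := h.exists_inLayer h1 ht h3
  have hd := h.density_eq h1 ht h3 hL
  rw [Plane.eta] at hd
  have hN := h.N_pos
  have hNm : N ∈ Finset.Icc 1 N := Finset.mem_Icc.2 ⟨h.one_le, le_rfl⟩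
  have hk := hL.k_le
  have hl := hL.l_le
  have hk' : (k : ℝ) ≤ N := by exact_mod_cast hk
  have hl' : (l : ℝ) ≤ N := by exact_mod_cast hl
  have habs : |density N c z p| ≤ 1 := by
    rw [show density N c z p = ((k : ℝ) - l) / N from hd, abs_div, abs_of_pos hN, div_le_one hN,
      abs_le]
    have : (0 : ℝ) ≤ k := Nat.cast_nonneg k
    have : (0 : ℝ) ≤ l := Nat.cast_nonneg l
    constructor <;> linarith
  have hsq : 0 ≤ 1 - density N c z p ^ 2 := by
    have := (sq_le_one_iff_abs_le_one _).2 habs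
    linarith
  by_cases hkl : k < N ∧ l < N
  · have key := h.corr_strict h1 ht hs (hb _ ⟨h1, h2⟩) (hcm _) (hzs _ _ ⟨h1.le, ht⟩) (hcs _) h3 hL
      hkl.1 hkl.2
    rw [Plane.eta] at key
    have := norm_defect_lt (velocity N c z p) hsq key
    exact ⟨this.le, fun _ => this, habs⟩
  · have hkl' : k = N ∨ l = N := by omega
    refine ⟨?_, fun hm => absurd hm ?_, habs⟩
    · obtain ⟨e1, e2, e3⟩ := h.corr_pure (zs := zs) (zt := zt) (c' := c') h1 ht h3 hL hkl'
      rw [Plane.eta] at e3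
      rw [momentum, e1, e2, defect_eq, show density N c z p ^ 2 = 1 from e3]
      have : (!₂[-0, (1 - 1) / 2 - 0] : Plane) = 0 := by
        ext i; fin_cases i <;> simp
      rw [this]
      simp
    · rw [h.omegaMix_eq hT']
      rintro ⟨-, -, m1, m2⟩
      rcases hkl' with rfl | rfl
      · exact lt_asymm m2 ((hL.upper _ hNm).2 le_rfl)
      · exact lt_irrefl _ ((hL.lower _ hNm).1 m1)

end Family

end Muskat

/-! ### Weak form of the system at a fixed time -/

namespace Muskat

namespace IsSheet

variable {β C a : ℝ} {ζ ζ' : ℝ → ℝ}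

lemma aestronglyMeasurable_vel (h : IsSheet β C a ζ ζ') (ha : 0 < a) (ha1 : a < 1) :
    AEStronglyMeasurable (fun q : ℝ × ℝ => velFst ζ 0 q.1 q.2) ∧
    AEStronglyMeasurable (fun q : ℝ × ℝ => velSnd ζ ζ' 0 q.1 q.2) := by
  have h0 : ∀ q : ℝ × ℝ, q.2 ≠ ζ q.1 → 0 < (q.2 - ζ q.1) ^ 2 + (0 : ℝ) ^ 2 := fun q hq => by
    have := sub_ne_zero.2 hq
    positivity
  have t1 : ∀ q : ℝ × ℝ, q.2 ≠ ζ q.1 →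
      Tendsto (fun e => tanInt ζ e q.1 q.2) (𝓝[≠] 0) (𝓝 (tanInt ζ 0 q.1 q.2)) := fun q hq =>
    (h.tendsto_tanInt ha hq).mono_left nhdsWithin_le_nhds
  constructor
  · have key : ∀ e : ℝ, AEStronglyMeasurable (fun q : ℝ × ℝ =>
        if e = 0 then 0 else velFst ζ e q.1 q.2) := by
      intro e
      by_cases he : e = 0
      · simp only [he, if_true]; exact aestronglyMeasurable_const
      · simp only [he, if_false]; exact (h.continuous_velFst ha he).aestronglyMeasurable
    refine aestronglyMeasurable_of_tendsto_ae (𝓝[≠] (0 : ℝ)) key ?_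
    filter_upwards [ae_off_graph h.continuous] with q hq
    refine ((t1 q hq).const_mul _).congr' ?_
    filter_upwards [self_mem_nhdsWithin] with e (he : e ≠ 0)
    rw [if_neg he, velFst]
  · have key : ∀ e : ℝ, AEStronglyMeasurable (fun q : ℝ × ℝ =>
        if e = 0 then 0 else velSnd ζ ζ' e q.1 q.2) := by
      intro e
      by_cases he : e = 0
      · simp only [he, if_true]; exact aestronglyMeasurable_const
      · simp only [he, if_false]; exact (h.continuous_velSnd ha ha1 he).aestronglyMeasurable
    refine aestronglyMeasurable_of_tendsto_ae (𝓝[≠] (0 : ℝ)) key ?_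
    filter_upwards [ae_off_graph h.continuous] with q hq
    have t2 := (h.tendsto_norInt ha ha1 q.1 q.2).mono_left (nhdsWithin_le_nhds (s := {0}ᶜ))
    refine ((t2.add ((t1 q hq).const_mul _)).const_mul _).congr' ?_
    filter_upwards [self_mem_nhdsWithin] with e (he : e ≠ 0)
    rw [if_neg he, velSnd]

/-- The velocity of a sheet is locally integrable. -/
lemma integrable_vel (h : IsSheet β C a ζ ζ') (ha : 0 < a) (ha1 : a < 1) {f g : ℝ × ℝ → ℝ}
    (hf : Integrable f) (hg : Integrable g) :
    Integrable fun q : ℝ × ℝ => velFst ζ 0 q.1 q.2 * f q + velSnd ζ ζ' 0 q.1 q.2 * g q := by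
  obtain ⟨m1, m2⟩ := h.aestronglyMeasurable_vel ha ha1
  exact (hf.bdd_mul m1 (Eventually.of_forall fun q => h.abs_velFst_le ha 0 q.1 q.2)).add
    (hg.bdd_mul m2 (Eventually.of_forall fun q => h.abs_velSnd_le ha 0 q.1 q.2))

end IsSheet

lemma integral_d1 {φ : ℝ × ℝ → ℝ} (hφ : ContDiff ℝ 1 φ) (hc : HasCompactSupport φ) :
    ∫ q, d1 φ q = 0 := by
  obtain ⟨B, -, hB⟩ := exists_box (hasCompactSupport_d1 hc)
  have key := integral_above_d1 (g := fun _ => -B - 1) (g' := fun _ => 0)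
    (fun s => hasDerivAt_const s _) continuous_const hφ hc
  simp only [zero_mul, integral_zero] at key
  rw [← key]
  refine (setIntegral_eq_integral_of_forall_compl_eq_zero fun q hq => hB q fun hm => hq ?_).symm
  have := hm.2.1
  simp only [above, mem_ofPred_eq]
  linarith

namespace Family

variable {N : ℕ} {T β C a : ℝ} {c c' : ℝ → ℝ} {z zs zt : ℝ → ℝ → ℝ}
variable {t : ℝ} {φ : ℝ × ℝ → ℝ}

lemma sum_vel (t : ℝ) (f g : ℝ × ℝ → ℝ) (q : ℝ × ℝ) :
    ∑ j ∈ indices N, (1 / (N : ℝ)) * (velFst (graph N T c z j t) 0 q.1 q.2 * f q +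
      velSnd (graph N T c z j t) (slope N T c' zs j t) 0 q.1 q.2 * g q) =
    u1 N T c z t q.1 q.2 * f q + u2 N T c c' z zs t q.1 q.2 * g q := by
  rw [u1, u2, Finset.sum_mul, Finset.sum_mul, ← Finset.sum_add_distrib]
  exact Finset.sum_congr rfl fun j _ => by ring

/-- `div u = 0`. -/
lemma integral_div (h : Family N T β C a c c' z zs zt) (hφ : ContDiff ℝ 1 φ)
    (hc : HasCompactSupport φ) :
    ∫ q : ℝ × ℝ, (u1 N T c z t q.1 q.2 * d1 φ q + u2 N T c c' z zs t q.1 q.2 * d2 φ q) = 0 := by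
  have i1 := (continuous_d1 hφ).integrable_of_hasCompactSupport (μ := volume)
    (hasCompactSupport_d1 hc)
  have i2 := (continuous_d2 hφ).integrable_of_hasCompactSupport (μ := volume)
    (hasCompactSupport_d2 hc)
  simp only [← sum_vel]
  rw [integral_finsetSum _ fun j hj =>
    ((h.isSheet hj t).integrable_vel h.a_pos h.a_lt i1 i2).const_mul _]
  refine Finset.sum_eq_zero fun j hj => ?_
  rw [integral_const_mul, (h.isSheet hj t).integral_vel_div h.a_pos h.a_lt hφ hc, mul_zero]

lemma integrable_indicator_above (h : Family N T β C a c c' z zs zt) (j : ℤ) {f : ℝ × ℝ → ℝ}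
    (hf : Integrable f) : Integrable ((above (graph N T c z j t)).indicator f) :=
  hf.indicator (measurableSet_above ((h.continuous_graph j).comp (Continuous.prodMk_right t)))

lemma integral_indicator_above (h : Family N T β C a c c' z zs zt) (j : ℤ) (f : ℝ × ℝ → ℝ) :
    ∫ q, (above (graph N T c z j t)).indicator f q = ∫ q in above (graph N T c z j t), f q :=
  integral_indicator
    (measurableSet_above ((h.continuous_graph j).comp (Continuous.prodMk_right t)))

lemma continuous_slope_at (h : Family N T β C a c c' z zs zt) (j : ℤ) (t : ℝ) :
    Continuous (slope N T c' zs j t) := (h.continuous_slope j).comp (Continuous.prodMk_right t)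

lemma continuous_graph_at (h : Family N T β C a c c' z zs zt) (j : ℤ) (t : ℝ) :
    Continuous (graph N T c z j t) := (h.continuous_graph j).comp (Continuous.prodMk_right t)

/-- Integration against the density. -/
lemma integral_stepDensity_mul (h : Family N T β C a c c' z zs zt) (t : ℝ) {f : ℝ × ℝ → ℝ}
    (hf : Integrable f) :
    Integrable (fun q => stepDensity N T c z t q * f q) ∧
    ∫ q, stepDensity N T c z t q * f q =
      -(∫ q, f q) + ∑ j ∈ indices N, 1 / (N : ℝ) * ∫ q in above (graph N T c z j t), f q := by
  have e : ∀ q, stepDensity N T c z t q * f q =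
      -f q + ∑ j ∈ indices N, 1 / (N : ℝ) * (above (graph N T c z j t)).indicator f q := by
    intro q
    rw [stepDensity, add_mul, neg_one_mul, Finset.sum_mul]
    congr 1
    refine Finset.sum_congr rfl fun j _ => ?_
    by_cases hq : q ∈ above (graph N T c z j t) <;> simp [hq]
  have i3 : Integrable fun q => ∑ j ∈ indices N, (1 / (N : ℝ)) *
      (above (graph N T c z j t)).indicator f q :=
    integrable_finsetSum _ fun j _ => (h.integrable_indicator_above j hf).const_mul _
  have i4 : Integrable fun q => -f q := hf.neg
  simp only [e]
  refine ⟨i4.add i3, ?_⟩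
  rw [integral_add i4 i3, integral_neg,
    integral_finsetSum _ fun j hj => (h.integrable_indicator_above j hf).const_mul _]
  congr 1
  refine Finset.sum_congr rfl fun j _ => ?_
  rw [integral_const_mul, h.integral_indicator_above]

/-- `curl u = -∂₁ρ`. -/
lemma integral_curl (h : Family N T β C a c c' z zs zt) (hφ : ContDiff ℝ 1 φ)
    (hc : HasCompactSupport φ) :
    ∫ q : ℝ × ℝ, (u2 N T c c' z zs t q.1 q.2 * d1 φ q - u1 N T c z t q.1 q.2 * d2 φ q) =
      -∫ q : ℝ × ℝ, stepDensity N T c z t q * d1 φ q := by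
  have i1 := (continuous_d1 hφ).integrable_of_hasCompactSupport (μ := volume)
    (hasCompactSupport_d1 hc)
  have i2 := (continuous_d2 hφ).integrable_of_hasCompactSupport (μ := volume)
    (hasCompactSupport_d2 hc)
  have e1 : ∀ q : ℝ × ℝ, u2 N T c c' z zs t q.1 q.2 * d1 φ q - u1 N T c z t q.1 q.2 * d2 φ q =
      ∑ j ∈ indices N, (1 / (N : ℝ)) * (velFst (graph N T c z j t) 0 q.1 q.2 * (-d2 φ q) +
        velSnd (graph N T c z j t) (slope N T c' zs j t) 0 q.1 q.2 * d1 φ q) := by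
    intro q
    rw [sum_vel t (fun q => -d2 φ q) (d1 φ)]
    ring
  have i5 : Integrable fun q => -d2 φ q := i2.neg
  simp only [e1]
  rw [(h.integral_stepDensity_mul t i1).2, integral_d1 hφ hc, neg_zero, zero_add,
    integral_finsetSum _ fun j hj =>
      ((h.isSheet hj t).integrable_vel h.a_pos h.a_lt i5 i1).const_mul _,
    ← Finset.sum_neg_distrib]
  refine Finset.sum_congr rfl fun j hj => ?_
  rw [integral_const_mul,
    integral_above_d1 (h.hasDerivAt_graph j t) (h.continuous_slope_at j t) hφ hc,
    (h.isSheet hj t).integral_vel_curl h.a_pos hφ hc, mul_neg]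
  simp only [mul_comm]

lemma continuous_flux (h : Family N T β C a c c' z zs zt) {i j : ℤ} (hi : i ∈ indices N)
    (hj : j ∈ indices N) (ht : 0 < t) :
    Continuous fun s => fluxAt (graph N T c z j t) (slope N T c' zs j t) 0
      (slope N T c' zs i t s) s (graph N T c z i t s) :=
  continuous_iff_continuousAt.2 fun s => continuousAt_fluxAt (P := ℝ)
    (ζ := fun _ => graph N T c z j t) (ζ' := fun _ => slope N T c' zs j t)
    h.a_pos h.a_lt (fun _ => h.isSheet hj t) ((h.continuous_graph_at j t).comp continuous_snd)
    ((h.continuous_slope_at j t).comp continuous_snd) (h.continuous_slope_at i t).continuousAt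
    continuousAt_id (h.continuous_graph_at i t).continuousAt (by
      by_cases hij : i = j
      · right; rw [hij]
      · left; exact h.graph_ne hi hj hij ht s)

/-- The flux of `u` through the `i`-th interface. -/
lemma integral_above_u (h : Family N T β C a c c' z zs zt) {i : ℤ} (hi : i ∈ indices N)
    (ht : 0 < t) (hφ : ContDiff ℝ 1 φ) (hc : HasCompactSupport φ) :
    ∫ q in above (graph N T c z i t),
      (u1 N T c z t q.1 q.2 * d1 φ q + u2 N T c c' z zs t q.1 q.2 * d2 φ q) =
    -∫ s, φ (s, graph N T c z i t s) * nu N T c c' z zs i s t := by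
  have i1 := (continuous_d1 hφ).integrable_of_hasCompactSupport (μ := volume)
    (hasCompactSupport_d1 hc)
  have i2 := (continuous_d2 hφ).integrable_of_hasCompactSupport (μ := volume)
    (hasCompactSupport_d2 hc)
  simp only [← sum_vel]
  rw [integral_finsetSum _ fun j hj =>
    (((h.isSheet hj t).integrable_vel h.a_pos h.a_lt i1 i2).const_mul _).integrableOn]
  have e1 : ∀ s, φ (s, graph N T c z i t s) * nu N T c c' z zs i s t =
      ∑ j ∈ indices N, (1 / (N : ℝ)) * (φ (s, graph N T c z i t s) *
        fluxAt (graph N T c z j t) (slope N T c' zs j t) 0 (slope N T c' zs i t s) s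
          (graph N T c z i t s)) := by
    intro s
    rw [nu, Finset.mul_sum]
    exact Finset.sum_congr rfl fun j _ => by ring
  simp only [e1]
  rw [integral_finsetSum _ fun j hj => (IsSheet.integrable_curve (h.continuous_graph_at i t)
    (h.continuous_flux hi hj ht) hφ.continuous hc).const_mul _, ← Finset.sum_neg_distrib]
  refine Finset.sum_congr rfl fun j hj => ?_
  rw [integral_const_mul, integral_const_mul,
    (h.isSheet hj t).integral_above_vel h.a_pos h.a_lt (h.hasDerivAt_graph i t)
      (h.continuous_slope_at i t) (fun s hs => ?_) hφ hc, mul_neg]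
  by_cases hij : i = j
  · rw [hij]
  · exact absurd hs (h.graph_ne hi hj hij ht s)

lemma integral_above_slip (h : Family N T β C a c c' z zs zt) {i : ℤ} (hi : i ∈ indices N)
    (ht : 0 < t) (hφ : ContDiff ℝ 1 φ) (hc : HasCompactSupport φ) :
    ∫ q in above (graph N T c z i t), slip N T c c' z zs zt i t q.1 * d2 φ q =
      -∫ s, φ (s, graph N T c z i t s) * slip N T c c' z zs zt i t s := by
  have hs := h.continuous_slip hi ht
  have hd : ∀ s y, HasDerivAt (fun y => φ (s, y)) (d2 φ (s, y)) y := fun s y =>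
    (hasDerivAt_comp_curve (hφ.differentiable one_ne_zero) (hasDerivAt_const y s)
      (hasDerivAt_id y)).congr_deriv (by simp)
  have := integral_above_deriv_snd (h.continuous_graph_at i t)
    (F := fun q => slip N T c c' z zs zt i t q.1 * φ q)
    (F' := fun q => slip N T c c' z zs zt i t q.1 * d2 φ q)
    (fun s y => (hd s y).const_mul (slip N T c c' z zs zt i t s))
    ((hs.comp continuous_fst).mul (continuous_d2 hφ)) hc.mul_left (hasCompactSupport_d2 hc).mul_left
  rw [this]
  simp only [mul_comm]

lemma continuous_corr (h : Family N T β C a c c' z zs zt) (ht : 0 < t) :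
    Continuous (corr N T c c' z zs zt t) :=
  continuous_iff_continuousAt.2 fun s => (h.hasDerivAt_corr ht s).continuousAt

lemma continuous_corrDeriv (h : Family N T β C a c c' z zs zt) (ht : 0 < t) :
    Continuous (corrDeriv N T c c' z zs zt t) :=
  continuous_iff_continuousAt.2 fun s => (h.continuousAt_corrDeriv ht).comp
    (f := fun s : ℝ => (t, s)) (by fun_prop)

/-- The momentum equation: at a fixed time the divergence of the momentum is concentrated on the
interfaces, with density given by their vertical speed `∂ₜz + cᵢ`. -/
lemma integral_momentum (h : Family N T β C a c c' z zs zt)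
    (ht : 0 < t) (hφ : ContDiff ℝ 1 φ) (hc : HasCompactSupport φ) :
    Integrable (fun q : ℝ × ℝ =>
      ((stepDensity N T c z t q *
          u1 N T c z t q.1 q.2 - corrFst N T c c' z zs zt t q) * d1 φ q +
       (stepDensity N T c z t q *
          u2 N T c c' z zs t q.1 q.2 - corrSnd N T c c' z zs zt t q) * d2 φ q)) ∧
    ∫ q : ℝ × ℝ,
      ((stepDensity N T c z t q *
          u1 N T c z t q.1 q.2 - corrFst N T c c' z zs zt t q) * d1 φ q +
       (stepDensity N T c z t q *
          u2 N T c c' z zs t q.1 q.2 - corrSnd N T c c' z zs zt t q) * d2 φ q) =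
    -∑ j ∈ indices N, 1 / (N : ℝ) *
      ∫ s, φ (s, graph N T c z j t s) * (zt s t + coef N j * c s) := by
  have i1 := (continuous_d1 hφ).integrable_of_hasCompactSupport (μ := volume)
    (hasCompactSupport_d1 hc)
  have i2 := (continuous_d2 hφ).integrable_of_hasCompactSupport (μ := volume)
    (hasCompactSupport_d2 hc)
  -- The contributions of `ρ u`, of the stream fields and of the slips. The second one vanishes, and
  -- the sum of the other two on the `j`-th interface is `u_ν + (∂ₜz + c_j - u_ν)`, up to `1/N`.
  set V : ℝ × ℝ → ℝ := fun q => u1 N T c z t q.1 q.2 * d1 φ q + u2 N T c c' z zs t q.1 q.2 * d2 φ q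
    with hV
  set S : ℤ → ℝ × ℝ → ℝ := fun j q => -corr N T c c' z zs zt t q.1 * d1 φ q +
    streamSnd N T c c' z zs zt j t q * d2 φ q with hS
  set D : ℤ → ℝ × ℝ → ℝ := fun j q => slip N T c c' z zs zt j t q.1 * d2 φ q with hD
  have iV : Integrable V := by
    simp only [hV, ← sum_vel]
    exact integrable_finsetSum _ fun j hj =>
      ((h.isSheet hj t).integrable_vel h.a_pos h.a_lt i1 i2).const_mul _
  have cd1 := continuous_d1 hφ
  have cd2 := continuous_d2 hφ
  have iS : ∀ j, Integrable (S j) := by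
    intro j
    have c1 := h.continuous_corr ht
    have c2 := h.continuous_corrDeriv ht
    have c3 := h.continuous_graph_at j t
    have c4 := h.continuous_slope_at j t
    refine Integrable.add ?_ ?_
    · refine Continuous.integrable_of_hasCompactSupport (by fun_prop)
        (hasCompactSupport_d1 hc).mul_left
    · refine Continuous.integrable_of_hasCompactSupport ?_ (hasCompactSupport_d2 hc).mul_left
      unfold streamSnd
      fun_prop
  have iD : ∀ j ∈ indices N, Integrable (D j) := by
    intro j hj
    have := h.continuous_slip hj ht
    exact Continuous.integrable_of_hasCompactSupport (by fun_prop)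
      (hasCompactSupport_d2 hc).mul_left
  have e1 : ∀ q : ℝ × ℝ,
      ((stepDensity N T c z t q *
          u1 N T c z t q.1 q.2 - corrFst N T c c' z zs zt t q) * d1 φ q +
       (stepDensity N T c z t q *
          u2 N T c c' z zs t q.1 q.2 - corrSnd N T c c' z zs zt t q) * d2 φ q) =
      -V q + ∑ j ∈ indices N, (1 / (N : ℝ) * (above (graph N T c z j t)).indicator V q +
        (above (graph N T c z j t)).indicator (D j) q) +
      ((above (graph N T c z 1 t)).indicator (S 1) q -
        (above (graph N T c z (-1) t)).indicator (S (-1)) q) := by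
    intro q
    have a1 : (∑ j ∈ indices N,
        (above (graph N T c z j t)).indicator (fun _ => 1 / (N : ℝ)) q) * V q =
        ∑ j ∈ indices N, 1 / (N : ℝ) * (above (graph N T c z j t)).indicator V q := by
      rw [Finset.sum_mul]
      refine Finset.sum_congr rfl fun j _ => ?_
      by_cases hq : q ∈ above (graph N T c z j t) <;> simp [hq]
    have a2 : (∑ j ∈ indices N, (above (graph N T c z j t)).indicator
        (fun q => slip N T c c' z zs zt j t q.1) q) * d2 φ q =
        ∑ j ∈ indices N, (above (graph N T c z j t)).indicator (D j) q := by
      rw [Finset.sum_mul]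
      refine Finset.sum_congr rfl fun j _ => ?_
      by_cases hq : q ∈ above (graph N T c z j t) <;> simp [hq, hD]
    have a3 : ∀ j, (above (graph N T c z j t)).indicator (S j) q =
        (above (graph N T c z j t)).indicator (fun q => -corr N T c c' z zs zt t q.1) q * d1 φ q +
        (above (graph N T c z j t)).indicator (streamSnd N T c c' z zs zt j t) q * d2 φ q := by
      intro j
      by_cases hq : q ∈ above (graph N T c z j t) <;> simp [hq, hS]
    rw [Finset.sum_add_distrib, ← a1, ← a2, a3, a3, corrFst, corrSnd, hV,
      stepDensity]
    ring
  have iA : ∀ j ∈ indices N, Integrable fun q =>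
      1 / (N : ℝ) * (above (graph N T c z j t)).indicator V q +
        (above (graph N T c z j t)).indicator (D j) q := fun j hj =>
    ((h.integrable_indicator_above j iV).const_mul _).add (h.integrable_indicator_above j (iD j hj))
  have iT := integrable_finsetSum _ iA
  have iB : Integrable fun q => (above (graph N T c z 1 t)).indicator (S 1) q -
        (above (graph N T c z (-1) t)).indicator (S (-1)) q :=
    (h.integrable_indicator_above 1 (iS 1)).sub (h.integrable_indicator_above (-1) (iS (-1)))
  have iVn : Integrable fun q => -V q := iV.neg
  have iVT : Integrable fun q => -V q + ∑ j ∈ indices N,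
      (1 / (N : ℝ) * (above (graph N T c z j t)).indicator V q +
        (above (graph N T c z j t)).indicator (D j) q) := iVn.add iT
  have zS : ∀ j, ∫ q in above (graph N T c z j t), S j q = 0 := fun j =>
    integral_above_stream (h.hasDerivAt_graph j t) (h.continuous_slope_at j t)
      (h.hasDerivAt_corr ht) (h.continuous_corrDeriv ht) hφ hc
  simp only [e1]
  refine ⟨iVT.add iB, ?_⟩
  rw [integral_add iVT iB, integral_add iVn iT, integral_neg, h.integral_div hφ hc,
    integral_sub (h.integrable_indicator_above 1 (iS 1))
      (h.integrable_indicator_above (-1) (iS (-1))),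
    h.integral_indicator_above, h.integral_indicator_above, zS, zS, sub_zero, add_zero, neg_zero,
    zero_add, integral_finsetSum _ iA, ← Finset.sum_neg_distrib]
  refine Finset.sum_congr rfl fun j hj => ?_
  have k1 : Integrable fun s => φ (s, graph N T c z j t s) * nu N T c c' z zs j s t := by
    refine IsSheet.integrable_curve (h.continuous_graph_at j t) ?_ hφ.continuous hc
    exact continuous_iff_continuousAt.2 fun s => (h.continuousAt_nu hj ht).comp
      (f := fun s : ℝ => (s, t)) (by fun_prop)
  have k2 := IsSheet.integrable_curve (h.continuous_graph_at j t) (h.continuous_slip hj ht)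
    hφ.continuous hc
  rw [integral_add ((h.integrable_indicator_above j iV).const_mul _)
    (h.integrable_indicator_above j (iD j hj)), integral_const_mul, h.integral_indicator_above,
    h.integral_indicator_above, h.integral_above_u hj ht hφ hc, h.integral_above_slip hj ht hφ hc,
    mul_neg, ← neg_add, ← integral_const_mul, ← integral_const_mul,
    ← integral_add (k1.const_mul _) k2]
  congr 2
  ext s
  rw [slip]
  ring

end Family

end Muskat

/-! ### Transport in time -/

namespace Muskat

/-- Time derivative of a function on `(ℝ × ℝ) × ℝ`. -/
noncomputable def dTime (Φ : (ℝ × ℝ) × ℝ → ℝ) (p : (ℝ × ℝ) × ℝ) : ℝ := fderiv ℝ Φ p (0, 1)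

section

variable {Φ : (ℝ × ℝ) × ℝ → ℝ}

lemma continuous_dTime (hΦ : ContDiff ℝ 1 Φ) : Continuous (dTime Φ) :=
  (hΦ.continuous_fderiv one_ne_zero).clm_apply continuous_const

lemma hasCompactSupport_dTime (hc : HasCompactSupport Φ) : HasCompactSupport (dTime Φ) :=
  hc.fderiv_apply ℝ _

lemma contDiff_slice (hΦ : ContDiff ℝ 1 Φ) (t : ℝ) : ContDiff ℝ 1 fun q => Φ (q, t) :=
  hΦ.comp (contDiff_id.prodMk contDiff_const)

lemma hasCompactSupport_slice {f : (ℝ × ℝ) × ℝ → ℝ} (hc : HasCompactSupport f) (t : ℝ) :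
    HasCompactSupport fun q => f (q, t) := by
  refine HasCompactSupport.intro (hc.isCompact.image continuous_fst) fun q hq => ?_
  by_contra h
  exact hq ⟨(q, t), subset_tsupport _ h, rfl⟩

lemma fderiv_slice (hΦ : ContDiff ℝ 1 Φ) (t : ℝ) (q v : ℝ × ℝ) :
    fderiv ℝ (fun q => Φ (q, t)) q v = fderiv ℝ Φ (q, t) (v, 0) := by
  have h1 : HasFDerivAt (fun q : ℝ × ℝ => (q, t)) (ContinuousLinearMap.inl ℝ (ℝ × ℝ) ℝ) q :=
    hasFDerivAt_prodMk_left q t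
  have h2 := ((hΦ.differentiable one_ne_zero) (q, t)).hasFDerivAt.comp q h1
  have h3 : fderiv ℝ (fun q => Φ (q, t)) q = _ := h2.fderiv
  rw [h3]
  rfl

lemma hasDerivAt_along (hΦ : ContDiff ℝ 1 Φ) {g : ℝ → ℝ} {g' s y t : ℝ} (hg : HasDerivAt g g' t) :
    HasDerivAt (fun τ => Φ ((s, g τ + y), τ))
      (dTime Φ ((s, g t + y), t) + g' * d2 (fun q => Φ (q, t)) (s, g t + y)) t := by
  have h1 : HasDerivAt (fun τ => (((s, g τ + y), τ) : (ℝ × ℝ) × ℝ)) ((0, g'), 1) t :=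
    (((hasDerivAt_const t s).prodMk (hg.add_const y))).prodMk (hasDerivAt_id t)
  have h2 := ((hΦ.differentiable one_ne_zero) ((s, g t + y), t)).hasFDerivAt.comp_hasDerivAt
    (f := fun τ => (((s, g τ + y), τ) : (ℝ × ℝ) × ℝ)) t h1
  refine h2.congr_deriv ?_
  have e : (((0, g'), 1) : (ℝ × ℝ) × ℝ) = (0, 1) + g' • ((0, 1), 0) := by simp
  rw [e, map_add, map_smul, d2, fderiv_slice hΦ]
  rfl

end

/-- Fundamental theorem of calculus in time, integrated over a set in space. -/
lemma integral_time {F H : (ℝ × ℝ) × ℝ → ℝ} {T' : ℝ} (hT' : 0 < T')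
    (hH : Continuous H) (hc : HasCompactSupport H)
    (hF : ∀ q, ContinuousOn (fun t => F (q, t)) (Icc 0 T'))
    (hd : ∀ q, ∀ t ∈ Ioo 0 T', HasDerivAt (fun t => F (q, t)) (H (q, t)) t)
    (h0 : ∀ q, F (q, T') = 0) (S : Set (ℝ × ℝ)) :
    IntegrableOn (fun t => ∫ q in S, H (q, t)) (Ioo 0 T') ∧
      ∫ t in Ioo 0 T', ∫ q in S, H (q, t) = -∫ q in S, F (q, 0) := by
  have hI : Integrable H ((volume.restrict S).prod (volume.restrict (Ioo 0 T'))) := by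
    rw [Measure.prod_restrict]
    exact (hH.integrable_of_hasCompactSupport hc).integrableOn
  refine ⟨hI.integral_prod_right, ?_⟩
  rw [← integral_prod_symm _ hI, integral_prod _ hI, ← integral_neg]
  congr 1
  ext q
  have hHq : Continuous fun t => H (q, t) := hH.comp (Continuous.prodMk_right q)
  rw [← integral_Ioc_eq_integral_Ioo, ← intervalIntegral.integral_of_le hT'.le,
    intervalIntegral.integral_eq_sub_of_hasDerivAt_of_le hT'.le (hF q) (hd q)
      (hHq.intervalIntegrable _ _), h0, zero_sub]

lemma integral_shear {g : ℝ → ℝ} (hg : Continuous g) {f : ℝ × ℝ → ℝ} (hf : Continuous f)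
    (hc : HasCompactSupport f) :
    ∫ q in univ ×ˢ Ioi 0, f (q.1, g q.1 + q.2) = ∫ q in above g, f q := by
  have h1 : HasCompactSupport fun q : ℝ × ℝ => f (q.1, g q.1 + q.2) := hc.comp_homeomorph (shear hg)
  have h2 : Continuous fun q : ℝ × ℝ => f (q.1, g q.1 + q.2) := by fun_prop
  rw [setIntegral_above hg (hf.integrable_of_hasCompactSupport hc), Measure.volume_eq_prod,
    setIntegral_prod _ (h2.integrable_of_hasCompactSupport h1).integrableOn, setIntegral_univ]
  congr 1
  ext s
  exact (integral_Ioi_shift (fun y => f (s, y)) (g s)).symm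

namespace Family

variable {N : ℕ} {T β C a : ℝ} {c c' : ℝ → ℝ} {z zs zt : ℝ → ℝ → ℝ} {T' : ℝ}
variable {Φ : (ℝ × ℝ) × ℝ → ℝ}

lemma hasDerivAt_graph_time {t : ℝ} (h : Family N T β C a c c' z zs zt) (j : ℤ) (s : ℝ)
    (ht : t ∈ Ioo 0 T) :
    HasDerivAt (fun τ => graph N T c z j τ s) (zt s t + coef N j * c s) t := by
  have h1 : HasDerivAt (fun τ => z s τ + coef N j * c s * τ) (zt s t + coef N j * c s * 1) t :=
    (h.deriv_t s t ht).add ((hasDerivAt_id t).const_mul _)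
  rw [mul_one] at h1
  refine h1.congr_of_eventuallyEq ?_
  filter_upwards [Icc_mem_nhds ht.1 ht.2] with τ hτ using graph_eq hτ j s

/-- The shear of space-time that maps the `j`-th interface to `ℝ × {0} × ℝ`, inverted. -/
noncomputable def spaceTimeShear (h : Family N T β C a c c' z zs zt) (j : ℤ) :
    (ℝ × ℝ) × ℝ ≃ₜ (ℝ × ℝ) × ℝ where
  toFun p := ((p.1.1, graph N T c z j p.2 p.1.1 + p.1.2), p.2)
  invFun p := ((p.1.1, p.1.2 - graph N T c z j p.2 p.1.1), p.2)
  left_inv p := by simp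
  right_inv p := by simp
  continuous_toFun := by
    have := (h.continuous_graph j).comp (f := fun p : (ℝ × ℝ) × ℝ => (p.2, p.1.1)) (by fun_prop)
    simp only [Function.comp_def] at this
    fun_prop
  continuous_invFun := by
    have := (h.continuous_graph j).comp (f := fun p : (ℝ × ℝ) × ℝ => (p.2, p.1.1)) (by fun_prop)
    simp only [Function.comp_def] at this
    fun_prop

/-- Reynolds' transport theorem for the moving domain above the `j`-th interface. -/
lemma transport_above (h : Family N T β C a c c' z zs zt) (hT'0 : 0 < T') (hT' : T' ≤ T)
    (hΦ : ContDiff ℝ 1 Φ) (hc : HasCompactSupport Φ) (hend : ∀ q, Φ (q, T') = 0) (j : ℤ) :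
    IntegrableOn (fun t => (∫ q in above (graph N T c z j t), dTime Φ (q, t)) -
        ∫ s, Φ ((s, graph N T c z j t s), t) * (zt s t + coef N j * c s)) (Ioo 0 T') ∧
      ∫ t in Ioo 0 T', ((∫ q in above (graph N T c z j t), dTime Φ (q, t)) -
        ∫ s, Φ ((s, graph N T c z j t s), t) * (zt s t + coef N j * c s)) =
      -∫ q in above (graph N T c z j 0), Φ (q, 0) := by
  set E := h.spaceTimeShear j with hE
  have cE : Continuous E := E.continuous
  have ck : Continuous fun p : (ℝ × ℝ) × ℝ => zt p.1.1 p.2 + coef N j * c p.1.1 := by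
    have h1 := h.cont_zt.comp (f := fun p : (ℝ × ℝ) × ℝ => (p.1.1, p.2)) (by fun_prop)
    have h2 := h.cont_c.comp (f := fun p : (ℝ × ℝ) × ℝ => p.1.1) (by fun_prop)
    exact h1.add (h2.const_mul _)
  have cT := continuous_dTime hΦ
  have sT := hasCompactSupport_dTime hc
  have cX : Continuous fun p : (ℝ × ℝ) × ℝ => fderiv ℝ Φ p ((0, 1), 0) :=
    (hΦ.continuous_fderiv one_ne_zero).clm_apply continuous_const
  have sX : HasCompactSupport fun p : (ℝ × ℝ) × ℝ => fderiv ℝ Φ p ((0, 1), 0) := hc.fderiv_apply ℝ _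
  have hH : Continuous fun p => dTime Φ (E p) + (zt p.1.1 p.2 + coef N j * c p.1.1) *
      fderiv ℝ Φ (E p) ((0, 1), 0) := (cT.comp cE).add (ck.mul (cX.comp cE))
  have sH : HasCompactSupport fun p => dTime Φ (E p) + (zt p.1.1 p.2 + coef N j * c p.1.1) *
      fderiv ℝ Φ (E p) ((0, 1), 0) :=
    (sT.comp_homeomorph E).add (HasCompactSupport.mul_left (sX.comp_homeomorph E))
  have key := integral_time (F := fun p => Φ (E p)) hT'0 hH sH
    (fun q => ((hΦ.continuous.comp cE).comp (Continuous.prodMk_right q)).continuousOn)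
    (fun q t ht => (hasDerivAt_along hΦ (s := q.1) (y := q.2)
      (h.hasDerivAt_graph_time j q.1 ⟨ht.1, ht.2.trans_le hT'⟩)).congr_deriv (by
        rw [d2, fderiv_slice hΦ]; rfl))
    (fun q => hend _) (univ ×ˢ Ioi 0)
  have e1 : ∀ t, ∫ q in univ ×ˢ Ioi 0, (dTime Φ (E (q, t)) +
        (zt (q, t).1.1 (q, t).2 + coef N j * c (q, t).1.1) * fderiv ℝ Φ (E (q, t)) ((0, 1), 0)) =
      (∫ q in above (graph N T c z j t), dTime Φ (q, t)) -
        ∫ s, Φ ((s, graph N T c z j t s), t) * (zt s t + coef N j * c s) := by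
    intro t
    have hg := h.continuous_graph_at j t
    have hs := contDiff_slice hΦ t
    have hsc := hasCompactSupport_slice hc t
    have ckt : Continuous fun s => zt s t + coef N j * c s :=
      ck.comp (f := fun s : ℝ => (((s, (0 : ℝ)), t) : (ℝ × ℝ) × ℝ)) (by fun_prop)
    have c1 : Continuous fun q : ℝ × ℝ => dTime Φ (q, t) := cT.comp (Continuous.prodMk_left t)
    have c2 : Continuous fun q : ℝ × ℝ => (zt q.1 t + coef N j * c q.1) *
        d2 (fun q => Φ (q, t)) q := (ckt.comp continuous_fst).mul (continuous_d2 hs)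
    have s1 := hasCompactSupport_slice sT t
    have s2 : HasCompactSupport fun q : ℝ × ℝ => (zt q.1 t + coef N j * c q.1) *
        d2 (fun q => Φ (q, t)) q := (hasCompactSupport_d2 hsc).mul_left
    have hd : ∀ s y, HasDerivAt (fun y => Φ ((s, y), t)) (d2 (fun q => Φ (q, t)) (s, y)) y :=
      fun s y => (hasDerivAt_comp_curve (hs.differentiable one_ne_zero) (hasDerivAt_const y s)
        (hasDerivAt_id y)).congr_deriv (by simp)
    have k1 := integral_shear hg (c1.add c2) (s1.add s2)
    have k2 := integral_above_deriv_snd hg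
      (F := fun q => (zt q.1 t + coef N j * c q.1) * Φ (q, t))
      (fun s y => (hd s y).const_mul (zt s t + coef N j * c s)) c2 hsc.mul_left s2
    have i1 := (c1.integrable_of_hasCompactSupport (μ := volume) s1).integrableOn
      (s := above (graph N T c z j t))
    have i2 := (c2.integrable_of_hasCompactSupport (μ := volume) s2).integrableOn
      (s := above (graph N T c z j t))
    refine Eq.trans ?_ (k1.trans ((integral_add i1 i2).trans ?_))
    · congr 1
      ext q
      simp only [Pi.add_apply, d2, fderiv_slice hΦ]
      rfl
    · rw [k2, ← sub_eq_add_neg]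
      simp only [mul_comm]
  simp only [e1] at key
  refine ⟨key.1, key.2.trans ?_⟩
  congr 1
  exact integral_shear (h.continuous_graph_at j 0) (f := fun q => Φ (q, 0))
    (contDiff_slice hΦ 0).continuous (hasCompactSupport_slice hc 0)

/-- The transport equation in integrated form. -/
lemma transport (h : Family N T β C a c c' z zs zt) (hT'0 : 0 < T') (hT' : T' ≤ T)
    (hΦ : ContDiff ℝ 1 Φ) (hc : HasCompactSupport Φ) (hend : ∀ q, Φ (q, T') = 0) :
    ∫ t in Ioo 0 T', ((∫ q : ℝ × ℝ, stepDensity N T c z t q * dTime Φ (q, t)) -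
      ∑ j ∈ indices N, 1 / (N : ℝ) *
        ∫ s, Φ ((s, graph N T c z j t s), t) * (zt s t + coef N j * c s)) =
    -∫ q : ℝ × ℝ, stepDensity N T c z 0 q * Φ (q, 0) := by
  have cT := continuous_dTime hΦ
  have sT := hasCompactSupport_dTime hc
  have iT : ∀ t, Integrable fun q => dTime Φ (q, t) := fun t =>
    (cT.comp (Continuous.prodMk_left t)).integrable_of_hasCompactSupport
      (hasCompactSupport_slice sT t)
  have i0 : Integrable fun q => Φ (q, 0) :=
    (contDiff_slice hΦ 0).continuous.integrable_of_hasCompactSupport (hasCompactSupport_slice hc 0)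
  obtain ⟨w1, w2⟩ := integral_time (F := Φ) hT'0 cT sT
    (fun q => (hΦ.continuous.comp (Continuous.prodMk_right q)).continuousOn)
    (fun q t _ => by
      have := hasDerivAt_along hΦ (s := q.1) (y := q.2) (hasDerivAt_const t (0 : ℝ))
      simpa using this)
    hend univ
  simp only [setIntegral_univ] at w1 w2
  have w1' : IntegrableOn (fun t => -∫ q, dTime Φ (q, t)) (Ioo 0 T') := w1.neg
  have tr := fun j => h.transport_above hT'0 hT' hΦ hc hend j
  have e1 : ∀ t, ((∫ q : ℝ × ℝ, stepDensity N T c z t q * dTime Φ (q, t)) -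
      ∑ j ∈ indices N, 1 / (N : ℝ) *
        ∫ s, Φ ((s, graph N T c z j t s), t) * (zt s t + coef N j * c s)) =
      -(∫ q, dTime Φ (q, t)) + ∑ j ∈ indices N, 1 / (N : ℝ) *
        ((∫ q in above (graph N T c z j t), dTime Φ (q, t)) -
          ∫ s, Φ ((s, graph N T c z j t s), t) * (zt s t + coef N j * c s)) := by
    intro t
    rw [(h.integral_stepDensity_mul t (iT t)).2, add_sub_assoc, ← Finset.sum_sub_distrib]
    simp only [mul_sub]
  simp only [e1]
  have w3 : IntegrableOn (fun t => ∑ j ∈ indices N, 1 / (N : ℝ) *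
        ((∫ q in above (graph N T c z j t), dTime Φ (q, t)) -
          ∫ s, Φ ((s, graph N T c z j t s), t) * (zt s t + coef N j * c s))) (Ioo 0 T') :=
    integrable_finsetSum _ fun j _ => (tr j).1.const_mul _
  rw [integral_add w1' w3, integral_neg, w2, (h.integral_stepDensity_mul 0 i0).2,
    integral_finsetSum _ fun j _ => (tr j).1.const_mul _, neg_add, ← Finset.sum_neg_distrib]
  congr 1
  refine Finset.sum_congr rfl fun j _ => ?_
  rw [integral_const_mul, (tr j).2, mul_neg]

end Family

end Muskat

/-! ### Test functions and the system -/

namespace Muskat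

/-- The plane as a product. -/
noncomputable def planeEquiv : (ℝ × ℝ) ≃L[ℝ] Plane :=
  (ContinuousLinearEquiv.finTwoArrow ℝ ℝ).symm.trans (EuclideanSpace.equiv (Fin 2) ℝ).symm

lemma planeEquiv_apply (q : ℝ × ℝ) : planeEquiv q = !₂[q.1, q.2] := by
  ext i
  fin_cases i <;> rfl

/-- Space-time as a product. -/
noncomputable def spaceTimeEquiv : ((ℝ × ℝ) × ℝ) ≃L[ℝ] (Plane × ℝ) :=
  planeEquiv.prodCongr (ContinuousLinearEquiv.refl ℝ ℝ)

lemma spaceTimeEquiv_apply (q : ℝ × ℝ) (t : ℝ) : spaceTimeEquiv (q, t) = (!₂[q.1, q.2], t) := by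
  rw [← planeEquiv_apply]
  rfl

section

variable {T' : ℝ} {φ : Plane × ℝ → ℝ}

lemma IsTest.contDiff (hφ : IsTest T' φ) : ContDiff ℝ 1 (φ ∘ spaceTimeEquiv) :=
  (hφ.1.of_le (by exact_mod_cast le_top)).comp spaceTimeEquiv.contDiff

lemma IsTest.hasCompactSupport (hφ : IsTest T' φ) : HasCompactSupport (φ ∘ spaceTimeEquiv) :=
  hφ.2.1.comp_homeomorph spaceTimeEquiv.toHomeomorph

lemma IsTest.eq_zero (hφ : IsTest T' φ) (q : ℝ × ℝ) : (φ ∘ spaceTimeEquiv) (q, T') = 0 := by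
  refine image_eq_zero_of_notMem_tsupport fun hm => lt_irrefl T' ?_
  have h1 : spaceTimeEquiv (q, T') ∈ tsupport φ :=
    tsupport_comp_subset_preimage φ spaceTimeEquiv.continuous hm
  have := hφ.2.2 h1
  rwa [spaceTimeEquiv_apply] at this

lemma fderiv_comp_spaceTimeEquiv (φ : Plane × ℝ → ℝ) (p v : (ℝ × ℝ) × ℝ) :
    fderiv ℝ (φ ∘ spaceTimeEquiv) p v = fderiv ℝ φ (spaceTimeEquiv p) (spaceTimeEquiv v) := by
  rw [spaceTimeEquiv.comp_right_fderiv]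
  rfl

lemma dTime_eq (φ : Plane × ℝ → ℝ) (q : ℝ × ℝ) (t : ℝ) :
    dTime (φ ∘ spaceTimeEquiv) (q, t) = dt φ (!₂[q.1, q.2], t) := by
  rw [dTime, fderiv_comp_spaceTimeEquiv, spaceTimeEquiv_apply, dt]
  congr 1
  ext i
  · fin_cases i <;> simp [spaceTimeEquiv, planeEquiv_apply]
  · rfl

lemma IsTest.d1_eq (hφ : IsTest T' φ) (q : ℝ × ℝ) (t : ℝ) :
    d1 (fun q => (φ ∘ spaceTimeEquiv) (q, t)) q = dx 0 φ (!₂[q.1, q.2], t) := by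
  rw [d1, fderiv_slice hφ.contDiff, fderiv_comp_spaceTimeEquiv, spaceTimeEquiv_apply, dx]
  congr 1
  rw [spaceTimeEquiv_apply]
  ext i
  · fin_cases i <;> simp
  · rfl

lemma IsTest.d2_eq (hφ : IsTest T' φ) (q : ℝ × ℝ) (t : ℝ) :
    d2 (fun q => (φ ∘ spaceTimeEquiv) (q, t)) q = dx 1 φ (!₂[q.1, q.2], t) := by
  rw [d2, fderiv_slice hφ.contDiff, fderiv_comp_spaceTimeEquiv, spaceTimeEquiv_apply, dx]
  congr 1
  rw [spaceTimeEquiv_apply]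
  ext i
  · fin_cases i <;> simp
  · rfl

lemma IsTest.fderiv_apply (hφ : IsTest T' φ) (v : Plane × ℝ) :
    Continuous (fun p => fderiv ℝ φ p v) ∧ HasCompactSupport (fun p => fderiv ℝ φ p v) :=
  ⟨(hφ.1.continuous_fderiv (by simp)).clm_apply continuous_const, hφ.2.1.fderiv_apply ℝ _⟩

/-- Products of bounded functions with derivatives of test functions are integrable. -/
lemma IsTest.integrable_mul (hφ : IsTest T' φ) (v : Plane × ℝ) {f : Plane × ℝ → ℝ} {K : ℝ}
    (hf : AEStronglyMeasurable f (volume.restrict (slab T')))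
    (hK : ∀ᵐ p ∂(volume.restrict (slab T')), |f p| ≤ K) :
    IntegrableOn (fun p => f p * fderiv ℝ φ p v) (slab T') := by
  obtain ⟨h1, h2⟩ := hφ.fderiv_apply v
  exact (h1.integrable_of_hasCompactSupport (μ := volume) h2).integrableOn.bdd_mul hf hK

end

namespace Family

variable {N : ℕ} {T β C a : ℝ} {c c' : ℝ → ℝ} {z zs zt : ℝ → ℝ → ℝ} {T' : ℝ}

lemma mem_regular {t : ℝ} (ht : t ∈ Ioo 0 T') {q : ℝ × ℝ}
    (hq : ∀ j ∈ indices N, q.2 ≠ graph N T c z j t q.1) :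
    ((!₂[q.1, q.2], t) : Plane × ℝ) ∈
      {p : Plane × ℝ | 0 < p.2 ∧ p.2 < T'} ∩ offAll N T c z := ⟨ht, hq⟩

/-- Identities on the slab that hold off the interfaces may be integrated time by time. -/
lemma integral_slab_congr (h : Family N T β C a c c' z zs zt) {f : Plane × ℝ → ℝ}
    (hf : IntegrableOn f (slab T')) {F : ℝ → ℝ × ℝ → ℝ}
    (he : ∀ t ∈ Ioo 0 T', ∀ q : ℝ × ℝ, (∀ j ∈ indices N, q.2 ≠ graph N T c z j t q.1) →
      f (!₂[q.1, q.2], t) = F t q) :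
    ∫ p in slab T', f p = ∫ t in Ioo 0 T', ∫ q, F t q := by
  rw [integral_slab hf]
  refine setIntegral_congr_fun measurableSet_Ioo fun t ht => integral_congr_ae ?_
  filter_upwards [h.ae_off t] with q hq using he t ht q hq

lemma norm_velocity_le (h : Family N T β C a c c' z zs zt) (hT' : T' ≤ T) {p : Plane × ℝ}
    (hp : p ∈ {p : Plane × ℝ | 0 < p.2 ∧ p.2 < T'} ∩ offAll N T c z) :
    ‖velocity N c z p‖ ≤ 4 * IsSheet.velBound β C a := by
  rw [h.velocity_eq_plane hT' hp]
  have h1 := h.abs_u1_le p.2 (p.1 0) (p.1 1)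
  have h2 := h.abs_u2_le p.2 (p.1 0) (p.1 1)
  have h0 := (abs_nonneg _).trans h1
  refine le_of_sq_le_sq ?_ (by linarith)
  rw [norm_sq_mk]
  have h3 := sq_le_sq' (abs_le.1 h1).1 (abs_le.1 h1).2
  have h4 := sq_le_sq' (abs_le.1 h2).1 (abs_le.1 h2).2
  nlinarith

lemma norm_momentum_le {ρ K : ℝ} {u m : Plane} (hρ : |ρ| ≤ 1) (hu : ‖u‖ ≤ K)
    (hd : ‖defect ρ u m‖ ≤ 1 / 2 * (1 - ρ ^ 2)) : ‖m‖ ≤ K + 1 := by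
  have e : m = defect ρ u m + ρ • u - (1 / 2 : ℝ) • !₂[0, 1 - ρ ^ 2] := by
    rw [defect]; abel
  have hsq := (sq_le_one_iff_abs_le_one _).2 hρ
  have h1 : ‖(!₂[0, 1 - ρ ^ 2] : Plane)‖ ≤ 1 := by
    refine le_of_sq_le_sq ?_ zero_le_one
    rw [norm_sq_mk]
    nlinarith [sq_nonneg ρ]
  have h2 : ‖ρ • u‖ ≤ K := by
    rw [norm_smul, Real.norm_eq_abs]
    exact (mul_le_of_le_one_left (norm_nonneg _) hρ).trans hu
  have h3 : ‖(1 / 2 : ℝ) • (!₂[0, 1 - ρ ^ 2] : Plane)‖ ≤ 1 / 2 := by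
    rw [norm_smul]
    norm_num
    linarith
  rw [e]
  refine (norm_sub_le _ _).trans ?_
  have := norm_add_le (defect ρ u m) (ρ • u)
  nlinarith [sq_nonneg ρ]

lemma abs_apply_le (x : Plane) (i : Fin 2) : |x i| ≤ ‖x‖ := PiLp.norm_apply_le x i

/-- The system in the sense of distributions, by integration in time of its weak forms at fixed
times. -/
lemma solvesSystem (h : Family N T β C a c c' z zs zt) (hT'0 : 0 < T') (hT' : T' ≤ T) {K : ℝ}
    (hρ : ∀ᵐ p ∂(volume.restrict (slab T')), |density N c z p| ≤ 1)
    (hu : ∀ᵐ p ∂(volume.restrict (slab T')), ‖velocity N c z p‖ ≤ K)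
    (hm : ∀ᵐ p ∂(volume.restrict (slab T')), ‖momentum N T c c' z zs zt p‖ ≤ K) :
    SolvesSystem T' (initialDensity fun s => z s 0) (density N c z) (velocity N c z)
      (momentum N T c c' z zs zt) := by
  have mρ := h.aestronglyMeasurable_of_continuousOn (h.continuousOn_density hT')
  have mu := h.aestronglyMeasurable_of_continuousOn (h.continuousOn_velocity hT')
  have mm := h.aestronglyMeasurable_of_continuousOn
    (h.continuousOn_momentum (c' := c') (zs := zs) (zt := zt) hT')
  have comp : ∀ {w : Plane × ℝ → Plane}, AEStronglyMeasurable w (volume.restrict (slab T')) →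
      ∀ i, AEStronglyMeasurable (fun p => w p i) (volume.restrict (slab T')) := fun hw i =>
    (EuclideanSpace.proj i : Plane →L[ℝ] ℝ).continuous.comp_aestronglyMeasurable hw
  have bd : ∀ {w : Plane × ℝ → Plane}, (∀ᵐ p ∂(volume.restrict (slab T')), ‖w p‖ ≤ K) →
      ∀ i, ∀ᵐ p ∂(volume.restrict (slab T')), |w p i| ≤ K := fun hw i => by
    filter_upwards [hw] with p hp using (abs_apply_le _ i).trans hp
  refine ⟨fun φ hφ => ?_, fun φ hφ => ?_, fun φ hφ => ?_⟩
  · have hI : IntegrableOn (fun p => density N c z p * dt φ p +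
        (momentum N T c c' z zs zt p 0 * dx 0 φ p + momentum N T c c' z zs zt p 1 * dx 1 φ p))
        (slab T') :=
      (hφ.integrable_mul _ mρ hρ).add ((hφ.integrable_mul _ (comp mm 0) (bd hm 0)).add
        (hφ.integrable_mul _ (comp mm 1) (bd hm 1)))
    rw [h.integral_slab_congr hI (F := fun t q =>
      stepDensity N T c z t q *
          dTime (φ ∘ spaceTimeEquiv) (q, t) +
      ((stepDensity N T c z t q *
          u1 N T c z t q.1 q.2 - corrFst N T c c' z zs zt t q) *
            d1 (fun q => (φ ∘ spaceTimeEquiv) (q, t)) q +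
       (stepDensity N T c z t q *
          u2 N T c c' z zs t q.1 q.2 - corrSnd N T c c' z zs zt t q) *
            d2 (fun q => (φ ∘ spaceTimeEquiv) (q, t)) q))]
    · have hΦ := hφ.contDiff
      have hc := hφ.hasCompactSupport
      have e1 : ∀ t ∈ Ioo 0 T', ∫ q : ℝ × ℝ,
          (stepDensity N T c z t q *
          dTime (φ ∘ spaceTimeEquiv) (q, t) +
      ((stepDensity N T c z t q *
          u1 N T c z t q.1 q.2 - corrFst N T c c' z zs zt t q) *
            d1 (fun q => (φ ∘ spaceTimeEquiv) (q, t)) q +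
       (stepDensity N T c z t q *
          u2 N T c c' z zs t q.1 q.2 - corrSnd N T c c' z zs zt t q) *
            d2 (fun q => (φ ∘ spaceTimeEquiv) (q, t)) q)) =
          (∫ q : ℝ × ℝ, stepDensity N T c z t q *
              dTime (φ ∘ spaceTimeEquiv) (q, t)) -
          ∑ j ∈ indices N, 1 / (N : ℝ) * ∫ s, (φ ∘ spaceTimeEquiv) ((s, graph N T c z j t s), t) *
            (zt s t + coef N j * c s) := by
        intro t ht
        have hs := contDiff_slice hΦ t
        have hsc := hasCompactSupport_slice hc t
        have i1 := (h.integral_stepDensity_mul t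
          (((continuous_dTime hΦ).comp (Continuous.prodMk_left t)).integrable_of_hasCompactSupport
            (μ := volume) (hasCompactSupport_slice (hasCompactSupport_dTime hc) t))).1
        obtain ⟨i2, i3⟩ := h.integral_momentum ht.1 hs hsc
        rw [sub_eq_add_neg, ← i3]
        exact integral_add i1 i2
      rw [setIntegral_congr_fun measurableSet_Ioo e1,
        h.transport hT'0 hT' hΦ hc hφ.eq_zero, integral_plane, neg_add_eq_zero]
      refine integral_congr_ae (Eventually.of_forall fun q => ?_)
      simp only [Function.comp, spaceTimeEquiv_apply]
      congr 1
      have hg : ∀ j, graph N T c z j 0 = fun s => z s 0 := fun j => funext fun s => by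
        rw [graph_eq ⟨le_rfl, hT'0.le.trans hT'⟩]; ring
      simp only [hg, Finset.sum_const, card_indices, nsmul_eq_mul, initialDensity, stepDensity]
      have hN := h.N_pos
      by_cases hq : z q.1 0 < q.2
      · have hm : q ∈ above fun s => z s 0 := hq
        rw [indicator_of_mem hm]
        have : z ((!₂[q.1, q.2] : Plane) 0) 0 < (!₂[q.1, q.2] : Plane) 1 := hq
        rw [if_pos this]
        push_cast
        field_simp
        norm_num
      · have hm : q ∉ above fun s => z s 0 := hq
        rw [indicator_of_notMem hm]
        have : ¬ z ((!₂[q.1, q.2] : Plane) 0) 0 < (!₂[q.1, q.2] : Plane) 1 := hq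
        rw [if_neg this]
        simp
    · intro t ht q hq
      have hr := mem_regular ht hq
      rw [dTime_eq, hφ.d1_eq, hφ.d2_eq, momentum, h.density_eq_step_plane hT' hr,
        h.velocity_eq_plane hT' hr]
      simp
  · have hI : IntegrableOn (fun p => velocity N c z p 0 * dx 0 φ p + velocity N c z p 1 * dx 1 φ p)
        (slab T') :=
      (hφ.integrable_mul _ (comp mu 0) (bd hu 0)).add (hφ.integrable_mul _ (comp mu 1) (bd hu 1))
    rw [h.integral_slab_congr hI (F := fun t q =>
      u1 N T c z t q.1 q.2 * d1 (fun q => (φ ∘ spaceTimeEquiv) (q, t)) q +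
        u2 N T c c' z zs t q.1 q.2 * d2 (fun q => (φ ∘ spaceTimeEquiv) (q, t)) q)]
    · refine setIntegral_eq_zero_of_forall_eq_zero fun t _ => ?_
      exact h.integral_div (contDiff_slice hφ.contDiff t)
        (hasCompactSupport_slice hφ.hasCompactSupport t)
    · intro t ht q hq
      rw [hφ.d1_eq, hφ.d2_eq, h.velocity_eq_plane hT' (mem_regular ht hq)]
      simp
  · have hI : IntegrableOn (fun p => velocity N c z p 1 * dx 0 φ p - velocity N c z p 0 * dx 1 φ p)
        (slab T') :=
      (hφ.integrable_mul _ (comp mu 1) (bd hu 1)).sub (hφ.integrable_mul _ (comp mu 0) (bd hu 0))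
    have hI' : IntegrableOn (fun p => density N c z p * dx 0 φ p) (slab T') :=
      hφ.integrable_mul _ mρ hρ
    rw [h.integral_slab_congr hI (F := fun t q =>
      u2 N T c c' z zs t q.1 q.2 * d1 (fun q => (φ ∘ spaceTimeEquiv) (q, t)) q -
        u1 N T c z t q.1 q.2 * d2 (fun q => (φ ∘ spaceTimeEquiv) (q, t)) q),
      h.integral_slab_congr hI' (F := fun t q => stepDensity N T c z t q *
          d1 (fun q => (φ ∘ spaceTimeEquiv) (q, t)) q), ← integral_neg]
    · refine setIntegral_congr_fun measurableSet_Ioo fun t _ => ?_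
      exact h.integral_curl (contDiff_slice hφ.contDiff t)
        (hasCompactSupport_slice hφ.hasCompactSupport t)
    · intro t ht q hq
      rw [hφ.d1_eq, h.density_eq_step_plane hT' (mem_regular ht hq)]
      rfl
    · intro t ht q hq
      rw [hφ.d1_eq, hφ.d2_eq, h.velocity_eq_plane hT' (mem_regular ht hq)]
      simp

end Family

end Muskat

/-! ### The subsolution -/

namespace Muskat

namespace Family

variable {N : ℕ} {T β C a : ℝ} {c c' : ℝ → ℝ} {z zs zt : ℝ → ℝ → ℝ} {T' M cmax θ ε : ℝ}

/-- The momentum defined from the slips gives an admissible subsolution as long as the slips are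
small. -/
lemma isAdmissibleSubsolution (h : Family N T β C a c c' z zs zt) (hT'0 : 0 < T') (hT' : T' ≤ T)
    (hs : IsSmall N T M cmax θ ε) (hb : ∀ t ∈ Ioo 0 T', SlipBound N T c c' z zs zt ε t)
    (hcm : ∀ s, c s ≤ cmax) (hzs : ∀ s, ∀ t ∈ Icc 0 T, |zs s t| ≤ M * √(c s))
    (hcs : ∀ s, |c' s| ≤ M * √(c s)) :
    IsAdmissibleSubsolution T' (initialDensity fun s => z s 0) (density N c z) (velocity N c z)
      (momentum N T c c' z zs zt) (omegaPlus c z T') (omegaMinus c z T') (omegaMix c z T')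
      (interfaces N c z T') := by
  have key := fun p hp => h.strict_mix (p := p) hT' hs hb hcm hzs hcs hp
  have bρ : ∀ᵐ p ∂(volume.restrict (slab T')), |density N c z p| ≤ 1 := by
    filter_upwards [h.ae_regular T'] with p hp using (key p hp).2.2
  have bu : ∀ᵐ p ∂(volume.restrict (slab T')),
      ‖velocity N c z p‖ ≤ 4 * IsSheet.velBound β C a + 1 := by
    filter_upwards [h.ae_regular T'] with p hp
    exact (h.norm_velocity_le hT' hp).trans (by linarith)
  have bm : ∀ᵐ p ∂(volume.restrict (slab T')),
      ‖momentum N T c c' z zs zt p‖ ≤ 4 * IsSheet.velBound β C a + 1 := by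
    filter_upwards [h.ae_regular T'] with p hp
    exact norm_momentum_le (key p hp).2.2 (h.norm_velocity_le hT' hp) (key p hp).1
  have hreg : omegaMix c z T' \ interfaces N c z T' ⊆
      {p : Plane × ℝ | 0 < p.2 ∧ p.2 < T'} ∩ offAll N T c z := by
    rw [omegaMix_diff hT']
    exact fun p hp => ⟨⟨hp.1.1, hp.1.2.1⟩, hp.2⟩
  exact
    { bounded_ρ := memLp_top_of_bound
        (h.aestronglyMeasurable_of_continuousOn (h.continuousOn_density hT')) 1 bρ
      bounded_u := memLp_top_of_bound
        (h.aestronglyMeasurable_of_continuousOn (h.continuousOn_velocity hT')) _ bu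
      bounded_m := memLp_top_of_bound
        (h.aestronglyMeasurable_of_continuousOn (h.continuousOn_momentum hT')) _ bm
      domain_p := ⟨h.isOpen_omegaPlus hT', h.isConnected_omegaPlus hT'0 hT',
        fun p hp => ⟨hp.1.le, hp.2.1⟩⟩
      domain_m := ⟨h.isOpen_omegaMinus hT', h.isConnected_omegaMinus hT'0 hT',
        fun p hp => ⟨hp.1.le, hp.2.1⟩⟩
      domain_mix := ⟨h.isOpen_omegaMix hT', h.isConnected_omegaMix hT'0 hT',
        fun p hp => ⟨hp.1.le, hp.2.1⟩⟩
      cover := h.cover hT'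
      system := h.solvesSystem hT'0 hT' bρ bu bm
      inequality := by
        filter_upwards [h.ae_regular T'] with p hp using (key p hp).1
      pure_phase := fun p hp => h.abs_density_pure hp
      null_S := h.volume_interfaces hT'
      isOpen_diff := by
        rw [omegaMix_diff hT']
        exact (h.isOpen_omegaMix hT').inter h.isOpen_offAll
      continuous_ρ := (h.continuousOn_density hT').mono hreg
      continuous_u := (h.continuousOn_velocity hT').mono hreg
      continuous_m := (h.continuousOn_momentum hT').mono hreg
      strict := fun p hp => (key p (hreg hp)).2.1 hp.1 }

end Family

end Muskat

theorem proposition2p1 (N : ℕ) (hN : 1 ≤ N) (T : ℝ) (hT : 0 < T)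
    (α α' β cmax M : ℝ) (hα : 0 < α ∧ α < 1) (hα' : 0 < α' ∧ α' < 1)
    (z ztilde : ℝ → ℝ → ℝ) (c : ℝ → ℝ)
    (hz : ∀ s, ∀ t ∈ Icc 0 T, z s t = β * s + ztilde s t)
    (hztilde : Muskat.C1InTime 1 α T ztilde)
    (hc : Differentiable ℝ c) (hc' : Muskat.MemStar 0 α' (deriv c))
    (hcpos : ∀ s, 0 < c s) (hcle : ∀ s, c s ≤ cmax)
    (hcmax : cmax < (2 * (N : ℝ) - 1) / N)
    (h1 : ∀ i ∈ Muskat.indices N,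
      Tendsto (fun t => ⨆ s : ℝ, ENNReal.ofReal
          (1 / c s * |deriv (fun τ => z s τ) t - Muskat.normalVelocity N c z i s t|))
        (𝓝[>] 0) (𝓝 0))
    (h2 : Tendsto (fun t => ⨆ s : ℝ, ENNReal.ofReal
          (1 / (t * c s ^ (3 / 2 : ℝ)) *
            |∫ s' in (0 : ℝ)..s, (deriv (fun τ => z s' τ) t -
              ∑ i ∈ Finset.Icc 1 N,
                (Muskat.normalVelocity N c z (i : ℤ) s' t +
                  Muskat.normalVelocity N c z (-(i : ℤ)) s' t) / (2 * N))|))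
        (𝓝[>] 0) (𝓝 0))
    (hM : 0 < M)
    (h3 : ∀ s, ∀ t ∈ Icc 0 T,
      |deriv (fun s' => z s' t) s| ≤ M * c s ^ (1 / 2 : ℝ) ∧
      |deriv c s| ≤ M * c s ^ (1 / 2 : ℝ)) :
    ∃ T' : ℝ, 0 < T' ∧ T' ≤ T ∧ ∃ m : Muskat.Plane × ℝ → Muskat.Plane,
      Muskat.IsAdmissibleSubsolution T' (Muskat.initialDensity (fun s => z s 0))
        (Muskat.density N c z) (Muskat.velocity N c z) m
        (Muskat.omegaPlus c z T') (Muskat.omegaMinus c z T') (Muskat.omegaMix c z T')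
        (Muskat.interfaces N c z T') := by
  obtain ⟨C, a, zs, zt, h⟩ := Muskat.exists_family hN hT hα hα' hz hztilde hc hc' hcpos hcle
  obtain ⟨θ, ε, hs⟩ := Muskat.exists_isSmall hN hT hM hcmax
  obtain ⟨δ, hδ, hsub⟩ := mem_nhdsGT_iff_exists_Ioo_subset.1
    (h.eventually_slipBound h1 h2 hs.ε_pos)
  have hds : ∀ s, ∀ t ∈ Icc 0 T, deriv (fun s' => z s' t) s = zs s t := fun s t ht => by
    have := (h.deriv_s s t).deriv
    rwa [Muskat.clamp_of_mem ht] at this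
  refine ⟨min δ T, lt_min hδ hT, min_le_right _ _, _, h.isAdmissibleSubsolution (lt_min hδ hT)
    (min_le_right _ _) hs (fun t ht => hsub ⟨ht.1, ht.2.trans_le (min_le_left _ _)⟩) hcle
    (fun s t ht => ?_) fun s => ?_⟩
  · rw [← hds s t ht, Real.sqrt_eq_rpow]
    exact (h3 s t ht).1
  · rw [Real.sqrt_eq_rpow]
    exact (h3 s 0 ⟨le_rfl, hT.le⟩).2
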